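/- Let $M$ be a compact complex manifold of dimension $m$, let $1\le k\le m$, and let $(L_1,h_1),\dots,(L_k,h_k)$ be holomorphic line bundles on $M$ with smooth Hermitian metrics. For each $j$ let $\mathcal S_j\subset H^0(M,L_j)$ be a nonzero (finite-dimensional) subspace with an inner product, let $(S^j_l)_{1\le l\le d_j}$ be an orthonormal basis of $\mathcal S_j$, and let $\gamma_j$ be the associated Gaussian probability measure, i.e. the law of $\sum_l c_l S^j_l$ where $c\in\mathbb C^{d_j}$ has law $\pi^{-d_j}e^{-|c|^2}\,dc$. Put $\Pi_{\mathcal S_j}(z,z)=\sum_l\|S^j_l(z)\|_{h_j}^2$; let $c_1(L_j,h_j)=\frac{\sqrt{-1}}{2\pi}\partial\bar\partial\log\|e\|_{h_j}^{-2}$ ($e$ a local holomorphic frame of $L_j$) be the curvature form; let $\Phi_{\mathcal S_j}:M\dashrightarrow\mathbb{CP}^{d_j-1}$, $z\mapsto[f_1(z),\dots,f_{d_j}(z)]$ where $S^j_l=f_l e$, be the Kodaira map; and let $\omega_{FS}=\frac{\sqrt{-1}}{2\pi}\partial\bar\partial\log\|\zeta\|^2$ be the Fubini–Study form. For sections $s_1,\dots,s_k$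 the zero current $Z_{s_1,\dots,s_k}$ is the current of integration over the set of regular points (common zeros at which the differentials of $s_1,\dots,s_k$ are linearly independent) of the common zero set $|Z_{s_1,\dots,s_k}|$. Let $U\subset M$ be an open set on which no $\mathcal S_j$ has base points: for all $z\in U$ and all $j$ there is $s\in\mathcal S_j$ with $s(z)\neq0$. Then for $\gamma_1\times\cdots\times\gamma_k$-almost every $(s_1,\dots,s_k)$ all points of $|Z_{s_1,\dots,s_k}|\cap U$ are regular points; for each test form $\phi$ of degree $2(m-k)$ with compact support in $U$, $(Z_{s_1,\dots,s_k},\phi)$ is almost surely defined and is an integrable random variable; and likewise, for each $j$, $(Z_{s_j},\phi)$ with respect to $\gamma_j$, for test forms $\phi$ of degree $2(m-1)$. The expected zero currents $\mathbf E_{\gamma_j}(Z_{s_j})$ are smooth $(1,1)$-forms on $U$, and on $U$ $$\mathbf E_{\gamma_1\times\cdots\times\gamma_k}(Z_{s_1,\dots,s_k})=\bigwedge_{j=1}^k\mathbf E_{\gamma_j}(Z_{s_j})=\bigwedge_{j=1}^k\Big[\frac{\sqrt{-1}}{2\pi}\partial\bar\partial\log\Pi_{\mathcal S_j}(z,z)+c_1(L_j,h_j)\Big]=\bigwedge_{j=1}^k\Phi_{\mathcal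 S_j}^*\omega_{FS},$$ where moreover $\mathbf E_{\gamma_j}(Z_{s_j})=\frac{\sqrt{-1}}{2\pi}\partial\bar\partial\log\Pi_{\mathcal S_j}(z,z)+c_1(L_j,h_j)=\Phi_{\mathcal S_j}^*\omega_{FS}$ on $U$ for each $j$. -/

import Mathlib

open scoped Manifold ContDiff Topology
open MeasureTheory Bundle

noncomputable section

namespace RandomZeros

/-! ### Differential forms on complex manifolds

A complex manifold of dimension `m` is modelled on `Fin m → ℂ`.  Its tangent space at `x` is, as in
Mathlib, `Fin m → ℂ` itself, through the preferred chart at `x`. -/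

/-- Alternating real `n`-linear complex valued forms on `ℂ^m`. -/
abbrev Alt (m n : ℕ) : Type := (Fin m → ℂ) [⋀^Fin n]→ₗ[ℝ] ℂ

/-- Complex valued differential forms of degree `n` on `M` (no regularity): the value at `x` is a
form on the tangent space at `x`. -/
abbrev DForm (m : ℕ) (M : Type*) (n : ℕ) : Type _ := M → Alt m n

/-- Wedge product of alternating forms (sum over shuffles, so that `dx ∧ dy` is `1` on the
standard frame). -/
def wedge {m a b : ℕ} (α : Alt m a) (β : Alt m b) : Alt m (a + b) :=
  ((LinearMap.mul' ℝ ℂ).compAlternatingMap (α.domCoprod β)).domDomCongr finSumFinEquiv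

/-- The wedge product `α₁ ∧ ⋯ ∧ α_k` of `k` two-forms. -/
def wedgeAll {m : ℕ} : (k : ℕ) → (Fin k → Alt m 2) → Alt m (2 * k)
  | 0, _ => AlternatingMap.constOfIsEmpty ℝ (Fin m → ℂ) (Fin 0) (1 : ℂ)
  | k + 1, α => wedge (wedgeAll k fun j => α j.castSucc) (α (Fin.last k))

/-- Wedge product of a form of degree `2q` with one of complementary degree, as a form of top
degree `2m`. -/
def wedgeTop {m q : ℕ} (hq : q ≤ m) (α : Alt m (2 * q)) (β : Alt m (2 * (m - q))) :
    Alt m (2 * m) :=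
  (wedge α β).domDomCongr (finCongr (by omega))

section Forms

variable {m : ℕ} {M : Type*} [TopologicalSpace M] [ChartedSpace (Fin m → ℂ) M]

/-- The real differential of a map between complex manifolds. -/
def realDeriv {p : ℕ} {N : Type*} [TopologicalSpace N] [ChartedSpace (Fin p → ℂ) N]
    (g : N → M) (x : N) : (Fin p → ℂ) →L[ℝ] (Fin m → ℂ) :=
  mfderiv 𝓘(ℝ, Fin p → ℂ) 𝓘(ℝ, Fin m → ℂ) g x

/-- Pull-back of a differential form by a map. -/
def pullback {p n : ℕ} {N : Type*} [TopologicalSpace N] [ChartedSpace (Fin p → ℂ) N]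
    (g : N → M) (η : DForm m M n) : DForm p N n :=
  fun x => (η (g x)).compLinearMap (realDeriv g x).toLinearMap

/-- A form is `C^∞` on the open set `U` if its coefficients in the charts are. -/
def SmoothFormOn {n : ℕ} (η : DForm m M n) (U : Set M) : Prop :=
  ∀ (x₀ : M) (v : Fin n → (Fin m → ℂ)),
    ContDiffOn ℝ ∞ (fun y => pullback (chartAt (Fin m → ℂ) x₀).symm η y v)
      ((chartAt (Fin m → ℂ) x₀).target ∩ (chartAt (Fin m → ℂ) x₀).symm ⁻¹' U)

/-- Test forms on `U`: smooth forms with compact support in `U`. -/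
def IsTestForm {n : ℕ} (U : Set M) (φ : DForm m M n) : Prop :=
  SmoothFormOn φ Set.univ ∧ ∃ K : Set M, IsCompact K ∧ K ⊆ U ∧ ∀ x ∉ K, φ x = 0

/-- `∂̄u` on `ℂ^m`: the complex antilinear part `v ↦ (du(v) + i du(iv)) / 2` of `du`. -/
def dbar (u : (Fin m → ℂ) → ℂ) (y : Fin m → ℂ) : (Fin m → ℂ) →L[ℝ] ℂ :=
  (2⁻¹ : ℂ) • (fderiv ℝ u y +
    Complex.I • (fderiv ℝ u y).comp
      ((Complex.I • ContinuousLinearMap.id ℂ (Fin m → ℂ)).restrictScalars ℝ))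

/-- `(√-1 / 2π) ∂∂̄u` for a real function `u` on `ℂ^m`; here `∂∂̄u = d∂̄u`, since `∂̄∂̄ = 0`. -/
def ddc (u : (Fin m → ℂ) → ℝ) (y : Fin m → ℂ) : Alt m 2 :=
  (Complex.I / (2 * Real.pi) : ℂ) •
    (extDeriv (𝕜 := ℝ) (fun y => ContinuousAlternatingMap.ofSubsingleton ℝ (Fin m → ℂ) ℂ (0 : Fin 1)
      (dbar (fun z => (u z : ℂ)) y)) y).toAlternatingMap

/-- `(√-1 / 2π) ∂∂̄u` at the point `x` of a complex manifold, computed in the preferred chart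
at `x`. -/
def ddcAt (u : M → ℝ) (x : M) : Alt m 2 :=
  ddc (u ∘ (chartAt (Fin m → ℂ) x).symm) (chartAt (Fin m → ℂ) x x)

/-! ### Integration over complex submanifolds -/

/-- The real frame `∂/∂x₁, ∂/∂y₁, …, ∂/∂x_p, ∂/∂y_p` of `ℂ^p`. -/
def stdFrame (p : ℕ) (i : Fin (2 * p)) : Fin p → ℂ :=
  Pi.single ⟨i / 2, by omega⟩ (if (i : ℕ) % 2 = 0 then 1 else Complex.I)

variable (m M) in
/-- A measurable piece of a `p`-dimensional complex submanifold of `M`: an injective holomorphic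
immersion of an open subset of `ℂ^p`, and a Borel subset of its domain. -/
structure Patch (p : ℕ) where
  /-- the parametrization -/
  map : (Fin p → ℂ) → M
  /-- its domain -/
  dom : Set (Fin p → ℂ)
  isOpen_dom : IsOpen dom
  holo : ContMDiffOn 𝓘(ℂ, Fin p → ℂ) 𝓘(ℂ, Fin m → ℂ) ω map dom
  injOn : Set.InjOn map dom
  immersion : ∀ w ∈ dom, Function.Injective (realDeriv (m := m) (p := p) map w)
  /-- the piece used -/
  carrier : Set (Fin p → ℂ)
  carrier_subset : carrier ⊆ dom
  measurableSet_carrier : MeasurableSet carrier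

/-- The coefficient of the pull-back of a `2p`-form with respect to
`dx₁ ∧ dy₁ ∧ ⋯ ∧ dx_p ∧ dy_p`. -/
def Patch.density {p : ℕ} (P : Patch m M p) (η : DForm m M (2 * p)) (w : Fin p → ℂ) : ℂ :=
  pullback P.map η w (stdFrame p)

/-- `HasIntegralOver p Z η a`: the integral of the `2p`-form `η` over the `p`-dimensional complex
submanifold `Z` of `M`, with its complex orientation, converges absolutely and equals `a`.  The
integral is computed by cutting `Z` into countably many disjoint pieces, each of them
parametrized holomorphically; by the change of variables formula its value does not depend on the
pieces. -/
def HasIntegralOver (p : ℕ) (Z : Set M) (η : DForm m M (2 * p)) (a : ℂ) : Prop :=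
  ∃ (ι : Type) (_ : Countable ι) (P : ι → Patch m M p),
    Pairwise (fun i i' => Disjoint ((P i).map '' (P i).carrier) ((P i').map '' (P i').carrier)) ∧
    (⋃ i, (P i).map '' (P i).carrier) = Z ∧
    (∀ i, IntegrableOn ((P i).density η) (P i).carrier) ∧
    Summable (fun i => ∫ w in (P i).carrier, ‖(P i).density η w‖) ∧
    HasSum (fun i => ∫ w in (P i).carrier, (P i).density η w) a

/-- For a random subset `Z ω'` of `M`, which is almost surely on `U` a complex submanifold of
codimension `q`: over `U`, the expectation of the current of integration over `Z` is the current
given by the `2q`-form `β`.  That is, for each test form `φ` on `U`, the pairing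
`X = (Z, φ) = ∫_{Z ∩ U} φ` is almost surely defined, it is an integrable random variable, and
`𝔼 X = ∫_U β ∧ φ`.
(No bidegree is imposed on `φ`: forms of bidegree `(m - q, m - q)` are a special case.) -/
def ExpectedCurrentEq {Ω : Type*} [MeasurableSpace Ω] (γ : Measure Ω) (Z : Ω → Set M) (U : Set M)
    {q : ℕ} (hq : q ≤ m) (β : DForm m M (2 * q)) : Prop :=
  ∀ φ : DForm m M (2 * (m - q)), IsTestForm U φ →
    ∃ X : Ω → ℂ,
      (∀ᵐ s ∂γ, HasIntegralOver (m - q) (Z s ∩ U) φ (X s)) ∧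
      Integrable X γ ∧
      HasIntegralOver m U (fun x => wedgeTop hq (β x) (φ x)) (∫ s, X s ∂γ)

end Forms

/-! ### Complex projective space and the Fubini-Study form -/

/-- Complex projective space `ℂℙ^n`. -/
abbrev CP (n : ℕ) : Type := Projectivization ℂ (Fin (n + 1) → ℂ)

/-- The quotient topology. -/
instance (n : ℕ) : TopologicalSpace (CP n) :=
  inferInstanceAs (TopologicalSpace (Quotient (projectivizationSetoid ℂ (Fin (n + 1) → ℂ))))

/-- The `i`-th homogeneous coordinate does not vanish. -/
def coordNeZero {n : ℕ} (i : Fin (n + 1)) : CP n → Prop :=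
  Projectivization.lift (fun v => v.1 i ≠ 0) (by
    rintro ⟨a, ha⟩ ⟨b, hb⟩ t (rfl : a = t • b)
    have ht : t ≠ 0 := fun h => ha (by simp [h])
    simp [ht])

/-- Affine coordinates `(ζ_l / ζ_i)_{l ≠ i}`. -/
def affineCoord {n : ℕ} (i : Fin (n + 1)) : CP n → (Fin n → ℂ) :=
  Projectivization.lift (fun v l => v.1 (i.succAbove l) / v.1 i) (by
    rintro ⟨a, ha⟩ ⟨b, hb⟩ t (rfl : a = t • b)
    have ht : t ≠ 0 := fun h => ha (by simp [h])
    funext l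
    simp [mul_div_mul_left _ _ ht])

/-- The vector with `i`-th coordinate `1` and the other coordinates given by `w`. -/
def affineVec {n : ℕ} (i : Fin (n + 1)) (w : Fin n → ℂ) : {v : Fin (n + 1) → ℂ // v ≠ 0} :=
  ⟨i.insertNth (α := fun _ => ℂ) 1 w, fun h => by simpa using congrFun h i⟩

lemma isOpen_coordNeZero {n : ℕ} (i : Fin (n + 1)) : IsOpen {p : CP n | coordNeZero i p} := by
  have : IsOpen {v : {v : Fin (n + 1) → ℂ // v ≠ 0} | v.1 i ≠ 0} :=
    isOpen_ne.preimage ((continuous_apply i).comp continuous_subtype_val)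
  exact this

/-- The affine chart `{ζ_i ≠ 0} → ℂ^n` of `ℂℙ^n`. -/
def affineChart {n : ℕ} (i : Fin (n + 1)) : OpenPartialHomeomorph (CP n) (Fin n → ℂ) where
  toFun := affineCoord i
  invFun w := Projectivization.mk' ℂ (affineVec i w)
  source := {p | coordNeZero i p}
  target := Set.univ
  map_source' _ _ := trivial
  map_target' w _ := by
    change (affineVec i w).1 i ≠ 0
    simp [affineVec]
  left_inv' p hp := by
    revert hp
    refine Projectivization.ind (fun v hv hp => ?_) p
    have hi : v i ≠ 0 := hp
    refine (Projectivization.mk_eq_mk_iff' ℂ _ _ _ _).2 ⟨(v i)⁻¹, ?_⟩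
    funext l
    rcases Fin.eq_self_or_eq_succAbove i l with rfl | ⟨l, rfl⟩
    · simp [hi]
    · simp [affineCoord, div_eq_inv_mul]
  right_inv' w _ := by
    funext l
    change (affineVec i w).1 (i.succAbove l) / (affineVec i w).1 i = w l
    simp [affineVec]
  open_source := isOpen_coordNeZero i
  open_target := isOpen_univ
  continuousOn_toFun := by
    have hq : Topology.IsQuotientMap
        (Quotient.mk (projectivizationSetoid ℂ (Fin (n + 1) → ℂ))) := isQuotientMap_quotient_mk'
    refine (hq.continuousOn_isOpen_iff (isOpen_coordNeZero i)).2 ?_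
    change ContinuousOn (fun (v : {v : Fin (n + 1) → ℂ // v ≠ 0}) l => v.1 (i.succAbove l) / v.1 i)
      {v | v.1 i ≠ 0}
    refine continuousOn_pi.2 fun l => ContinuousOn.div ?_ ?_ fun v hv => hv
    · exact ((continuous_apply _).comp continuous_subtype_val).continuousOn
    · exact ((continuous_apply _).comp continuous_subtype_val).continuousOn
  continuousOn_invFun := by
    refine Continuous.continuousOn ?_
    refine continuous_quotient_mk'.comp (Continuous.subtype_mk ?_ _)
    exact Continuous.finInsertNth i continuous_const continuous_id

lemma exists_coordNeZero {n : ℕ} (p : CP n) : ∃ i, coordNeZero i p := by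
  exact Projectivization.ind (fun v hv => Function.ne_iff.1 hv) p

/-- The manifold structure of `ℂℙ^n` given by the affine charts. -/
instance (n : ℕ) : ChartedSpace (Fin n → ℂ) (CP n) where
  atlas := Set.range affineChart
  chartAt p := affineChart (exists_coordNeZero p).choose
  mem_chart_source p := (exists_coordNeZero p).choose_spec
  chart_mem_atlas _ := ⟨_, rfl⟩

/-- The Fubini-Study form `ω_FS = (√-1 / 2π) ∂∂̄ log ‖ζ‖²` of `ℂℙ^n`; in affine coordinates `w`
it is `(√-1 / 2π) ∂∂̄ log (1 + ‖w‖²)`. -/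
def fubiniStudy (n : ℕ) : DForm n (CP n) 2 :=
  fun p => ddc (fun w => Real.log (1 + ∑ l, ‖w l‖ ^ 2)) (chartAt (Fin n → ℂ) p p)

/-! ### Hermitian holomorphic line bundles, their sections, and Gaussian measures -/

section Bundles

variable {m : ℕ} {M : Type*} [TopologicalSpace M] [ChartedSpace (Fin m → ℂ) M]
  (L : M → Type*) [∀ x, TopologicalSpace (L x)] [TopologicalSpace (TotalSpace ℂ L)]
  [∀ x, AddCommGroup (L x)] [∀ x, Module ℂ (L x)] [FiberBundle ℂ L]

/-- The space `H⁰(M, L)` of holomorphic sections of `L`. -/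
abbrev HolSection [VectorBundle ℂ ℂ L] : Type _ :=
  ContMDiffSection 𝓘(ℂ, Fin m → ℂ) ℂ ω L

/-- The local holomorphic frame of `L` around `x₀` given by the preferred trivialization
at `x₀`. -/
def localFrame (x₀ y : M) : L y := (trivializationAt ℂ L x₀).symm y 1

/-- A smooth Hermitian metric on the line bundle `L`. -/
structure HermitianMetric where
  /-- the Hermitian inner products on the fibres -/
  core : ∀ x, InnerProductSpace.Core ℂ (L x)
  smooth : ∀ x₀ : M, ContMDiffOn 𝓘(ℝ, Fin m → ℂ) 𝓘(ℝ, ℝ) ∞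
    (fun y => ((core y).inner (localFrame L x₀ y) (localFrame L x₀ y)).re)
    (trivializationAt ℂ L x₀).baseSet

variable {L}

/-- `‖v‖_h²`. -/
def HermitianMetric.normSq (h : HermitianMetric (m := m) L) {x : M} (v : L x) : ℝ :=
  ((h.core x).inner v v).re

/-- The curvature form `c₁(L, h) = (√-1 / 2π) ∂∂̄ log a`, with `a = ‖e‖_h⁻²` for a local
holomorphic frame `e`. -/
def chernForm (h : HermitianMetric (m := m) L) : DForm m M 2 :=
  fun x => ddcAt (fun y => Real.log (h.normSq (localFrame L x y))⁻¹) x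

variable [VectorBundle ℂ ℂ L]

/-- The function `f` with `s = f e` in the preferred trivialization at `x₀`. -/
def localRep (s : HolSection (m := m) L) (x₀ y : M) : ℂ :=
  (trivializationAt ℂ L x₀ ⟨y, s y⟩).2

/-- The differential at `z` of a section in the preferred trivialization at `z`.  At a zero of the
section it does not depend on the trivialization. -/
def sectionDeriv (s : HolSection (m := m) L) (z : M) : (Fin m → ℂ) →L[ℂ] ℂ :=
  mfderiv 𝓘(ℂ, Fin m → ℂ) 𝓘(ℂ, ℂ) (localRep s z) z

/-- The measurable structure of a (finite dimensional) space of sections: the coarsest one for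
which the linear functionals are Borel. -/
instance sectionMeasurableSpace (S : Submodule ℂ (HolSection (m := m) L)) : MeasurableSpace S :=
  ⨆ f : Module.Dual ℂ S, MeasurableSpace.comap f (borel ℂ)

/-- The Gaussian measure `π^{-d} e^{-|c|²} dc` on `ℂ^d`. -/
def stdComplexGaussian (d : ℕ) : Measure (Fin d → ℂ) :=
  volume.withDensity fun c => ENNReal.ofReal (Real.exp (-∑ l, ‖c l‖ ^ 2) / Real.pi ^ d)

/-- The Gaussian measure on `S` associated with the inner product for which `b` is orthonormal: the
law of `∑ c_l b_l`, where `c` has the law `π^{-d} e^{-|c|²} dc`. -/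
def gaussianMeasure {S : Submodule ℂ (HolSection (m := m) L)} {d : ℕ} (b : Module.Basis (Fin d) ℂ S) :
    Measure S :=
  (stdComplexGaussian d).map fun c => ∑ l, c l • b l

/-- The map whose law defines `gaussianMeasure` is measurable. -/
lemma measurable_sum_smul_basis {S : Submodule ℂ (HolSection (m := m) L)} {d : ℕ}
    (b : Module.Basis (Fin d) ℂ S) : Measurable fun c : Fin d → ℂ => ∑ l, c l • b l := by
  refine measurable_iff_comap_le.2 ?_
  change MeasurableSpace.comap _ (⨆ f : Module.Dual ℂ S, MeasurableSpace.comap f (borel ℂ)) ≤ _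
  rw [MeasurableSpace.comap_iSup]
  refine iSup_le fun f => ?_
  rw [MeasurableSpace.comap_comp, ← BorelSpace.measurable_eq (α := ℂ)]
  refine measurable_iff_comap_le.1 ?_
  change Measurable fun c : Fin d → ℂ => f (∑ l, c l • b l)
  simp only [map_sum, map_smul]
  fun_prop

/-- The Szegő kernel on the diagonal, `Π_S(z, z) = ∑ ‖S_l(z)‖_h²` for an orthonormal basis. -/
def szegoDiag (h : HermitianMetric (m := m) L) {S : Submodule ℂ (HolSection (m := m) L)} {d : ℕ}
    (b : Module.Basis (Fin d) ℂ S) (z : M) : ℝ :=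
  ∑ l, h.normSq ((b l : HolSection (m := m) L) z)

/-- The form `(√-1 / 2π) ∂∂̄ log Π_S(z, z) + c₁(L, h)`. -/
def expectedForm (h : HermitianMetric (m := m) L) {S : Submodule ℂ (HolSection (m := m) L)} {d : ℕ}
    (b : Module.Basis (Fin d) ℂ S) : DForm m M 2 :=
  fun x => ddcAt (fun z => Real.log (szegoDiag h b z)) x + chernForm h x

open scoped Classical in
/-- The Kodaira map `Φ_S : M ⇢ ℂℙ^n`, `z ↦ [f_0(z), …, f_n(z)]`, where the orthonormal basis is
`S_l = f_l e` in a local frame `e` (with an irrelevant value at base points). -/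
def kodairaMap {S : Submodule ℂ (HolSection (m := m) L)} {n : ℕ}
    (b : Module.Basis (Fin (n + 1)) ℂ S) (z : M) : CP n :=
  if hz : (fun l => localRep (b l : HolSection (m := m) L) z z) ≠ 0 then
    Projectivization.mk ℂ _ hz
  else Projectivization.mk' ℂ (affineVec 0 0)

end Bundles

section Zeros

variable {m : ℕ} {M : Type*} [TopologicalSpace M] [ChartedSpace (Fin m → ℂ) M]
  {k : ℕ} {L : Fin k → M → Type*} [∀ j x, TopologicalSpace (L j x)]
  [∀ j, TopologicalSpace (TotalSpace ℂ (L j))]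
  [∀ j x, AddCommGroup (L j x)] [∀ j x, Module ℂ (L j x)] [∀ j, FiberBundle ℂ (L j)]
  [∀ j, VectorBundle ℂ ℂ (L j)]

/-- The common zeros of `s₁, …, s_k`. -/
def zeroSet (s : ∀ j, HolSection (m := m) (L j)) : Set M := {z | ∀ j, s j z = 0}

/-- The points of the zero set `|Z_{s₁, …, s_k}|` at which it is a complex submanifold of
codimension `k` without multiplicity: the common zeros at which the differentials of the sections
are linearly independent.  The zero current `Z_{s₁, …, s_k}` is integration over this set. -/
def regularZeros (s : ∀ j, HolSection (m := m) (L j)) : Set M :=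
  {z | (∀ j, s j z = 0) ∧ LinearIndependent ℂ fun j => sectionDeriv (s j) z}

end Zeros

end RandomZeros

end

open RandomZeros

noncomputable section

namespace RandomZeros

/-! ### Algebra of wedge products -/

section Wedge

variable {m a b : ℕ}

/-! Locally the zero equations can be solved for one Gaussian coefficient per section. Over a chart
on which a distinguished basis section of each space has no zeros, let g_j be the vector of
quotients of the other basis sections by the distinguished one. Then s_j vanishes at z exactly when
its distinguished coefficient c_j equals G_j(z, a) = -∑ a_{j,i} g_{j,i}(z), where a collects the
remaining coefficients. So the incidence variety of pairs (point, tuple of sections vanishing there)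
is the graph of G over the pairs (z, a), and the zero set of a tuple is the slice of this graph with
given (a, c).

Averaging the integral of φ over these slices against the Gaussian density of c is a coarea
computation. Where the differentials d_z G_j are independent, G(·, a) is completed by a linear map
to holomorphic coordinates. The change of variables then produces the integral over z of the
Gaussian density at G(z, a) times the coefficient of ⋀ (i/2) dG_j ∧ conj dG_j ∧ φ
(`wedgeCoeff_tauForm_mul`, `GraphChart.det_smul_dens`, `GraphChart.integrable_pieceDens`). Points
with dependent differentials contribute nothing to this integral
(`wedgeAll_tauForm_eq_zero_of_not_surjective`), and by Sard's theorem they almost surely do not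
occur among the zeros (`ae_surjective_graphDeriv`).

It remains to average over a. Since dG_j is linear in a_j, the integrand is a sum of products over
j, and independence of the sections moves the expectation inside the wedge product
(`integral_incidenceDensity`). One factor is a second moment of a Gaussian vector weighted by
exp(-|a·g|²), a rank one perturbation of the exponent (`integral_exp_mul_dot_mul_conj_dot`). Its
value is exactly the coefficient matrix of (i/2π) ∂∂̄ log(1 + |g|²)
(`sum_weightedMoment_smul_tauForm`), which is the Fubini–Study form pulled back by the Kodaira map
in affine coordinates. It is also the curvature expression: with f the distinguished section in a
frame e, one has Π = |f|² (1 + |g|²) ‖e‖², where log |f|² is pluriharmonic and log ‖e‖² cancels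
against the Chern form (`expectedForm_eq_ddc`).

To globalise, U is cut into countably many disjoint pieces inside compact subsets of such charts
(`CoverPieces`), and the incidence variety over each piece is cut further along charts of the graph
(`GraphPieces`). The support of φ meets finitely many pieces of U, so all L¹ norms are summable, and
Fubini's theorem for series (`hasSum_integral_slices`) exchanges expectation and sum. -/

lemma wedge_apply (α : Alt m a) (β : Alt m b) (v : Fin (a + b) → Fin m → ℂ) :
    wedge α β v = ∑ σ : Equiv.Perm.ModSumCongr (Fin a) (Fin b),
      ((Equiv.Perm.sign σ.out : ℤ) : ℂ) *
        (α (fun i => v (finSumFinEquiv (σ.out (Sum.inl i)))) *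
          β (fun j => v (finSumFinEquiv (σ.out (Sum.inr j))))) := by
  simp only [wedge, AlternatingMap.domDomCongr_apply, LinearMap.compAlternatingMap_apply,
    AlternatingMap.domCoprod_apply]
  rw [_root_.sum_apply, map_sum]
  refine Finset.sum_congr rfl fun σ _ => ?_
  conv_lhs => rw [← Quotient.out_eq' σ]
  rw [AlternatingMap.domCoprod.summand_mk'']
  simp only [_root_.smul_apply, MultilinearMap.domDomCongr_apply,
    MultilinearMap.domCoprod_apply, AlternatingMap.coe_multilinearMap]
  rw [Units.smul_def, map_zsmul, zsmul_eq_mul]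
  simp

/-- If `α` vanishes as soon as one of its arguments is one of the last `b` vectors, then the wedge
product is evaluated blockwise. -/
lemma wedge_apply_eq_mul (α : Alt m a) (β : Alt m b) (v : Fin (a + b) → Fin m → ℂ)
    (hα : ∀ x : Fin a → Fin m → ℂ, (∃ i j, x i = v (Fin.natAdd a j)) → α x = 0) :
    wedge α β v = α (fun i => v (Fin.castAdd b i)) * β (fun j => v (Fin.natAdd a j)) := by
  simp only [wedge, AlternatingMap.domDomCongr_apply, LinearMap.compAlternatingMap_apply,
    AlternatingMap.domCoprod_apply]
  rw [_root_.sum_apply, map_sum]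
  refine (Finset.sum_eq_single
    (Quotient.mk'' 1 : Equiv.Perm.ModSumCongr (Fin a) (Fin b)) ?_ ?_).trans ?_
  · intro σ _ hσ
    induction σ using Quotient.inductionOn' with | _ σ
    rw [AlternatingMap.domCoprod.summand_mk'']
    -- A permutation outside the class of the identity sends some index of the first block into the
    -- second, and then `α` is fed one of the last `b` vectors.
    have key : ∃ i j, σ (Sum.inl i) = Sum.inr j := by
      by_contra hcon
      push Not at hcon
      apply hσ
      have hmaps : Set.MapsTo σ (Set.range Sum.inl) (Set.range Sum.inl) := by
        rintro _ ⟨i, rfl⟩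
        rcases h : σ (Sum.inl i) with i' | j
        · exact ⟨i', rfl⟩
        · exact absurd h (hcon i j)
      have hmem := Equiv.Perm.mem_sumCongrHom_range_of_perm_mapsTo_inl hmaps
      refine Quotient.sound' ?_
      rw [QuotientGroup.leftRel_apply, mul_one]
      exact inv_mem hmem
    obtain ⟨i, j, hij⟩ := key
    have h0 : α (fun i => v (finSumFinEquiv (σ (Sum.inl i)))) = 0 :=
      hα _ ⟨i, j, by simp [hij]⟩
    simp only [_root_.smul_apply, MultilinearMap.domDomCongr_apply,
      MultilinearMap.domCoprod_apply, AlternatingMap.coe_multilinearMap]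
    rw [Units.smul_def, map_zsmul, LinearMap.mul'_apply]
    simp [h0]
  · simp
  · rw [AlternatingMap.domCoprod.summand_mk'']
    simp [MultilinearMap.domDomCongr_apply]

lemma wedge_compLinearMap {p : ℕ} (α : Alt m a) (β : Alt m b)
    (f : (Fin p → ℂ) →ₗ[ℝ] (Fin m → ℂ)) :
    (wedge α β).compLinearMap f = wedge (α.compLinearMap f) (β.compLinearMap f) := by
  ext v
  simp [wedge_apply]

lemma wedgeAll_compLinearMap {p : ℕ} (f : (Fin p → ℂ) →ₗ[ℝ] (Fin m → ℂ)) :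
    ∀ (k : ℕ) (α : Fin k → Alt m 2),
      (wedgeAll k α).compLinearMap f = wedgeAll k fun j => (α j).compLinearMap f
  | 0, _ => by ext v; simp [wedgeAll]
  | k + 1, α => by
    simp only [wedgeAll]
    rw [wedge_compLinearMap, wedgeAll_compLinearMap f k]

/-- Pulling back a `wedgeTop`; the dimension of the space may not change. -/
lemma wedgeTop_compLinearMap {q : ℕ} (hq : q ≤ m) (α : Alt m (2 * q)) (β : Alt m (2 * (m - q)))
    (f : (Fin m → ℂ) →ₗ[ℝ] (Fin m → ℂ)) :
    (wedgeTop hq α β).compLinearMap f =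
      wedgeTop hq (α.compLinearMap f) (β.compLinearMap f) := by
  rw [wedgeTop, wedgeTop, ← wedge_compLinearMap]
  rfl

lemma wedge_add_left (α α' : Alt m a) (β : Alt m b) :
    wedge (α + α') β = wedge α β + wedge α' β := by
  ext v
  simp [wedge_apply, add_mul, mul_add, Finset.sum_add_distrib]

lemma wedge_add_right (α : Alt m a) (β β' : Alt m b) :
    wedge α (β + β') = wedge α β + wedge α β' := by
  ext v
  simp [wedge_apply, mul_add, Finset.sum_add_distrib]

lemma wedge_smul_left (c : ℂ) (α : Alt m a) (β : Alt m b) :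
    wedge (c • α) β = c • wedge α β := by
  ext v
  simp only [wedge_apply, AlternatingMap.smul_apply, smul_eq_mul, Finset.mul_sum]
  exact Finset.sum_congr rfl fun σ _ => by ring

lemma wedge_smul_right (c : ℂ) (α : Alt m a) (β : Alt m b) :
    wedge α (c • β) = c • wedge α β := by
  ext v
  simp only [wedge_apply, AlternatingMap.smul_apply, smul_eq_mul, Finset.mul_sum]
  exact Finset.sum_congr rfl fun σ _ => by ring

/-- Lets the theorem on a single section be read off from the one on tuples with `k = 1`. -/
lemma wedgeAll_one (α : Fin 1 → Alt m 2) : wedgeAll 1 α = α 0 := by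
  ext v
  change wedge _ (α 0) v = _
  rw [wedge_apply_eq_mul]
  · simp only [wedgeAll, AlternatingMap.constOfIsEmpty_apply, Function.const_apply, one_mul]
    congr 1
    funext j
    congr 1
    ext
    simp
  · rintro x ⟨i, -⟩
    exact i.elim0

/-- Additivity in each slot, with the homogeneity below, is what makes `wedgeCoeff` a
`MultilinearMap`, so that sums in the factors can be expanded and collected again by
`MultilinearMap.map_sum`. -/
lemma wedgeAll_update_add : ∀ (k : ℕ) (α : Fin k → Alt m 2) (i : Fin k) (x y : Alt m 2),
    wedgeAll k (Function.update α i (x + y)) =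
      wedgeAll k (Function.update α i x) + wedgeAll k (Function.update α i y)
  | 0, _, i, _, _ => i.elim0
  | k + 1, α, i, x, y => by
    simp only [wedgeAll]
    induction i using Fin.lastCases with
    | last =>
      simp only [Function.update_self, wedge_add_right]
      simp [Function.update_of_ne]
    | cast i =>
      have h (z : Alt m 2) : (fun j : Fin k => Function.update α i.castSucc z j.castSucc) =
          Function.update (fun j => α j.castSucc) i z := by
        funext j
        simp [Function.update_apply]
      simp only [h, wedgeAll_update_add k, wedge_add_left,
        Function.update_of_ne (Fin.castSucc_lt_last i).ne']

lemma wedgeAll_update_smul : ∀ (k : ℕ) (α : Fin k → Alt m 2) (i : Fin k) (c : ℂ) (x : Alt m 2),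
    wedgeAll k (Function.update α i (c • x)) = c • wedgeAll k (Function.update α i x)
  | 0, _, i, _, _ => i.elim0
  | k + 1, α, i, c, x => by
    simp only [wedgeAll]
    induction i using Fin.lastCases with
    | last =>
      simp only [Function.update_self, wedge_smul_right]
      simp
    | cast i =>
      have h (z : Alt m 2) : (fun j : Fin k => Function.update α i.castSucc z j.castSucc) =
          Function.update (fun j => α j.castSucc) i z := by
        funext j
        simp [Function.update_apply]
      simp only [h, wedgeAll_update_smul k, wedge_smul_left,
        Function.update_of_ne (Fin.castSucc_lt_last i).ne']

/-- The coefficient of `α₁ ∧ ⋯ ∧ α_k ∧ φ` on the standard frame, as a multilinear function of the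
two-forms `α₁, …, α_k`. -/
def wedgeCoeff {k : ℕ} (hk : k ≤ m) (φ : Alt m (2 * (m - k))) :
    MultilinearMap ℂ (fun _ : Fin k => Alt m 2) ℂ where
  toFun α := wedgeTop hk (wedgeAll k α) φ (stdFrame m)
  map_update_add' {inst} α i x y := by
    -- The field quantifies over an arbitrary decidability instance; it is replaced by the canonical
    -- one used in `wedgeAll_update_add`.
    rw [Subsingleton.elim inst (instDecidableEqFin k)]
    rw [wedgeAll_update_add, wedgeTop, wedge_add_left]
    rfl
  map_update_smul' {inst} α i c x := by
    rw [Subsingleton.elim inst (instDecidableEqFin k)]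
    rw [wedgeAll_update_smul, wedgeTop, wedge_smul_left]
    rfl

/-- A class of functions closed under the ring operations contains the coefficients of a wedge
product if it contains those of the factors. -/
lemma wedge_induction {X : Type*} (A : Subalgebra ℂ (X → ℂ)) {α : X → Alt m a} {β : X → Alt m b}
    (hα : ∀ v, (fun x => α x v) ∈ A) (hβ : ∀ v, (fun x => β x v) ∈ A)
    (v : Fin (a + b) → Fin m → ℂ) : (fun x => wedge (α x) (β x) v) ∈ A := by
  have : (fun x => wedge (α x) (β x) v) =
      ∑ σ : Equiv.Perm.ModSumCongr (Fin a) (Fin b),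
      ((Equiv.Perm.sign σ.out : ℤ) : ℂ) •
        ((fun x => α x (fun i => v (finSumFinEquiv (σ.out (Sum.inl i))))) *
          (fun x => β x (fun j => v (finSumFinEquiv (σ.out (Sum.inr j)))))) := by
    funext x
    simp [wedge_apply, Finset.sum_apply]
  rw [this]
  exact sum_mem fun σ _ => A.smul_mem (mul_mem (hα _) (hβ _)) _

lemma wedgeAll_induction {X : Type*} (A : Subalgebra ℂ (X → ℂ)) :
    ∀ (k : ℕ) {α : X → Fin k → Alt m 2}, (∀ j v, (fun x => α x j v) ∈ A) →
      ∀ v, (fun x => wedgeAll k (α x) v) ∈ A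
  | 0, _, _, _ => A.one_mem
  | k + 1, α, hα, v => by
    simp only [wedgeAll]
    exact wedge_induction A (wedgeAll_induction A k fun j v => hα j.castSucc v)
      (fun v => hα (Fin.last k) v) v

lemma wedgeCoeff_induction {X : Type*} (A : Subalgebra ℂ (X → ℂ)) {k : ℕ} (hk : k ≤ m)
    {φ : X → Alt m (2 * (m - k))} {α : X → Fin k → Alt m 2}
    (hα : ∀ j v, (fun x => α x j v) ∈ A) (hφ : ∀ v, (fun x => φ x v) ∈ A) :
    (fun x => wedgeCoeff hk (φ x) (α x)) ∈ A :=
  wedge_induction A (wedgeAll_induction A k hα) hφ _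

end Wedge

/-! ### The two-forms attached to complex linear forms -/

section Tau

variable {m : ℕ}

/-- The two-form `(i/2) lam ∧ conj mu` for complex linear forms `lam`, `mu`. -/
def tauForm (lam mu : (Fin m → ℂ) →L[ℂ] ℂ) : Alt m 2 where
  toFun v := Complex.I / 2 * (lam (v 0) * starRingEnd ℂ (mu (v 1)) -
    lam (v 1) * starRingEnd ℂ (mu (v 0)))
  map_update_add' v i x y := by
    fin_cases i <;> simp <;> ring
  map_update_smul' v i c x := by
    fin_cases i <;> simp <;> ring
  map_eq_zero_of_eq' v i j hv hij := by
    have h01 : v 0 = v 1 := by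
      fin_cases i <;> fin_cases j <;> simp_all
    simp [h01]

lemma tauForm_apply (lam mu : (Fin m → ℂ) →L[ℂ] ℂ) (v : Fin 2 → Fin m → ℂ) :
    tauForm lam mu v = Complex.I / 2 * (lam (v 0) * starRingEnd ℂ (mu (v 1)) -
    lam (v 1) * starRingEnd ℂ (mu (v 0))) := rfl

lemma altSum_apply {n : ℕ} {ι : Type*} (s : Finset ι) (α : ι → Alt m n)
    (v : Fin n → Fin m → ℂ) : (∑ i ∈ s, α i) v = ∑ i ∈ s, α i v := by
  induction s using Finset.cons_induction with
  | empty => simp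
  | cons i s hi ih => simp [Finset.sum_cons, ih]

/-- Sesquilinearity: for a form with random coefficients, only the products `a l * conj (a l')` are
random, so its average needs only (weighted) second moments. -/
lemma tauForm_sum {ι : Type*} [Fintype ι] (a : ι → ℂ) (lam : ι → (Fin m → ℂ) →L[ℂ] ℂ) :
    tauForm (∑ l, a l • lam l) (∑ l, a l • lam l) =
      ∑ q : ι × ι, (a q.1 * starRingEnd ℂ (a q.2)) • tauForm (lam q.1) (lam q.2) := by
  ext v
  rw [altSum_apply]
  simp only [tauForm_apply, AlternatingMap.smul_apply, FunLike.coe_sum, Finset.sum_apply,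
    FunLike.coe_smul, Pi.smul_apply, smul_eq_mul, map_sum, map_mul, Fintype.sum_prod_type,
    Finset.sum_mul_sum]
  rw [← Finset.sum_sub_distrib, Finset.mul_sum]
  refine Finset.sum_congr rfl fun i _ => ?_
  rw [← Finset.sum_sub_distrib, Finset.mul_sum]
  exact Finset.sum_congr rfl fun j _ => by ring

lemma tauForm_neg_neg (lam : (Fin m → ℂ) →L[ℂ] ℂ) : tauForm (-lam) (-lam) = tauForm lam lam := by
  ext v
  simp [tauForm_apply]

lemma tauForm_comp {p : ℕ} (lam mu : (Fin m → ℂ) →L[ℂ] ℂ) (f : (Fin p → ℂ) →L[ℂ] (Fin m → ℂ)) :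
    (tauForm lam mu).compLinearMap (f.restrictScalars ℝ).toLinearMap =
      tauForm (lam.comp f) (mu.comp f) := by
  ext v
  simp [tauForm_apply]

lemma tauForm_eq_zero (lam : (Fin m → ℂ) →L[ℂ] ℂ) (v : Fin 2 → Fin m → ℂ) (i : Fin 2)
    (h : lam (v i) = 0) : tauForm lam lam v = 0 := by
  fin_cases i <;> simp_all [tauForm_apply]

/-- In every term of the shuffle sum the vector `x i` is an argument of one of the factors, which it
annihilates. -/
lemma wedgeAll_tauForm_eq_zero : ∀ (k : ℕ) (lam : Fin k → (Fin m → ℂ) →L[ℂ] ℂ)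
    (x : Fin (2 * k) → Fin m → ℂ) (i : Fin (2 * k)), (∀ j, lam j (x i) = 0) →
      wedgeAll k (fun j => tauForm (lam j) (lam j)) x = 0
  | 0, _, _, i, _ => i.elim0
  | k + 1, lam, x, i, h => by
    change wedge (wedgeAll k fun j => tauForm (lam j.castSucc) (lam j.castSucc))
      (tauForm (lam (Fin.last k)) (lam (Fin.last k))) x = 0
    rw [wedge_apply]
    refine Finset.sum_eq_zero fun σ _ => ?_
    obtain ⟨y, hy⟩ := (σ.out).surjective (finSumFinEquiv.symm i)
    have hi : finSumFinEquiv (σ.out y) = i := by rw [hy, Equiv.apply_symm_apply]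
    rcases y with y | y
    · rw [wedgeAll_tauForm_eq_zero k _ _ y]
      · simp
      · intro j
        rw [hi]
        exact h j.castSucc
    · rw [tauForm_eq_zero _ _ y]
      · simp
      · rw [hi]
        exact h (Fin.last k)

/-- The form `(i/2)^k lam₁ ∧ conj lam₁ ∧ ⋯` takes the value one on vectors which look like the
standard frame. -/
lemma wedgeAll_tauForm_eq_one : ∀ (k : ℕ) (lam : Fin k → (Fin m → ℂ) →L[ℂ] ℂ)
    (x : Fin (2 * k) → Fin m → ℂ),
    (∀ j i, lam j (x i) = stdFrame k i j) →
      wedgeAll k (fun j => tauForm (lam j) (lam j)) x = 1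
  | 0, _, _, _ => by simp [wedgeAll]
  | k + 1, lam, x, h => by
    change wedge (wedgeAll k fun j => tauForm (lam j.castSucc) (lam j.castSucc))
      (tauForm (lam (Fin.last k)) (lam (Fin.last k))) x = 1
    rw [wedge_apply_eq_mul, wedgeAll_tauForm_eq_one k, one_mul, tauForm_apply, h, h]
    -- On the last two frame vectors `lam (Fin.last k)` takes the values 1 and i, and (i/2)(1 · conj
    -- i - i · conj 1) = 1; this is the reason for the constant i/2 in `tauForm`.
    · have h0 : (⟨((Fin.natAdd (2 * k) (0 : Fin 2) : Fin (2 * k + 2)) : ℕ) / 2, by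
          simp⟩ : Fin (k + 1)) = Fin.last k := by
        ext; simp
      have h1 : (⟨((Fin.natAdd (2 * k) (1 : Fin 2) : Fin (2 * k + 2)) : ℕ) / 2, by
          simp; omega⟩ : Fin (k + 1)) = Fin.last k := by
        ext; simp
        try omega
      have e0 : stdFrame (k + 1) (Fin.natAdd (2 * k) (0 : Fin 2)) (Fin.last k) = 1 := by
        rw [stdFrame, h0]
        simp
      have e1 : stdFrame (k + 1) (Fin.natAdd (2 * k) (1 : Fin 2)) (Fin.last k) = Complex.I := by
        rw [stdFrame, h1]
        simp [Nat.add_mod]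
      erw [e0, e1]
      simp only [Complex.conj_I, map_one]
      ring_nf
      simp
    · intro j i
      rw [h]
      simp only [stdFrame, Pi.single_apply, Fin.ext_iff]
      simp
    · rintro y ⟨i, j, hij⟩
      refine wedgeAll_tauForm_eq_zero k _ _ i fun j' => ?_
      rw [hij, h]
      rw [stdFrame, Pi.single_apply, if_neg]
      rw [Fin.ext_iff]
      simp only [Fin.val_castSucc, Fin.val_natAdd]
      omega

end Tau

/-! ### Determinants and forms of top degree -/

section Det

variable {m : ℕ}

/-- A form of top real degree is multiplied by the real determinant, which for a complex linear map
is the squared modulus of the complex one. Real and imaginary parts are treated separately because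
`Basis.det` describes forms with values in the scalar field. -/
lemma alternating_comp_eq_det_smul (η : Alt m (2 * m)) (T : (Fin m → ℂ) →ₗ[ℂ] (Fin m → ℂ)) :
    η.compLinearMap (T.restrictScalars ℝ) = ((‖LinearMap.det T‖ ^ 2 : ℝ) : ℂ) • η := by
  have hfr : Module.finrank ℝ (Fin m → ℂ) = 2 * m := by
    rw [← Module.finrank_mul_finrank ℝ ℂ (Fin m → ℂ)]
    simp
  let e := Module.finBasisOfFinrankEq ℝ (Fin m → ℂ) hfr
  have hdet : LinearMap.det (T.restrictScalars ℝ) = ‖LinearMap.det T‖ ^ 2 := by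
    rw [LinearMap.det_restrictScalars, Algebra.norm_complex_apply, Complex.normSq_eq_norm_sq]
  have key (f : (Fin m → ℂ) [⋀^Fin (2 * m)]→ₗ[ℝ] ℝ) (v : Fin (2 * m) → Fin m → ℂ) :
      f (fun i => T (v i)) = ‖LinearMap.det T‖ ^ 2 * f v := by
    rw [f.eq_smul_basis_det e]
    simp only [AlternatingMap.smul_apply, smul_eq_mul]
    have := e.det_comp (T.restrictScalars ℝ) v
    rw [hdet] at this
    change _ * e.det (fun i => T (v i)) = _
    change e.det (fun i => T (v i)) = _ at this
    rw [this]
    ring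
  ext v
  refine Complex.ext ?_ ?_
  · have := key (Complex.reLm.compAlternatingMap η) v
    simpa [← Complex.ofReal_pow] using this
  · have := key (Complex.imLm.compAlternatingMap η) v
    simpa [← Complex.ofReal_pow] using this

/-- Jacobian formula: in coordinates adapted to complex linear forms `lam j`, the coefficient of
`⋀ (i/2) lam_j ∧ conj lam_j ∧ φ` is the coefficient of `φ` on the remaining coordinates. -/
lemma wedgeCoeff_tauForm_mul {k : ℕ} (hk : k ≤ m) (lam : Fin k → (Fin m → ℂ) →L[ℂ] ℂ)
    (φ : Alt m (2 * (m - k))) (T : (Fin m → ℂ) →ₗ[ℂ] (Fin m → ℂ))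
    (hlam : ∀ j (w : Fin m → ℂ), lam j (T w) = w (Fin.castLE hk j)) :
    ((‖LinearMap.det T‖ ^ 2 : ℝ) : ℂ) * wedgeCoeff hk φ (fun j => tauForm (lam j) (lam j)) =
      φ (fun i => T (stdFrame m ⟨2 * k + i, by omega⟩)) := by
  -- The top form is pulled back by `T` and evaluated on the standard frame. The first `2k` images
  -- look like the standard frame of ℂ^k to the forms `lam`, and the others are killed by all of
  -- them, so the shuffle sum collapses to one term.
  have h1 := congrArg (fun η : Alt m (2 * m) => η (stdFrame m))
    (alternating_comp_eq_det_smul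
      (wedgeTop hk (wedgeAll k fun j => tauForm (lam j) (lam j)) φ) T)
  simp only [AlternatingMap.smul_apply, smul_eq_mul] at h1
  change _ = _ * wedgeCoeff hk φ (fun j => tauForm (lam j) (lam j)) at h1
  rw [← h1]
  change wedge (wedgeAll k fun j => tauForm (lam j) (lam j)) φ _ = _
  rw [wedge_apply_eq_mul, wedgeAll_tauForm_eq_one, one_mul]
  · rfl
  · intro j i
    change lam j (T (stdFrame m _)) = _
    rw [hlam]
    simp only [stdFrame, Pi.single_apply, Fin.ext_iff]
    simp
  · rintro x ⟨i, i', hi⟩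
    refine wedgeAll_tauForm_eq_zero k _ _ i fun j => ?_
    rw [hi]
    change lam j (T (stdFrame m _)) = _
    rw [hlam, stdFrame, Pi.single_apply, if_neg]
    rw [Fin.ext_iff]
    simp
    omega

/-- If the complex linear forms are dependent, the wedge product vanishes. -/
lemma wedgeAll_tauForm_eq_zero_of_not_surjective {k : ℕ} (lam : Fin k → (Fin m → ℂ) →L[ℂ] ℂ)
    (h : ¬ Function.Surjective (ContinuousLinearMap.pi lam)) :
    wedgeAll k (fun j => tauForm (lam j) (lam j)) = 0 := by
  -- The wedge is pulled back from ℂ^k, where it has top degree. A nonzero value there would need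
  -- `2k` real independent vectors in the range of the map, which would then be everything.
  have h1 : (wedgeAll k fun j => tauForm (lam j) (lam j)) =
      (wedgeAll k fun j => tauForm (ContinuousLinearMap.proj (R := ℂ) (φ := fun _ : Fin k => ℂ) j)
        (ContinuousLinearMap.proj j)).compLinearMap
        ((ContinuousLinearMap.pi lam).restrictScalars ℝ).toLinearMap := by
    rw [wedgeAll_compLinearMap]
    simp only [tauForm_comp]
    rfl
  rw [h1]
  ext v
  rw [AlternatingMap.compLinearMap_apply, AlternatingMap.zero_apply]
  refine AlternatingMap.map_linearDependent _ _ fun hli => h ?_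
  have hfr : Module.finrank ℝ (Fin k → ℂ) = 2 * k := by
    rw [← Module.finrank_mul_finrank ℝ ℂ (Fin k → ℂ)]
    simp
  have hspan := hli.span_eq_top_of_card_eq_finrank' (by simp [hfr])
  have : LinearMap.range ((ContinuousLinearMap.pi lam).restrictScalars ℝ).toLinearMap = ⊤ := by
    rw [eq_top_iff, ← hspan, Submodule.span_le]
    rintro _ ⟨i, rfl⟩
    exact ⟨v i, rfl⟩
  exact LinearMap.range_eq_top (f := ((ContinuousLinearMap.pi lam).restrictScalars ℝ).toLinearMap).1 this

end Det

/-! ### Gaussian integrals -/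

section Gauss

/-- The density of the standard complex Gaussian on `ℂ`. -/
def gaussDensity (z : ℂ) : ℝ := Real.exp (-‖z‖ ^ 2) / Real.pi

lemma gaussDensity_nonneg (z : ℂ) : 0 ≤ gaussDensity z := by
  unfold gaussDensity; positivity

lemma gaussDensity_le (z : ℂ) : gaussDensity z ≤ 1 := by
  unfold gaussDensity
  rw [div_le_one Real.pi_pos]
  have h1 : Real.exp (-‖z‖ ^ 2) ≤ 1 := Real.exp_le_one_iff.2 (by nlinarith [sq_nonneg ‖z‖])
  linarith [Real.pi_gt_three]

@[fun_prop]
lemma continuous_gaussDensity : Continuous gaussDensity := by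
  unfold gaussDensity; fun_prop

lemma integral_gaussDensity : ∫ z, gaussDensity z = 1 := by
  have h := Complex.integral_rpow_mul_exp_neg_rpow (p := 2) (q := 0) (by norm_num) (by norm_num)
  simp only [Real.rpow_zero, one_mul, Real.rpow_ofNat] at h
  simp only [gaussDensity, integral_div, h]
  norm_num

lemma integral_sq_mul_gaussDensity : ∫ z : ℂ, ‖z‖ ^ 2 * gaussDensity z = 1 := by
  have h := Complex.integral_rpow_mul_exp_neg_rpow (p := 2) (q := 2) (by norm_num) (by norm_num)
  simp only [Real.rpow_ofNat] at h
  simp only [gaussDensity, ← mul_div_assoc, integral_div, h]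
  norm_num

lemma integrable_gaussDensity : Integrable gaussDensity :=
  .of_integral_ne_zero (by rw [integral_gaussDensity]; exact one_ne_zero)

lemma integrable_sq_mul_gaussDensity : Integrable fun z : ℂ => ‖z‖ ^ 2 * gaussDensity z :=
  .of_integral_ne_zero (by rw [integral_sq_mul_gaussDensity]; exact one_ne_zero)

/-- The standard complex Gaussian measure on `ℂ`. -/
def gaussOne : Measure ℂ := volume.withDensity fun z => ENNReal.ofReal (gaussDensity z)

lemma measurable_ofReal_gaussDensity : Measurable fun z : ℂ => ENNReal.ofReal (gaussDensity z) :=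
  continuous_gaussDensity.measurable.ennreal_ofReal

instance : IsProbabilityMeasure gaussOne := by
  constructor
  rw [gaussOne, withDensity_apply _ MeasurableSet.univ, Measure.restrict_univ,
    ← ofReal_integral_eq_lintegral_ofReal integrable_gaussDensity
      (.of_forall gaussDensity_nonneg), integral_gaussDensity, ENNReal.ofReal_one]

lemma integral_gaussOne {F : Type*} [NormedAddCommGroup F] [NormedSpace ℝ F] (f : ℂ → F) :
    ∫ z, f z ∂gaussOne = ∫ z, gaussDensity z • f z := by
  rw [gaussOne, integral_withDensity_eq_integral_toReal_smul measurable_ofReal_gaussDensity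
    (by simp)]
  simp [ENNReal.toReal_ofReal (gaussDensity_nonneg _)]

lemma integrable_gaussOne_iff {F : Type*} [NormedAddCommGroup F] [NormedSpace ℝ F] (f : ℂ → F) :
    Integrable f gaussOne ↔ Integrable fun z => gaussDensity z • f z := by
  rw [gaussOne, integrable_withDensity_iff_integrable_smul₀' (by fun_prop) (by simp)]
  simp [ENNReal.toReal_ofReal (gaussDensity_nonneg _)]

lemma integrable_sq_gaussOne : Integrable (fun z : ℂ => ‖z‖ ^ 2) gaussOne := by
  rw [integrable_gaussOne_iff]
  simpa [mul_comm] using integrable_sq_mul_gaussDensity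

lemma integral_mul_conj_gaussOne : ∫ z : ℂ, z * starRingEnd ℂ z ∂gaussOne = 1 := by
  rw [integral_gaussOne, ← Complex.ofReal_one, ← integral_sq_mul_gaussDensity,
    ← integral_complex_ofReal]
  congr 1
  funext z
  rw [Complex.mul_conj, Complex.normSq_eq_norm_sq, Complex.real_smul]
  push_cast
  ring

lemma integral_id_gaussOne : ∫ z : ℂ, z ∂gaussOne = 0 := by
  have h := integral_neg_eq_self (fun z : ℂ => gaussDensity z • z) volume
  rw [integral_gaussOne]
  have h2 : ∀ z : ℂ, gaussDensity (-z) • (-z) = -(gaussDensity z • z) := by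
    intro z; simp [gaussDensity]
  simp only [h2, integral_neg] at h
  exact self_eq_neg.1 h.symm

lemma prod_gaussDensity {ι : Type*} [Fintype ι] (c : ι → ℂ) :
    ∏ l, gaussDensity (c l) = Real.exp (-∑ l, ‖c l‖ ^ 2) / Real.pi ^ Fintype.card ι := by
  simp only [gaussDensity, Finset.prod_div_distrib, ← Real.exp_sum]
  simp

/-- It suffices to compare the measures on boxes, where the integral of the product density factors.
-/
lemma pi_gaussOne {ι : Type*} [Fintype ι] :
    Measure.pi (fun _ : ι => gaussOne) =
      volume.withDensity fun c : ι → ℂ => ENNReal.ofReal (∏ l, gaussDensity (c l)) := by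
  classical
  refine (Measure.pi_eq fun s hs => ?_)
  have hind (c : ι → ℂ) : (Set.univ.pi s).indicator
      (fun c : ι → ℂ => ∏ l, gaussDensity (c l)) c = ∏ l, (s l).indicator gaussDensity (c l) := by
    by_cases hc : c ∈ Set.univ.pi s
    · rw [Set.indicator_of_mem hc]
      exact Finset.prod_congr rfl fun l _ => (Set.indicator_of_mem (hc l trivial) _).symm
    · rw [Set.indicator_of_notMem hc]
      simp only [Set.mem_pi, Set.mem_univ, true_implies, not_forall] at hc
      obtain ⟨l, hl⟩ := hc
      exact (Finset.prod_eq_zero (Finset.mem_univ l) (Set.indicator_of_notMem hl _)).symm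
  have hS := MeasurableSet.univ_pi hs
  have hint : Integrable fun c : ι → ℂ => ∏ l, gaussDensity (c l) :=
    Integrable.fintype_prod fun _ => integrable_gaussDensity
  rw [withDensity_apply _ hS, ← ofReal_integral_eq_lintegral_ofReal hint.integrableOn
    (.of_forall fun c => Finset.prod_nonneg fun l _ => gaussDensity_nonneg _),
    ← integral_indicator hS]
  simp only [hind]
  rw [integral_fintype_prod_volume_eq_prod, ENNReal.ofReal_prod_of_nonneg]
  · refine Finset.prod_congr rfl fun l _ => ?_
    rw [gaussOne, withDensity_apply _ (hs l), ← ofReal_integral_eq_lintegral_ofReal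
      integrable_gaussDensity.integrableOn (.of_forall gaussDensity_nonneg),
      integral_indicator (hs l)]
  · exact fun l _ => integral_nonneg fun z => Set.indicator_nonneg (fun z _ => gaussDensity_nonneg z) z

lemma stdComplexGaussian_eq_pi (d : ℕ) :
    stdComplexGaussian d = Measure.pi fun _ : Fin d => gaussOne := by
  rw [pi_gaussOne, stdComplexGaussian]
  simp [prod_gaussDensity]

instance (d : ℕ) : IsProbabilityMeasure (stdComplexGaussian d) := by
  rw [stdComplexGaussian_eq_pi]
  infer_instance

lemma integral_stdComplexGaussian {d : ℕ} {F : Type*} [NormedAddCommGroup F] [NormedSpace ℝ F]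
    (f : (Fin d → ℂ) → F) :
    ∫ c, f c ∂stdComplexGaussian d =
      ∫ c : Fin d → ℂ, (Real.exp (-∑ l, ‖c l‖ ^ 2) / Real.pi ^ d) • f c := by
  rw [stdComplexGaussian, integral_withDensity_eq_integral_toReal_smul (by fun_prop) (by simp)]
  congr 1
  funext c
  rw [ENNReal.toReal_ofReal (by positivity)]

/-- Second moments. -/
lemma integrable_moment {d : ℕ} (l l' : Fin d) :
    Integrable (fun c : Fin d → ℂ => c l * starRingEnd ℂ (c l')) (stdComplexGaussian d) := by
  rw [stdComplexGaussian_eq_pi]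
  have hs (l : Fin d) : Integrable (fun c : Fin d → ℂ => ‖c l‖ ^ 2)
      (Measure.pi fun _ : Fin d => gaussOne) :=
    integrable_comp_eval (X := fun _ : Fin d => ℂ) (f := fun z : ℂ => ‖z‖ ^ 2) (i := l)
      integrable_sq_gaussOne
  refine ((hs l).add (hs l')).mono' (by fun_prop) (.of_forall fun c => ?_)
  simp only [norm_mul, RCLike.norm_conj, Pi.add_apply]
  nlinarith [sq_nonneg (‖c l‖ - ‖c l'‖), sq_nonneg (‖c l‖ + ‖c l'‖)]

/-- By independence the integral factors over the coordinates; off the diagonal one factor is the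
mean of `z`, which vanishes by symmetry. -/
lemma integral_moment {d : ℕ} (l l' : Fin d) :
    ∫ c : Fin d → ℂ, c l * starRingEnd ℂ (c l') ∂stdComplexGaussian d =
      if l = l' then 1 else 0 := by
  classical
  rw [stdComplexGaussian_eq_pi]
  let f : Fin d → ℂ → ℂ := fun i z =>
    (if i = l then z else 1) * (if i = l' then starRingEnd ℂ z else 1)
  have h (c : Fin d → ℂ) : c l * starRingEnd ℂ (c l') = ∏ i, f i (c i) := by
    simp only [f, Finset.prod_mul_distrib]
    simp
  simp only [h]
  rw [integral_fintype_prod_eq_prod]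
  split_ifs with hl
  · subst hl
    refine Finset.prod_eq_one fun i _ => ?_
    by_cases hi : i = l
    · simp [f, hi, integral_mul_conj_gaussOne]
    · simp [f, hi]
  · refine Finset.prod_eq_zero (Finset.mem_univ l) ?_
    simp [f, hl, integral_id_gaussOne]

/-- The bilinear pairing of `ℂ^d` satisfies `𝔼 (c·u) conj (c·v) = u·conj v`. -/
lemma integral_dot_mul_conj_dot {d : ℕ} (u v : Fin d → ℂ) :
    ∫ c : Fin d → ℂ, (∑ l, c l * u l) * starRingEnd ℂ (∑ l, c l * v l) ∂stdComplexGaussian d =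
      ∑ l, u l * starRingEnd ℂ (v l) := by
  have h (c : Fin d → ℂ) : (∑ l, c l * u l) * starRingEnd ℂ (∑ l, c l * v l) =
      ∑ l, ∑ l', (u l * starRingEnd ℂ (v l')) * (c l * starRingEnd ℂ (c l')) := by
    rw [map_sum, Finset.sum_mul_sum]
    refine Finset.sum_congr rfl fun l _ => Finset.sum_congr rfl fun l' _ => ?_
    rw [map_mul]
    ring
  simp only [h]
  rw [integral_finsetSum _ fun l _ => integrable_finsetSum _ fun l' _ =>
    (integrable_moment l l').const_mul _]
  refine Finset.sum_congr rfl fun l _ => ?_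
  rw [integral_finsetSum _ fun l' _ => (integrable_moment l l').const_mul _]
  simp [integral_const_mul, integral_moment]

/-- Gaussian integral with a rank one perturbation of the exponent. -/
lemma integral_exp_mul_dot_mul_conj_dot {d : ℕ} (g u v : Fin d → ℂ) :
    ∫ c : Fin d → ℂ, (Real.exp (-‖∑ l, c l * g l‖ ^ 2) : ℂ) *
        ((∑ l, c l * u l) * starRingEnd ℂ (∑ l, c l * v l)) ∂stdComplexGaussian d =
      ((1 + ∑ l, ‖g l‖ ^ 2 : ℝ) : ℂ)⁻¹ * (∑ l, u l * starRingEnd ℂ (v l) -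
        ((1 + ∑ l, ‖g l‖ ^ 2 : ℝ) : ℂ)⁻¹ *
          ((∑ l, u l * starRingEnd ℂ (g l)) * ∑ l, g l * starRingEnd ℂ (v l))) := by
  set s : ℝ := ∑ l, ‖g l‖ ^ 2 with hs
  have hs0 : 0 ≤ s := Finset.sum_nonneg fun l _ => by positivity
  set r : ℝ := √(1 + s) with hr
  have hr2 : r ^ 2 = 1 + s := Real.sq_sqrt (by linarith)
  have hr1 : 0 < r := Real.sqrt_pos.2 (by linarith)
  have hsC : (∑ l, g l * starRingEnd ℂ (g l)) = (s : ℂ) := by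
    rw [hs]
    push_cast
    refine Finset.sum_congr rfl fun l _ => ?_
    rw [Complex.mul_conj, Complex.normSq_eq_norm_sq]
    push_cast
    rfl
  let dot : (Fin d → ℂ) → (Fin d → ℂ) → ℂ := fun c u => ∑ l, c l * u l
  let f : Module.Dual ℂ (Fin d → ℂ) :=
    ∑ l, (g l) • (LinearMap.proj l : (Fin d → ℂ) →ₗ[ℂ] ℂ)
  have hf (c) : f c = ∑ l, c l * g l := by simp [f, mul_comm]
  let gb : Fin d → ℂ := fun l => starRingEnd ℂ (g l)
  have hfgb : f gb = s := by
    rw [hf, ← hsC]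
    exact Finset.sum_congr rfl fun l _ => mul_comm _ _
  -- `T` is the positive square root of the perturbed quadratic form: it scales the direction `conj
  -- g` by r = √(1 + s) and fixes its orthogonal complement. The coefficient is 1/(1 + r) because 1
  -- + s/(1 + r) = r.
  let T : (Fin d → ℂ) →ₗ[ℂ] (Fin d → ℂ) := LinearMap.transvection f (((1 + r : ℝ) : ℂ)⁻¹ • gb)
  have hTa (c l) : T c l = c l + f c * (((1 + r : ℝ) : ℂ)⁻¹ * starRingEnd ℂ (g l)) := rfl
  have hrC : (r : ℂ) ^ 2 = 1 + s := by exact_mod_cast hr2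
  have hr0 : (r : ℂ) ≠ 0 := by exact_mod_cast hr1.ne'
  have h1r : (1 + r : ℂ) ≠ 0 := by exact_mod_cast (by linarith : (1 : ℝ) + r ≠ 0)
  have hdet : LinearMap.det T = r := by
    have h1 : LinearMap.det T = 1 + f (((1 + r : ℝ) : ℂ)⁻¹ • gb) := LinearMap.transvection.det _ _
    rw [h1, map_smul, hfgb, smul_eq_mul]
    push_cast
    field_simp
    linear_combination (-1 : ℂ) * hrC
  have hdetR : LinearMap.det (T.restrictScalars ℝ) = 1 + s := by
    rw [LinearMap.det_restrictScalars, Algebra.norm_complex_apply, hdet, Complex.normSq_ofReal,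
      ← sq, hr2]
  -- the new coordinates
  have hfT (c) : f (T c) = r * f c := by
    have : T c = c + f c • (((1 + r : ℝ) : ℂ)⁻¹ • gb) := rfl
    rw [this, map_add, map_smul, map_smul, hfgb]
    simp only [smul_eq_mul]
    push_cast
    field_simp
    linear_combination (-f c) * hrC
  have hnorm (c : Fin d → ℂ) : ∑ l, ‖T c l‖ ^ 2 = ∑ l, ‖c l‖ ^ 2 + ‖∑ l, c l * g l‖ ^ 2 := by
    have h1 (z : ℂ) : ((‖z‖ ^ 2 : ℝ) : ℂ) = z * starRingEnd ℂ z := by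
      rw [Complex.mul_conj, Complex.normSq_eq_norm_sq]
    apply Complex.ofReal_injective
    rw [Complex.ofReal_sum, Complex.ofReal_add, Complex.ofReal_sum, ← hf]
    simp only [h1, hTa]
    have h2 (l : Fin d) : (c l + f c * (((1 + r : ℝ) : ℂ)⁻¹ * starRingEnd ℂ (g l))) *
        starRingEnd ℂ (c l + f c * (((1 + r : ℝ) : ℂ)⁻¹ * starRingEnd ℂ (g l))) =
        c l * starRingEnd ℂ (c l) +
        ((starRingEnd ℂ (f c) * ((1 + r : ℝ) : ℂ)⁻¹) * (c l * g l) +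
        (f c * ((1 + r : ℝ) : ℂ)⁻¹) * starRingEnd ℂ (c l * g l) +
        (f c * starRingEnd ℂ (f c) * ((1 + r : ℝ) : ℂ)⁻¹ ^ 2) * (g l * starRingEnd ℂ (g l))) := by
      simp only [map_add, map_mul, map_inv₀, Complex.conj_conj, Complex.conj_ofReal]
      ring
    simp only [h2, Finset.sum_add_distrib, ← Finset.mul_sum, ← map_sum, ← hf, hsC]
    push_cast
    field_simp
    linear_combination (-1 : ℂ) * (f c) * (starRingEnd ℂ (f c)) * hrC
  -- the vectors paired with the new coordinates
  let S : (Fin d → ℂ) → (Fin d → ℂ) := fun u l =>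
    u l - (∑ l, u l * starRingEnd ℂ (g l)) * ((r : ℂ)⁻¹ * (1 + r : ℂ)⁻¹) * g l
  -- `S` is the inverse transpose of `T` for the bilinear pairing. It divides `g` by r, as 1 -
  -- s/(r(1 + r)) = 1/r.
  have hS (c u : Fin d → ℂ) : ∑ l, c l * u l = ∑ l, T c l * S u l := by
    have h1 (l : Fin d) : T c l * S u l = c l * u l
        - ((∑ l, u l * starRingEnd ℂ (g l)) * ((r : ℂ)⁻¹ * (1 + r : ℂ)⁻¹)) * (c l * g l)
        + (f c * (1 + r : ℂ)⁻¹) * (u l * starRingEnd ℂ (g l))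
        - (f c * (1 + r : ℂ)⁻¹ *
          ((∑ l, u l * starRingEnd ℂ (g l)) * ((r : ℂ)⁻¹ * (1 + r : ℂ)⁻¹))) *
            (g l * starRingEnd ℂ (g l)) := by
      simp only [hTa, S]
      push_cast
      ring
    simp only [h1, Finset.sum_add_distrib, Finset.sum_sub_distrib, ← Finset.mul_sum, ← hf, hsC]
    field_simp
    linear_combination (-(f c) * ∑ l, u l * starRingEnd ℂ (g l)) * hrC
  -- change of variables
  let F : (Fin d → ℂ) → ℂ := fun b => (Real.exp (-∑ l, ‖b l‖ ^ 2) / Real.pi ^ d) •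
      ((∑ l, b l * S u l) * starRingEnd ℂ (∑ l, b l * S v l))
  have hcv : ∫ c, F (T c) = (1 + s)⁻¹ • ∫ b, F b := by
    have hne : LinearMap.det (T.restrictScalars ℝ) ≠ 0 := by rw [hdetR]; linarith
    have hmap := Measure.map_linearMap_addHaar_eq_smul_addHaar
      (volume : Measure (Fin d → ℂ)) hne
    let e := LinearEquiv.ofIsUnitDet (f := T.restrictScalars ℝ)
      (v := Module.finBasis ℝ _) (v' := Module.finBasis ℝ _)
      (by rw [LinearMap.det_toMatrix]; exact isUnit_iff_ne_zero.2 hne)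
    have hemb : MeasurableEmbedding T :=
      (e.toContinuousLinearEquiv.toHomeomorph.measurableEmbedding)
    rw [← hemb.integral_map]
    change ∫ b, F b ∂(Measure.map (T.restrictScalars ℝ) volume) = _
    rw [hmap, integral_smul_measure, hdetR, abs_of_pos (by positivity),
      ENNReal.toReal_ofReal (by positivity)]
  have hL : ∫ c : Fin d → ℂ, (Real.exp (-‖∑ l, c l * g l‖ ^ 2) : ℂ) *
        ((∑ l, c l * u l) * starRingEnd ℂ (∑ l, c l * v l)) ∂stdComplexGaussian d =
      ∫ c, F (T c) := by
    rw [integral_stdComplexGaussian]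
    congr 1
    funext c
    simp only [F]
    rw [hnorm, ← hS, ← hS, neg_add, Real.exp_add]
    simp only [Complex.real_smul]
    push_cast
    ring
  rw [hL, hcv, ← integral_stdComplexGaussian, integral_dot_mul_conj_dot, Complex.real_smul]
  push_cast
  congr 1
  -- After summation the coefficient of (u·conj g)(g·conj v) is -2κ + κ²s with κ = 1/(r(1 + r)),
  -- which simplifies to -1/r² = -1/(1 + s).
  have h1 (l : Fin d) : S u l * starRingEnd ℂ (S v l) = u l * starRingEnd ℂ (v l)
      - ((∑ l, u l * starRingEnd ℂ (g l)) * ((r : ℂ)⁻¹ * (1 + r : ℂ)⁻¹)) *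
        (g l * starRingEnd ℂ (v l))
      - (starRingEnd ℂ (∑ l, v l * starRingEnd ℂ (g l)) * ((r : ℂ)⁻¹ * (1 + r : ℂ)⁻¹)) *
        (u l * starRingEnd ℂ (g l))
      + ((∑ l, u l * starRingEnd ℂ (g l)) * starRingEnd ℂ (∑ l, v l * starRingEnd ℂ (g l)) *
        ((r : ℂ)⁻¹ * (1 + r : ℂ)⁻¹) ^ 2) * (g l * starRingEnd ℂ (g l)) := by
    simp only [S, map_sub, map_mul, map_inv₀, map_add, map_one, Complex.conj_ofReal]
    ring
  have h2 : starRingEnd ℂ (∑ l, v l * starRingEnd ℂ (g l)) =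
      ∑ l, g l * starRingEnd ℂ (v l) := by
    rw [map_sum]
    refine Finset.sum_congr rfl fun l _ => ?_
    rw [map_mul, Complex.conj_conj, mul_comm]
  simp only [h1, Finset.sum_add_distrib, Finset.sum_sub_distrib, ← Finset.mul_sum, hsC, h2]
  rw [← hrC]
  have hsr : (s : ℂ) = r ^ 2 - 1 := by rw [hrC]; ring
  rw [hsr]
  field_simp
  ring

end Gauss

/-! ### Regrouping product measures -/

section Split

/-- Both measures agree on products of boxes, a generating π-system with finite spanning sets, so
σ-finiteness gives equality. -/
lemma measurePreserving_pi_prod {ι : Type*} [Fintype ι] {X Y : ι → Type*}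
    [∀ i, MeasurableSpace (X i)] [∀ i, MeasurableSpace (Y i)] (μ : ∀ i, Measure (X i))
    (ν : ∀ i, Measure (Y i)) [∀ i, SigmaFinite (μ i)] [∀ i, SigmaFinite (ν i)] :
    MeasurePreserving (fun p : ∀ i, X i × Y i => ((fun i => (p i).1), fun i => (p i).2))
      (Measure.pi fun i => (μ i).prod (ν i)) ((Measure.pi μ).prod (Measure.pi ν)) where
  measurable := by fun_prop
  map_eq := by
    refine (Measure.FiniteSpanningSetsIn.ext ?_ (isPiSystem_pi.prod isPiSystem_pi)
      ((Measure.FiniteSpanningSetsIn.pi fun i => (μ i).toFiniteSpanningSetsIn).prod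
      (Measure.FiniteSpanningSetsIn.pi (fun i => (ν i).toFiniteSpanningSetsIn))) ?_).symm
    · refine (generateFrom_eq_prod generateFrom_pi generateFrom_pi ?_ ?_).symm
      · exact (Measure.FiniteSpanningSetsIn.pi
          (fun i => (μ i).toFiniteSpanningSetsIn)).isCountablySpanning
      · exact (Measure.FiniteSpanningSetsIn.pi
          (fun i => (ν i).toFiniteSpanningSetsIn)).isCountablySpanning
    · rintro _ ⟨s, ⟨s, hs, rfl⟩, ⟨_, ⟨t, ht, rfl⟩, rfl⟩⟩
      have hs' : MeasurableSet (Set.univ.pi s) :=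
        MeasurableSet.univ_pi fun i => hs i trivial
      have ht' : MeasurableSet (Set.univ.pi t) :=
        MeasurableSet.univ_pi fun i => ht i trivial
      rw [Measure.map_apply (by fun_prop) (hs'.prod ht')]
      rw [show (fun p : ∀ i, X i × Y i => ((fun i => (p i).1), fun i => (p i).2)) ⁻¹'
          (Set.univ.pi s ×ˢ Set.univ.pi t) = (Set.univ.pi fun i => s i ×ˢ t i) by
          ext; simp [Set.mem_pi, forall_and]]
      simp_rw [Measure.pi_pi, Measure.prod_prod, Measure.pi_pi, Finset.prod_mul_distrib]

lemma measurePreserving_splitNth {d : ℕ} (l : Fin (d + 1)) :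
    MeasurePreserving (fun c : Fin (d + 1) → ℂ => ((fun i => c (l.succAbove i)), c l))
      (stdComplexGaussian (d + 1)) ((stdComplexGaussian d).prod gaussOne) := by
  rw [stdComplexGaussian_eq_pi, stdComplexGaussian_eq_pi]
  have h1 := measurePreserving_piFinSuccAbove (fun _ : Fin (d + 1) => gaussOne) l
  exact Measure.measurePreserving_swap.comp h1

end Split

/-! ### Random sections in terms of Gaussian coefficients -/

section Coordinates

variable {m : ℕ} {M : Type*} [TopologicalSpace M] [ChartedSpace (Fin m → ℂ) M]

lemma measurable_dual_section {L : M → Type*} [∀ x, TopologicalSpace (L x)]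
    [TopologicalSpace (TotalSpace ℂ L)] [∀ x, AddCommGroup (L x)] [∀ x, Module ℂ (L x)]
    [FiberBundle ℂ L] [VectorBundle ℂ ℂ L] {S : Submodule ℂ (HolSection (m := m) L)}
    (f : Module.Dual ℂ S) : Measurable f := by
  refine measurable_iff_comap_le.2 ?_
  rw [BorelSpace.measurable_eq (α := ℂ)]
  exact le_iSup (fun f : Module.Dual ℂ S => MeasurableSpace.comap f (borel ℂ)) f

/-- The coordinate map undoes the map that defines `gaussianMeasure`, so statements about random
sections become statements about Gaussian vectors. -/
lemma measurePreserving_equivFun {L : M → Type*} [∀ x, TopologicalSpace (L x)]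
    [TopologicalSpace (TotalSpace ℂ L)] [∀ x, AddCommGroup (L x)] [∀ x, Module ℂ (L x)]
    [FiberBundle ℂ L] [VectorBundle ℂ ℂ L] {S : Submodule ℂ (HolSection (m := m) L)} {d : ℕ}
    (b : Module.Basis (Fin d) ℂ S) :
    MeasurePreserving (fun s => b.equivFun s) (gaussianMeasure b) (stdComplexGaussian d) := by
  have hm : Measurable fun s => b.equivFun s :=
    measurable_pi_lambda _ fun i => measurable_dual_section (b.coord i)
  refine ⟨hm, ?_⟩
  rw [gaussianMeasure, Measure.map_map hm (measurable_sum_smul_basis b)]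
  have : (fun s => b.equivFun s) ∘ (fun c : Fin d → ℂ => ∑ l, c l • b l) = id := by
    funext c
    change b.equivFun (∑ l, c l • b l) = c
    rw [← b.equivFun_symm_apply, LinearEquiv.apply_symm_apply]
  rw [this, Measure.map_id]

instance {L : M → Type*} [∀ x, TopologicalSpace (L x)]
    [TopologicalSpace (TotalSpace ℂ L)] [∀ x, AddCommGroup (L x)] [∀ x, Module ℂ (L x)]
    [FiberBundle ℂ L] [VectorBundle ℂ ℂ L] {S : Submodule ℂ (HolSection (m := m) L)} {d : ℕ}
    (b : Module.Basis (Fin d) ℂ S) : IsProbabilityMeasure (gaussianMeasure b) :=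
  Measure.isProbabilityMeasure_map (measurable_sum_smul_basis b).aemeasurable

variable {k : ℕ} {L : Fin k → M → Type*} [∀ j x, TopologicalSpace (L j x)]
  [∀ j, TopologicalSpace (TotalSpace ℂ (L j))]
  [∀ j x, AddCommGroup (L j x)] [∀ j x, Module ℂ (L j x)] [∀ j, FiberBundle ℂ (L j)]
  [∀ j, VectorBundle ℂ ℂ (L j)]

/-- The Gaussian measure on the coefficients other than the distinguished ones. -/
def restMeasure {k : ℕ} (n : Fin k → ℕ) : Measure (∀ j, Fin (n j) → ℂ) :=
  Measure.pi fun j => stdComplexGaussian (n j)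

instance {k : ℕ} (n : Fin k → ℕ) : IsProbabilityMeasure (restMeasure n) := by
  unfold restMeasure; infer_instance

/-- The coefficients of a tuple of sections, split into the distinguished ones (the second
component) and the others. -/
def splitCoeff {S : ∀ j, Submodule ℂ (HolSection (m := m) (L j))} {n : Fin k → ℕ}
    (b : ∀ j, Module.Basis (Fin (n j + 1)) ℂ (S j)) (l : ∀ j, Fin (n j + 1)) (s : ∀ j, S j) :
    (∀ j, Fin (n j) → ℂ) × (Fin k → ℂ) :=
  (fun j i => (b j).equivFun (s j) ((l j).succAbove i), fun j => (b j).equivFun (s j) (l j))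

/-- The distinguished coefficients of the sections are jointly independent of the others. This
allows the other coefficients to be frozen, and the distinguished ones to be treated as the variable
of the change of variables. -/
lemma measurePreserving_splitCoeff {S : ∀ j, Submodule ℂ (HolSection (m := m) (L j))}
    {n : Fin k → ℕ} (b : ∀ j, Module.Basis (Fin (n j + 1)) ℂ (S j)) (l : ∀ j, Fin (n j + 1)) :
    MeasurePreserving (splitCoeff b l) (Measure.pi fun j => gaussianMeasure (b j))
      ((restMeasure n).prod (stdComplexGaussian k)) := by
  rw [stdComplexGaussian_eq_pi]
  have h1 := measurePreserving_pi (fun j => gaussianMeasure (b j)) _ fun j =>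
    (measurePreserving_splitNth (l j)).comp (measurePreserving_equivFun (b j))
  exact (measurePreserving_pi_prod (fun j => stdComplexGaussian (n j)) fun _ => gaussOne).comp h1

end Coordinates

/-! ### Calculus of `∂∂̄` on `ℂ^m` -/

section DDC

variable {m n : ℕ}

/-- The one-form `∂̄u` as a continuous alternating form. -/
abbrev dbarForm (u : (Fin m → ℂ) → ℝ) (y : Fin m → ℂ) : (Fin m → ℂ) [⋀^Fin 1]→L[ℝ] ℂ :=
  ContinuousAlternatingMap.ofSubsingleton ℝ (Fin m → ℂ) ℂ (0 : Fin 1) (dbar (fun z => (u z : ℂ)) y)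

lemma contDiffAt_dbar {u : (Fin m → ℂ) → ℝ} {y : Fin m → ℂ} {r s : WithTop ℕ∞}
    (hu : ContDiffAt ℝ s u y) (hrs : r + 1 ≤ s) :
    ContDiffAt ℝ r (dbar fun z => (u z : ℂ)) y := by
  have h1 : ContDiffAt ℝ s (fun z => (u z : ℂ)) y :=
    (Complex.ofRealCLM.contDiff.contDiffAt).comp y hu
  have h2 := h1.fderiv_right hrs
  unfold dbar
  exact (h2.add ((h2.clm_comp contDiffAt_const).const_smul _)).const_smul _

lemma contDiffAt_dbarForm {u : (Fin m → ℂ) → ℝ} {y : Fin m → ℂ} {r s : WithTop ℕ∞}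
    (hu : ContDiffAt ℝ s u y) (hrs : r + 1 ≤ s) : ContDiffAt ℝ r (dbarForm u) y :=
  (ContinuousAlternatingMap.ofSubsingletonLIE (𝕜 := ℝ) (E := Fin m → ℂ) (F := ℂ)
    (0 : Fin 1)).toContinuousLinearEquiv.contDiff.contDiffAt.comp y (contDiffAt_dbar hu hrs)

lemma ddc_congr {u v : (Fin m → ℂ) → ℝ} {y : Fin m → ℂ} (h : u =ᶠ[𝓝 y] v) :
    ddc u y = ddc v y := by
  have h1 : dbarForm u =ᶠ[𝓝 y] dbarForm v := by
    filter_upwards [h.eventuallyEq_nhds] with z hz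
    have : (fun z => (u z : ℂ)) =ᶠ[𝓝 z] fun z => (v z : ℂ) := by
      filter_upwards [hz] with w hw
      rw [hw]
    simp only [dbarForm, dbar, this.fderiv_eq]
  unfold ddc
  rw [h1.extDeriv_eq]

lemma ddc_add {u v : (Fin m → ℂ) → ℝ} {y : Fin m → ℂ} (hu : ContDiffAt ℝ 2 u y)
    (hv : ContDiffAt ℝ 2 v y) : ddc (fun z => u z + v z) y = ddc u y + ddc v y := by
  have key : dbarForm (fun z => u z + v z) =ᶠ[𝓝 y] dbarForm u + dbarForm v := by
    filter_upwards [hu.eventually (by simp), hv.eventually (by simp)] with z hz hz'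
    have h1 : DifferentiableAt ℝ (fun z => (u z : ℂ)) z :=
      Complex.ofRealCLM.differentiableAt.comp z (hz.differentiableAt (by simp))
    have h2 : DifferentiableAt ℝ (fun z => (v z : ℂ)) z :=
      Complex.ofRealCLM.differentiableAt.comp z (hz'.differentiableAt (by simp))
    ext w
    simp only [dbarForm, dbar, Complex.ofReal_add, fderiv_fun_add h1 h2, Pi.add_apply]
    simp
    ring
  unfold ddc
  rw [key.extDeriv_eq, extDeriv_add]
  · ext w
    simp
  · exact (contDiffAt_dbarForm (r := 1) hu (by norm_num)).differentiableAt (by simp)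
  · exact (contDiffAt_dbarForm (r := 1) hv (by norm_num)).differentiableAt (by simp)

/-- The derivative of a holomorphic map commutes with multiplication by i, hence with taking the
antilinear part. -/
lemma dbar_comp {u : (Fin n → ℂ) → ℝ} {g : (Fin m → ℂ) → (Fin n → ℂ)} {y : Fin m → ℂ}
    (hu : DifferentiableAt ℝ u (g y)) (hg : DifferentiableAt ℂ g y) :
    dbar (fun z => (u (g z) : ℂ)) y =
      (dbar (fun z => (u z : ℂ)) (g y)).comp (fderiv ℝ g y) := by
  have hu' : DifferentiableAt ℝ (fun z => (u z : ℂ)) (g y) :=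
    Complex.ofRealCLM.differentiableAt.comp _ hu
  have h1 : fderiv ℝ (fun z => (u (g z) : ℂ)) y =
      (fderiv ℝ (fun z => (u z : ℂ)) (g y)).comp (fderiv ℝ g y) :=
    fderiv_comp y hu' (hg.restrictScalars ℝ)
  ext v
  simp only [dbar, h1, hg.fderiv_restrictScalars ℝ]
  simp

/-- `∂∂̄` commutes with holomorphic changes of variables. -/
lemma ddc_comp {u : (Fin n → ℂ) → ℝ} {g : (Fin m → ℂ) → (Fin n → ℂ)} {y : Fin m → ℂ}
    (hu : ContDiffAt ℝ 2 u (g y)) (hg : ContDiffAt ℂ ω g y) :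
    ddc (fun z => u (g z)) y =
      (ddc u (g y)).compLinearMap ((fderiv ℂ g y).restrictScalars ℝ).toLinearMap := by
  have hgR : ContDiffAt ℝ 2 g y := (hg.of_le le_top).restrict_scalars ℝ
  have key : dbarForm (fun z => u (g z)) =ᶠ[𝓝 y]
      fun z => (dbarForm u (g z)).compContinuousLinearMap (fderiv ℝ g z) := by
    filter_upwards [hg.continuousAt.eventually (hu.eventually (by simp)),
      hg.eventually (by simp)] with z hz hz'
    ext w
    simp only [dbarForm]
    rw [dbar_comp (hz.differentiableAt (by simp)) (hz'.differentiableAt (by simp))]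
    simp
  unfold ddc
  rw [key.extDeriv_eq, extDeriv_pullback (r := 2)
    ((contDiffAt_dbarForm (r := 1) hu (by norm_num)).differentiableAt (by simp)) hgR (by simp)]
  rw [(hg.differentiableAt (by simp)).fderiv_restrictScalars ℝ]
  rfl

lemma ddc_apply {u : (Fin m → ℂ) → ℝ} {y : Fin m → ℂ} (hu : ContDiffAt ℝ 2 u y)
    (v : Fin 2 → Fin m → ℂ) :
    ddc u y v = Complex.I / (2 * Real.pi) *
      (fderiv ℝ (fun w => dbar (fun z => (u z : ℂ)) w (v 1)) y (v 0) -
        fderiv ℝ (fun w => dbar (fun z => (u z : ℂ)) w (v 0)) y (v 1)) := by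
  have hd : DifferentiableAt ℝ (dbarForm u) y :=
    (contDiffAt_dbarForm (r := 1) hu (by norm_num)).differentiableAt (by simp)
  unfold ddc
  rw [AlternatingMap.smul_apply, ContinuousAlternatingMap.coe_toAlternatingMap, extDeriv_apply hd]
  simp only [smul_eq_mul]
  erw [Fin.sum_univ_two]
  simp [Fin.removeNth, Fin.tail, sub_eq_add_neg]

lemma contDiffOn_ddc {u : (Fin m → ℂ) → ℝ} {Ω : Set (Fin m → ℂ)} (hΩ : IsOpen Ω)
    (hu : ContDiffOn ℝ ∞ u Ω) (v : Fin 2 → Fin m → ℂ) :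
    ContDiffOn ℝ ∞ (fun y => ddc u y v) Ω := by
  have h2 (a b : Fin m → ℂ) :
      ContDiffOn ℝ ∞ (fun y => fderiv ℝ (fun w => dbar (fun z => (u z : ℂ)) w a) y b) Ω := by
    intro y hy
    have hy' := hu.contDiffAt (hΩ.mem_nhds hy)
    have h1 : ContDiffAt ℝ ∞ (fun w => dbar (fun z => (u z : ℂ)) w a) y :=
      (contDiffAt_dbar hy' (by simp)).clm_apply contDiffAt_const
    exact ((h1.fderiv_right (m := ∞) (by simp)).clm_apply contDiffAt_const).contDiffWithinAt
  refine ((contDiffOn_const (c := Complex.I / (2 * Real.pi))).mul ((h2 (v 1) (v 0)).sub (h2 (v 0) (v 1)))).congr fun y hy => ?_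
  exact ddc_apply ((hu.contDiffAt (hΩ.mem_nhds hy)).of_le (WithTop.coe_le_coe.2 (le_top : (2 : ℕ∞) ≤ ⊤))) v

lemma contDiff_sum_normSq : ContDiff ℝ ω fun w : Fin n → ℂ => ∑ l, ‖w l‖ ^ 2 := by
  refine ContDiff.sum fun l _ => ?_
  exact (contDiff_apply ℝ ℂ l).norm_sq ℝ

lemma contDiffAt_log_normSq {ε : ℝ} {w : Fin n → ℂ} (h : ε + ∑ l, ‖w l‖ ^ 2 ≠ 0) :
    ContDiffAt ℝ ω (fun w => Real.log (ε + ∑ l, ‖w l‖ ^ 2)) w :=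
  (contDiffAt_const.add contDiff_sum_normSq.contDiffAt).log h

lemma hasFDerivAt_normSq (ε : ℝ) (w : Fin n → ℂ) :
    ∃ N' : (Fin n → ℂ) →L[ℝ] ℝ, HasFDerivAt (fun w : Fin n → ℂ => ε + ∑ l, ‖w l‖ ^ 2) N' w ∧
      ∀ v, (N' v : ℂ) = ∑ l, starRingEnd ℂ (w l) * v l + ∑ l, w l * starRingEnd ℂ (v l) := by
  refine ⟨_, HasFDerivAt.const_add _ (HasFDerivAt.fun_sum fun l _ =>
    ((ContinuousLinearMap.proj (R := ℝ) (φ := fun _ : Fin n => ℂ) l).hasFDerivAt).norm_sq), ?_⟩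
  intro v
  rw [← Finset.sum_add_distrib]
  simp only [FunLike.coe_sum, Finset.sum_apply, Complex.ofReal_sum]
  refine Finset.sum_congr rfl fun l _ => ?_
  simp only [FunLike.coe_smul, Pi.smul_apply, ContinuousLinearMap.comp_apply]
  apply Complex.ext <;> simp [Complex.inner] <;> ring

/-- Of the two sums in the differential of ‖w‖², `dbar` keeps the one antilinear in `v`. The
parameter `ε` serves two purposes: `ε = 1` gives the Fubini–Study potential, `ε = 0` the
pluriharmonicity of log |t|². -/
lemma dbar_log_normSq {ε : ℝ} {w : Fin n → ℂ} (h : ε + ∑ l, ‖w l‖ ^ 2 ≠ 0) (v : Fin n → ℂ) :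
    dbar (fun z => (Real.log (ε + ∑ l, ‖z l‖ ^ 2) : ℂ)) w v =
      (∑ l, w l * starRingEnd ℂ (v l)) / ((ε + ∑ l, ‖w l‖ ^ 2 : ℝ) : ℂ) := by
  obtain ⟨N', hN, hN'⟩ := hasFDerivAt_normSq ε w
  have h1 := Complex.ofRealCLM.hasFDerivAt.comp w (hN.log h)
  have h2 : fderiv ℝ (fun z : Fin n → ℂ => (Real.log (ε + ∑ l, ‖z l‖ ^ 2) : ℂ)) w =
    Complex.ofRealCLM.comp ((ε + ∑ l, ‖w l‖ ^ 2)⁻¹ • N') := h1.fderiv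
  have h3 (x : Fin n → ℂ) : fderiv ℝ (fun z : Fin n → ℂ => (Real.log (ε + ∑ l, ‖z l‖ ^ 2) : ℂ)) w x =
      ((ε + ∑ l, ‖w l‖ ^ 2 : ℝ) : ℂ)⁻¹ * (∑ l, starRingEnd ℂ (w l) * x l +
        ∑ l, w l * starRingEnd ℂ (x l)) := by
    rw [h2, ← hN']
    simp
  have h4 : dbar (fun z => (Real.log (ε + ∑ l, ‖z l‖ ^ 2) : ℂ)) w v = 2⁻¹ *
      (fderiv ℝ (fun z : Fin n → ℂ => (Real.log (ε + ∑ l, ‖z l‖ ^ 2) : ℂ)) w v + Complex.I *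
      fderiv ℝ (fun z : Fin n → ℂ => (Real.log (ε + ∑ l, ‖z l‖ ^ 2) : ℂ)) w (Complex.I • v)) := rfl
  rw [h4, h3, h3]
  have h5 : ∑ l, starRingEnd ℂ (w l) * (Complex.I • v) l =
      Complex.I * ∑ l, starRingEnd ℂ (w l) * v l := by
    rw [Finset.mul_sum]
    refine Finset.sum_congr rfl fun l _ => ?_
    simp only [Pi.smul_apply, smul_eq_mul]
    ring
  have h6 : ∑ l, w l * starRingEnd ℂ ((Complex.I • v) l) =
      -Complex.I * ∑ l, w l * starRingEnd ℂ (v l) := by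
    rw [Finset.mul_sum]
    refine Finset.sum_congr rfl fun l _ => ?_
    simp only [Pi.smul_apply, smul_eq_mul, map_mul, Complex.conj_I]
    ring
  rw [h5, h6, div_eq_inv_mul]
  linear_combination (2⁻¹ * ((ε + ∑ l, ‖w l‖ ^ 2 : ℝ) : ℂ)⁻¹ *
    (∑ l, starRingEnd ℂ (w l) * v l - ∑ l, w l * starRingEnd ℂ (v l))) * Complex.I_mul_I

/-- `(i/2π) ∂∂̄ log (ε + ‖w‖²)`. -/
lemma ddc_log_normSq {ε : ℝ} {w : Fin n → ℂ} (h : ε + ∑ l, ‖w l‖ ^ 2 ≠ 0)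
    (v : Fin 2 → Fin n → ℂ) :
    ddc (fun z => Real.log (ε + ∑ l, ‖z l‖ ^ 2)) w v = Complex.I / (2 * Real.pi) *
      (((ε + ∑ l, ‖w l‖ ^ 2 : ℝ) : ℂ)⁻¹ * (∑ l, v 0 l * starRingEnd ℂ (v 1 l) -
        ((ε + ∑ l, ‖w l‖ ^ 2 : ℝ) : ℂ)⁻¹ *
          ((∑ l, v 0 l * starRingEnd ℂ (w l)) * ∑ l, w l * starRingEnd ℂ (v 1 l))) -
      ((ε + ∑ l, ‖w l‖ ^ 2 : ℝ) : ℂ)⁻¹ * (∑ l, v 1 l * starRingEnd ℂ (v 0 l) -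
        ((ε + ∑ l, ‖w l‖ ^ 2 : ℝ) : ℂ)⁻¹ *
          ((∑ l, v 1 l * starRingEnd ℂ (w l)) * ∑ l, w l * starRingEnd ℂ (v 0 l)))) := by
  rw [ddc_apply ((contDiffAt_log_normSq h).of_le le_top)]
  have hev : ∀ᶠ z : Fin n → ℂ in 𝓝 w, ε + ∑ l, ‖z l‖ ^ 2 ≠ 0 :=
    (continuous_const.add contDiff_sum_normSq.continuous).continuousAt.eventually_ne h
  have key (a b : Fin n → ℂ) :
      fderiv ℝ (fun z => dbar (fun z => (Real.log (ε + ∑ l, ‖z l‖ ^ 2) : ℂ)) z a) w b =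
      ((ε + ∑ l, ‖w l‖ ^ 2 : ℝ) : ℂ)⁻¹ * (∑ l, b l * starRingEnd ℂ (a l)) -
        ((ε + ∑ l, ‖w l‖ ^ 2 : ℝ) : ℂ)⁻¹ ^ 2 * (∑ l, w l * starRingEnd ℂ (a l)) *
        (∑ l, starRingEnd ℂ (w l) * b l + ∑ l, w l * starRingEnd ℂ (b l)) := by
    have he : (fun z => dbar (fun z => (Real.log (ε + ∑ l, ‖z l‖ ^ 2) : ℂ)) z a) =ᶠ[𝓝 w]
        fun z => (∑ l, z l * starRingEnd ℂ (a l)) * (((ε + ∑ l, ‖z l‖ ^ 2)⁻¹ : ℝ) : ℂ) := by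
      filter_upwards [hev] with z hz
      rw [dbar_log_normSq hz, div_eq_mul_inv, Complex.ofReal_inv]
    rw [he.fderiv_eq]
    obtain ⟨N', hN, hN'⟩ := hasFDerivAt_normSq ε w
    have h1 := Complex.ofRealCLM.hasFDerivAt.comp w
      ((hasDerivAt_inv h).comp_hasFDerivAt w hN)
    have h2 : HasFDerivAt (fun z : Fin n → ℂ => ∑ l, z l * starRingEnd ℂ (a l))
        (∑ l, (starRingEnd ℂ (a l)) • ContinuousLinearMap.proj (R := ℝ) (φ := fun _ : Fin n => ℂ) l)
        w :=
      HasFDerivAt.fun_sum fun l _ =>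
        (ContinuousLinearMap.proj (R := ℝ) (φ := fun _ : Fin n => ℂ) l).hasFDerivAt.mul_const _
    have h3 := h2.mul h1
    have h4 : fderiv ℝ (fun z : Fin n → ℂ => (∑ l, z l * starRingEnd ℂ (a l)) *
        (((ε + ∑ l, ‖z l‖ ^ 2)⁻¹ : ℝ) : ℂ)) w = _ := h3.fderiv
    rw [h4]
    simp only [FunLike.coe_add, Pi.add_apply, FunLike.coe_smul, Pi.smul_apply, FunLike.coe_sum,
      Finset.sum_apply, ContinuousLinearMap.comp_apply, smul_eq_mul, Function.comp_apply,
      Complex.ofRealCLM_apply, ContinuousLinearMap.proj_apply]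
    push_cast
    rw [hN']
    simp only [mul_comm (starRingEnd ℂ (a _)), ← inv_pow]
    ring
  -- The products of two antilinear sums are symmetric in the two vectors and cancel in the
  -- antisymmetrisation.
  rw [key, key]
  have hc (x : Fin n → ℂ) : ∑ l, starRingEnd ℂ (w l) * x l = ∑ l, x l * starRingEnd ℂ (w l) :=
    Finset.sum_congr rfl fun l _ => mul_comm _ _
  rw [hc, hc]
  ring

/-- `log ‖t‖²` is pluriharmonic for a holomorphic function `t` without zeros. -/
lemma ddc_log_normSq_holomorphic {t : (Fin m → ℂ) → ℂ} {y : Fin m → ℂ} (ht : ContDiffAt ℂ ω t y)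
    (h0 : t y ≠ 0) : ddc (fun z => Real.log (‖t z‖ ^ 2)) y = 0 := by
  have hne : (0 : ℝ) + ∑ l : Fin 1, ‖(fun _ : Fin 1 => t y) l‖ ^ 2 ≠ 0 := by simpa using h0
  have h1 := ddc_comp (g := fun z (_ : Fin 1) => t z)
    ((contDiffAt_log_normSq hne).of_le le_top) (contDiffAt_pi.2 fun _ => ht)
  have h2 : ddc (fun w : Fin 1 → ℂ => Real.log (0 + ∑ l, ‖w l‖ ^ 2)) (fun _ => t y) = 0 := by
    ext v
    rw [ddc_log_normSq hne]
    have hN : (((0 + ∑ l : Fin 1, ‖(fun _ : Fin 1 => t y) l‖ ^ 2 : ℝ) : ℝ) : ℂ) =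
        t y * starRingEnd ℂ (t y) := by
      simp [Complex.mul_conj, Complex.normSq_eq_norm_sq]
    rw [hN]
    have h3 : starRingEnd ℂ (t y) ≠ 0 := by simpa using h0
    simp only [Finset.univ_unique, Fin.default_eq_zero, Finset.sum_singleton,
      AlternatingMap.zero_apply]
    field_simp
    ring
  rw [h2] at h1
  have h3 : (fun z => Real.log (‖t z‖ ^ 2)) =
      fun z => Real.log (0 + ∑ _l : Fin 1, ‖t z‖ ^ 2) := by
    funext z; simp
  rw [h3, h1]
  ext v
  simp

end DDC

/-! ### Holomorphic charts and Sard's theorem -/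

section Charts

variable {E F : Type*} [NormedAddCommGroup E] [NormedSpace ℂ E]
  [NormedAddCommGroup F] [NormedSpace ℂ F]

lemma contDiffOn_fderiv_of_isOpen {f : E → F} {Ω : Set E} (hΩ : IsOpen Ω)
    (hf : ContDiffOn ℂ ω f Ω) : ContDiffOn ℂ ω (fderiv ℂ f) Ω := fun _ hx =>
  ((hf.contDiffAt (hΩ.mem_nhds hx)).fderiv_right (m := ω) (by simp)).contDiffWithinAt

/-- The holomorphic inverse function theorem. -/
lemma exists_holomorphic_chart [CompleteSpace E] [CompleteSpace F] {f : E → F} {Ω : Set E} (hΩ : IsOpen Ω) (hf : ContDiffOn ℂ ω f Ω)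
    {x₀ : E} (hx₀ : x₀ ∈ Ω) (hb : ∃ e : E ≃L[ℂ] F, (e : E →L[ℂ] F) = fderiv ℂ f x₀) :
    ∃ H : OpenPartialHomeomorph E F, x₀ ∈ H.source ∧ H.source ⊆ Ω ∧ ⇑H = f ∧
      (∀ x ∈ H.source, ∃ e : E ≃L[ℂ] F, (e : E →L[ℂ] F) = fderiv ℂ f x) ∧
      ContDiffOn ℂ ω H.symm H.target := by
  obtain ⟨e, he⟩ := hb
  have hfa := hf.contDiffAt (hΩ.mem_nhds hx₀)
  have hd : HasFDerivAt f (e : E →L[ℂ] F) x₀ := by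
    rw [he]; exact (hfa.differentiableAt (by simp)).hasFDerivAt
  -- The source is shrunk to the open set where the derivative is still invertible, so that the
  -- inverse is holomorphic on the whole target and not only near one point.
  have hopen : IsOpen (Ω ∩ fderiv ℂ f ⁻¹' Set.range ((↑) : (E ≃L[ℂ] F) → E →L[ℂ] F)) :=
    (contDiffOn_fderiv_of_isOpen hΩ hf).continuousOn.isOpen_inter_preimage hΩ
      ContinuousLinearEquiv.isOpen
  let H := (hfa.toOpenPartialHomeomorph f hd (by simp)).restrOpen _ hopen
  refine ⟨H, ⟨hfa.mem_toOpenPartialHomeomorph_source hd (by simp), hx₀, e, he⟩,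
    fun x hx => hx.2.1, rfl, fun x hx => hx.2.2, fun y hy => ?_⟩
  have hs := H.map_target hy
  obtain ⟨e', he'⟩ := hs.2.2
  have hc : ContDiffAt ℂ ω f (H.symm y) := hf.contDiffAt (hΩ.mem_nhds hs.2.1)
  refine (H.contDiffAt_symm hy (f₀' := e') ?_ hc).contDiffWithinAt
  rw [he']
  exact (hc.differentiableAt (by simp)).hasFDerivAt

/-- Adjoining to `A` a linear projection onto its kernel gives an injective map between spaces of
equal dimension. This is how submersions are completed to local coordinates below. -/
lemma exists_complement [FiniteDimensional ℂ E] [FiniteDimensional ℂ F] {p : ℕ}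
    (hp : Module.finrank ℂ F + p = Module.finrank ℂ E) {A : E →L[ℂ] F}
    (hA : Function.Surjective A) :
    ∃ P : E →L[ℂ] (Fin p → ℂ), ∃ e : E ≃L[ℂ] F × (Fin p → ℂ),
      (e : E →L[ℂ] F × (Fin p → ℂ)) = A.prod P := by
  have hker : Module.finrank ℂ (LinearMap.ker A.toLinearMap) = p := by
    have h1 := LinearMap.finrank_range_add_finrank_ker A.toLinearMap
    rw [LinearMap.range_eq_top.2 hA, finrank_top] at h1
    omega
  obtain ⟨pr, hpr⟩ := (LinearMap.ker A.toLinearMap).subtype.exists_leftInverse_of_injective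
    (Submodule.ker_subtype _)
  let φ : LinearMap.ker A.toLinearMap ≃ₗ[ℂ] (Fin p → ℂ) :=
    LinearEquiv.ofFinrankEq _ _ (by rw [hker]; simp)
  let P : E →ₗ[ℂ] (Fin p → ℂ) := φ.toLinearMap ∘ₗ pr
  have hinj : Function.Injective (A.toLinearMap.prod P) := by
    rw [← LinearMap.ker_eq_bot, LinearMap.ker_eq_bot']
    intro x hx
    have h1 : A x = 0 := congrArg Prod.fst hx
    have h2 : φ (pr x) = 0 := congrArg Prod.snd hx
    have h3 : pr x = 0 := by simpa using h2
    have h4 := LinearMap.congr_fun hpr ⟨x, h1⟩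
    simp only [LinearMap.comp_apply, Submodule.subtype_apply, LinearMap.id_apply] at h4
    rw [h3] at h4
    exact congrArg Subtype.val h4.symm
  have hfr : Module.finrank ℂ E = Module.finrank ℂ (F × (Fin p → ℂ)) := by
    rw [Module.finrank_prod, ← hp]; simp
  refine ⟨P.toContinuousLinearMap,
    (LinearEquiv.ofInjectiveOfFinrankEq _ hinj hfr).toContinuousLinearEquiv, ?_⟩
  ext x <;> rfl

/-- A map is surjective exactly when some complementary projection completes it to an isomorphism,
and isomorphisms form an open set. -/
lemma isOpen_setOf_surjective [FiniteDimensional ℂ E] [FiniteDimensional ℂ F] :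
    IsOpen {A : E →L[ℂ] F | Function.Surjective A} := by
  have key : {A : E →L[ℂ] F | Function.Surjective A} =
      ⋃ P : E →L[ℂ] (Fin (Module.finrank ℂ E - Module.finrank ℂ F) → ℂ),
        (fun A : E →L[ℂ] F => A.prod P) ⁻¹' Set.range
          ((↑) : (E ≃L[ℂ] F × (Fin (Module.finrank ℂ E - Module.finrank ℂ F) → ℂ)) → _) := by
    ext A
    simp only [Set.mem_ofPred_eq, Set.mem_iUnion, Set.mem_preimage, Set.mem_range]
    constructor
    · intro hA
      have := LinearMap.finrank_le_finrank_of_surjective (f := A.toLinearMap) hA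
      exact exists_complement (by omega) hA
    · rintro ⟨P, e, he⟩ y
      refine ⟨e.symm (y, 0), ?_⟩
      have := DFunLike.congr_fun he (e.symm (y, 0))
      simp only [ContinuousLinearEquiv.coe_coe, ContinuousLinearEquiv.apply_symm_apply] at this
      exact (congrArg Prod.fst this).symm
  rw [key]
  refine isOpen_iUnion fun P => ContinuousLinearEquiv.isOpen.preimage ?_
  exact (ContinuousLinearMap.prodₗᵢ (𝕜 := ℂ) ℂ).continuous.comp (continuous_id.prodMk continuous_const)

end Charts

/-! ### σ-compact sets and measurability of images -/

section SigmaCompact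

variable {E : Type*} [TopologicalSpace E]

/-- Continuous images of such sets are again σ-compact, hence Borel; this provides the measurability
of images that Fubini's theorem needs in the Sard arguments. -/
lemma IsOpen.isSigmaCompact_inter [LocallyCompactSpace E] [SecondCountableTopology E]
    {N C : Set E} (hN : IsOpen N) (hC : IsClosed C) : IsSigmaCompact (N ∩ C) := by
  have : LocallyCompactSpace N := hN.isOpenEmbedding_subtypeVal.locallyCompactSpace
  have hs : IsSigmaCompact N := isSigmaCompact_iff_sigmaCompactSpace.2 inferInstance
  obtain ⟨K, hK, hU⟩ := hs
  exact ⟨fun i => K i ∩ C, fun i => (hK i).inter_right hC, by rw [← Set.iUnion_inter, hU]⟩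

lemma IsSigmaCompact.measurableSet [T2Space E] [MeasurableSpace E] [OpensMeasurableSpace E]
    {S : Set E} (hS : IsSigmaCompact S) : MeasurableSet S := by
  obtain ⟨K, hK, rfl⟩ := hS
  exact MeasurableSet.iUnion fun i => (hK i).isClosed.measurableSet

end SigmaCompact

/-! ### Sard's theorem for holomorphic maps -/

section Sard

/-- By the Lindelöf property countably many of the neighbourhoods cover `S`. The next lemma is the
same argument for null sets. -/
lemma countable_image_of_locally {X Y : Type*} [TopologicalSpace X] [SecondCountableTopology X]
    (f : X → Y) (S : Set X) (h : ∀ z ∈ S, ∃ N ∈ 𝓝[S] z, (f '' (N ∩ S)).Countable) :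
    (f '' S).Countable := by
  choose! N hN hc using h
  obtain ⟨t, htS, ht, hcov⟩ := TopologicalSpace.countable_cover_nhdsWithin hN
  refine (ht.biUnion fun z hz => hc z (htS hz)).mono ?_
  rintro _ ⟨z, hz, rfl⟩
  obtain ⟨w, hw, hzw⟩ := Set.mem_iUnion₂.1 (hcov hz)
  exact Set.mem_iUnion₂.2 ⟨w, hw, z, ⟨hzw, hz⟩, rfl⟩

lemma measure_image_zero_of_locally {X Y : Type*} [TopologicalSpace X]
    [SecondCountableTopology X] [MeasurableSpace Y] (μ : Measure Y)
    (f : X → Y) (S : Set X) (h : ∀ z ∈ S, ∃ N ∈ 𝓝[S] z, μ (f '' (N ∩ S)) = 0) :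
    μ (f '' S) = 0 := by
  choose! N hN hc using h
  obtain ⟨t, htS, ht, hcov⟩ := TopologicalSpace.countable_cover_nhdsWithin hN
  refine measure_mono_null ?_ ((measure_biUnion_null_iff ht).2 fun z hz => hc z (htS hz))
  rintro _ ⟨z, hz, rfl⟩
  obtain ⟨w, hw, hzw⟩ := Set.mem_iUnion₂.1 (hcov hz)
  exact Set.mem_iUnion₂.2 ⟨w, hw, z, ⟨hzw, hz⟩, rfl⟩

/-- The power series at `z` reduces to its constant term. -/
lemma eventually_eq_of_iteratedFDeriv_eq_zero {E F : Type*} [NormedAddCommGroup E]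
    [NormedSpace ℂ E] [NormedAddCommGroup F] [NormedSpace ℂ F] [CompleteSpace F] {f : E → F}
    {z : E} (hf : AnalyticAt ℂ f z) (h : ∀ r, iteratedFDeriv ℂ (r + 1) f z = 0) :
    ∀ᶠ y in 𝓝 z, f y = f z := by
  obtain ⟨p, r, hp⟩ := hf
  filter_upwards [Metric.eball_mem_nhds z hp.r_pos] with y hy
  have hy' : y - z ∈ Metric.eball (0 : E) r := by
    simpa [Metric.mem_eball, edist_eq_enorm_sub] using hy
  have h1 := hp.hasSum_iteratedFDeriv hy'
  have h2 : HasSum (fun n : ℕ => ((Nat.factorial n : ℂ)⁻¹) •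
      iteratedFDeriv ℂ n f z fun _ => y - z) (f z) := by
    convert! hasSum_single (f := fun n : ℕ => ((Nat.factorial n : ℂ)⁻¹) •
      iteratedFDeriv ℂ n f z fun _ => y - z) 0 ?_ using 1
    · simp
    · intro n hn
      obtain ⟨r, rfl⟩ := Nat.exists_eq_succ_of_ne_zero hn
      simp [h r]
  have h3 : z + (y - z) = y := by abel
  rw [h3] at h1
  refine h1.unique ?_
  simpa using h2

/-- The set of critical values of a holomorphic function is countable. -/
theorem countable_criticalValues : ∀ (m : ℕ) (W : Set (Fin m → ℂ)) (f : (Fin m → ℂ) → ℂ),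
    IsOpen W → ContDiffOn ℂ ω f W → (f '' {z ∈ W | fderiv ℂ f z = 0}).Countable
  | 0, W, f, _, _ => (Set.subsingleton_of_subsingleton.image f).countable
  | m + 1, W, f, hW, hf => by
    have hfa : AnalyticOnNhd ℂ f W := fun z hz =>
      (hf.contDiffAt (hW.mem_nhds hz)).analyticAt
    -- Critical points are sorted by the order of the first nonvanishing derivative; if there is
    -- none, `f` is locally constant, which is the case `S'`.
    let S : ℕ → Set (Fin (m + 1) → ℂ) := fun r =>
      {z ∈ W | fderiv ℂ f z = 0 ∧ iteratedFDeriv ℂ (r + 1) f z = 0 ∧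
        iteratedFDeriv ℂ (r + 2) f z ≠ 0}
    let S' : Set (Fin (m + 1) → ℂ) := {z ∈ W | ∀ r, iteratedFDeriv ℂ (r + 1) f z = 0}
    have hsub : {z ∈ W | fderiv ℂ f z = 0} ⊆ S' ∪ ⋃ r, S r := by
      rintro z ⟨hz, hz0⟩
      by_cases hall : ∀ r, iteratedFDeriv ℂ (r + 1) f z = 0
      · exact Or.inl ⟨hz, hall⟩
      · right
        push Not at hall
        classical
        have h0 : Nat.find hall ≠ 0 := by
          intro h
          apply (Nat.find_eq_zero hall).1 h
          ext v
          simp [iteratedFDeriv_succ_apply_right, hz0]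
        obtain ⟨r, hr⟩ := Nat.exists_eq_succ_of_ne_zero h0
        refine Set.mem_iUnion.2 ⟨r, hz, hz0, ?_, ?_⟩
        · by_contra hcon
          exact Nat.find_min hall (m := r) (by omega) hcon
        · have := Nat.find_spec hall
          rwa [hr] at this
    refine Set.Countable.mono (Set.image_mono hsub) ?_
    rw [Set.image_union, Set.image_iUnion]
    refine Set.Countable.union ?_ (Set.countable_iUnion fun r => ?_)
    · refine countable_image_of_locally f S' fun z hz => ?_
      refine ⟨_, mem_nhdsWithin_of_mem_nhds
        (eventually_eq_of_iteratedFDeriv_eq_zero (hfa z hz.1) hz.2), ?_⟩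
      refine (Set.countable_singleton (f z)).mono ?_
      rintro _ ⟨y, ⟨hy, -⟩, rfl⟩
      exact hy
    · refine countable_image_of_locally f (S r) fun z hz => ?_
      obtain ⟨hzW, hz0, hz1, hz2⟩ := hz
      obtain ⟨v, hv⟩ : ∃ v, iteratedFDeriv ℂ (r + 2) f z v ≠ 0 := by
        by_contra hcon
        push Not at hcon
        exact hz2 (by ext v; simpa using hcon v)
      -- `D` is a partial derivative of order `r + 1`: it vanishes on all of `S r` but has nonzero
      -- differential at `z`. So near `z` the set `S r` lies in a smooth hypersurface, and points of
      -- `S r` are critical for the restriction of `f` to it; induction on the dimension applies.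
      let D : (Fin (m + 1) → ℂ) → ℂ := fun y => iteratedFDeriv ℂ (r + 1) f y (Fin.tail v)
      have hD' : AnalyticOnNhd ℂ (iteratedFDeriv ℂ (r + 1) f) W := hfa.iteratedFDeriv (r + 1)
      have hD : ContDiffOn ℂ ω D W := fun y hy =>
        (((ContinuousMultilinearMap.apply ℂ (fun _ : Fin (r + 1) => Fin (m + 1) → ℂ) ℂ
          (Fin.tail v)).contDiff.contDiffAt).comp y (hD' y hy).contDiffAt).contDiffWithinAt
      have hDd : fderiv ℂ D z (v 0) ≠ 0 := by
        have h1 := (ContinuousMultilinearMap.apply ℂ (fun _ : Fin (r + 1) => Fin (m + 1) → ℂ) ℂ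
          (Fin.tail v)).hasFDerivAt.comp z (hD' z hzW).differentiableAt.hasFDerivAt
        have h2 : fderiv ℂ D z (v 0) =
            fderiv ℂ (iteratedFDeriv ℂ (r + 1) f) z (v 0) (Fin.tail v) :=
          DFunLike.congr_fun h1.fderiv (v 0)
        rw [h2, ← iteratedFDeriv_succ_apply_left]
        exact hv
      have hsurj : Function.Surjective (fderiv ℂ D z) := fun c =>
        ⟨(c / fderiv ℂ D z (v 0)) • v 0, by simp [hDd]⟩
      obtain ⟨P, hP⟩ := exists_complement (p := m) (by simp [add_comm]) hsurj
      have hG : ContDiffOn ℂ ω (fun y => (D y, P y)) W := hD.prodMk P.contDiff.contDiffOn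
      have hGd : fderiv ℂ (fun y => (D y, P y)) z = (fderiv ℂ D z).prod P := by
        rw [DifferentiableAt.fderiv_prodMk
          ((hD.contDiffAt (hW.mem_nhds hzW)).differentiableAt (by simp)) P.differentiableAt,
          P.fderiv]
      obtain ⟨H, hzH, hHW, hHf, -, hHs⟩ := exists_holomorphic_chart hW hG hzW (by rwa [hGd])
      let ψ : (Fin m → ℂ) → (Fin (m + 1) → ℂ) := fun x => H.symm (0, x)
      let V : Set (Fin m → ℂ) := {x | ((0 : ℂ), x) ∈ H.target}
      have hV : IsOpen V := H.open_target.preimage (by fun_prop)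
      have hψ : ContDiffOn ℂ ω ψ V :=
        hHs.comp (contDiffOn_const.prodMk contDiffOn_id) fun x hx => hx
      have hψW : Set.MapsTo ψ V W := fun x hx => hHW (H.map_target hx)
      have hfψ : ContDiffOn ℂ ω (f ∘ ψ) V := hf.comp hψ hψW
      refine ⟨H.source, mem_nhdsWithin_of_mem_nhds (H.open_source.mem_nhds hzH),
        (countable_criticalValues m V (f ∘ ψ) hV hfψ).mono ?_⟩
      rintro _ ⟨y, ⟨hyH, hyW, hy0, hy1, -⟩, rfl⟩
      have hHy : H y = (0, P y) := by
        have h1 : D y = 0 := by simp [D, hy1]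
        rw [hHf]
        exact Prod.ext h1 rfl
      have hPy : P y ∈ V := by
        change ((0 : ℂ), P y) ∈ H.target
        rw [← hHy]
        exact H.map_source hyH
      have hψy : ψ (P y) = y := by
        change H.symm (0, P y) = y
        rw [← hHy, H.left_inv hyH]
      refine ⟨P y, ⟨hPy, ?_⟩, by simp [hψy]⟩
      rw [fderiv_comp _ ((hf.contDiffAt (hW.mem_nhds (hψW hPy))).differentiableAt (by simp))
        ((hψ.contDiffAt (hV.mem_nhds hPy)).differentiableAt (by simp)), hψy, hy0]
      simp

/-- Sard's theorem for holomorphic maps. -/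
theorem sard : ∀ (k m : ℕ) (W : Set (Fin m → ℂ)) (f : (Fin m → ℂ) → (Fin k → ℂ)),
    IsOpen W → ContDiffOn ℂ ω f W →
      volume (f '' {z ∈ W | ¬ Function.Surjective (fderiv ℂ f z)}) = 0
  | 0, m, W, f, _, _ => by
    have : {z ∈ W | ¬ Function.Surjective (fderiv ℂ f z)} = ∅ := by
      ext z
      simp only [Set.mem_ofPred_eq, Set.mem_empty_iff_false, iff_false, not_and, not_not]
      exact fun _ y => ⟨0, Subsingleton.elim _ _⟩
    simp [this]
  | k + 1, m, W, f, hW, hf => by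
    let f' : (Fin m → ℂ) → (Fin k → ℂ) := fun z j => f z j.succ
    have hf' : ContDiffOn ℂ ω f' W := contDiffOn_pi.2 fun j => (contDiffOn_pi.1 hf) j.succ
    have hf0 : ContDiffOn ℂ ω (fun z => f z 0) W := (contDiffOn_pi.1 hf) 0
    have hda {z} (hz : z ∈ W) : DifferentiableAt ℂ f z :=
      (hf.contDiffAt (hW.mem_nhds hz)).differentiableAt (by simp)
    have hfd {z} (hz : z ∈ W) (v : Fin m → ℂ) (j : Fin (k + 1)) :
        fderiv ℂ f z v j = fderiv ℂ (fun z => f z j) z v := by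
      have := (hasFDerivAt_pi'.1 (hda hz).hasFDerivAt) j
      rw [this.fderiv]
      rfl
    have hfd' {z} (hz : z ∈ W) (v : Fin m → ℂ) (j : Fin k) :
        fderiv ℂ f' z v j = fderiv ℂ f z v j.succ := by
      rw [hfd hz]
      have h1 : DifferentiableAt ℂ f' z :=
        (hf'.contDiffAt (hW.mem_nhds hz)).differentiableAt (by simp)
      have := (hasFDerivAt_pi'.1 h1.hasFDerivAt) j
      change _ = fderiv ℂ (fun z => f' z j) z v
      rw [this.fderiv]
      rfl
    -- Either the last `k` components `f'` are already critical, and the image lies in the cylinder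
    -- over a set that is null by induction; or `f'` is a submersion, and the remaining component is
    -- studied along the fibres of `f'`.
    let A := {z ∈ W | ¬ Function.Surjective (fderiv ℂ f' z)}
    let B := {z ∈ W | Function.Surjective (fderiv ℂ f' z) ∧ ¬ Function.Surjective (fderiv ℂ f z)}
    have hsub : {z ∈ W | ¬ Function.Surjective (fderiv ℂ f z)} ⊆ A ∪ B := by
      rintro z ⟨hz, hz'⟩
      by_cases h : Function.Surjective (fderiv ℂ f' z)
      · exact Or.inr ⟨hz, h, hz'⟩
      · exact Or.inl ⟨hz, h⟩
    have hmp := (volume_preserving_piFinSuccAbove (fun _ : Fin (k + 1) => ℂ) 0)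
    refine measure_mono_null (Set.image_mono hsub) ?_
    rw [Set.image_union]
    refine measure_union_null ?_ (measure_image_zero_of_locally _ _ _ fun z hz => ?_)
    · have hq : Measure.QuasiMeasurePreserving
          (fun y : Fin (k + 1) → ℂ => fun j : Fin k => y j.succ) :=
        (Measure.quasiMeasurePreserving_snd (μ := (volume : Measure ℂ))
          (ν := (volume : Measure (Fin k → ℂ)))).comp hmp.quasiMeasurePreserving
      refine measure_mono_null ?_ (hq.preimage_null (sard k m W f' hW hf'))
      rintro _ ⟨z, hz, rfl⟩
      exact ⟨z, hz, rfl⟩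
    · obtain ⟨hzW, hzs, -⟩ := hz
      have hkm : k ≤ m := by
        simpa using LinearMap.finrank_le_finrank_of_surjective (f := (fderiv ℂ f' z).toLinearMap) hzs
      let W' := W ∩ fderiv ℂ f' ⁻¹' {A | Function.Surjective A}
      have hW' : IsOpen W' :=
        (contDiffOn_fderiv_of_isOpen hW hf').continuousOn.isOpen_inter_preimage hW
          isOpen_setOf_surjective
      obtain ⟨P, hP⟩ := exists_complement (p := m - k) (by simp; omega) hzs
      have hG : ContDiffOn ℂ ω (fun y => (f' y, P y)) W' :=
        (hf'.mono Set.inter_subset_left).prodMk P.contDiff.contDiffOn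
      have hzW' : z ∈ W' := ⟨hzW, hzs⟩
      have hGd : fderiv ℂ (fun y => (f' y, P y)) z = (fderiv ℂ f' z).prod P := by
        rw [DifferentiableAt.fderiv_prodMk
          ((hf'.contDiffAt (hW.mem_nhds hzW)).differentiableAt (by simp)) P.differentiableAt,
          P.fderiv]
      obtain ⟨H, hzH, hHW, hHf, -, hHs⟩ := exists_holomorphic_chart hW' hG hzW' (by rwa [hGd])
      refine ⟨H.source, mem_nhdsWithin_of_mem_nhds (H.open_source.mem_nhds hzH), ?_⟩
      have hHW2 : H.source ⊆ W := hHW.trans Set.inter_subset_left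
      -- the image is σ-compact
      have hSeq : H.source ∩ B =
          H.source ∩ (H.source ∩ fderiv ℂ f ⁻¹' {A | Function.Surjective A})ᶜ := by
        ext y
        constructor
        · rintro ⟨hy, -, -, hy'⟩
          exact ⟨hy, fun h => hy' h.2⟩
        · rintro ⟨hy, hy'⟩
          exact ⟨hy, hHW2 hy, (hHW hy).2, fun h => hy' ⟨hy, h⟩⟩
      have hO : IsOpen (H.source ∩ fderiv ℂ f ⁻¹' {A | Function.Surjective A}) :=
        ((contDiffOn_fderiv_of_isOpen hW hf).mono hHW2).continuousOn.isOpen_inter_preimage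
          H.open_source isOpen_setOf_surjective
      have hmeas : MeasurableSet (f '' (H.source ∩ B)) := by
        rw [hSeq]
        refine IsSigmaCompact.measurableSet (IsSigmaCompact.image_of_continuousOn
          (IsOpen.isSigmaCompact_inter H.open_source hO.isClosed_compl) ?_)
        exact (hf.mono hHW2).continuousOn.mono Set.inter_subset_left
      -- Fubini
      have hmp' := (Measure.measurePreserving_swap.comp hmp).symm
        ((MeasurableEquiv.piFinSuccAbove (fun _ : Fin (k + 1) => ℂ) 0).trans MeasurableEquiv.prodComm)
      rw [← hmp'.measure_preimage hmeas.nullMeasurableSet, Measure.measure_prod_null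
        (hmp'.measurable hmeas)]
      refine .of_forall fun t => ?_
      -- `ψ` parametrizes the fibre `f' = t` in the chart. The slice of the image over `t` consists
      -- of critical values of `f · 0` on this fibre, hence is countable.
      let ψ : (Fin (m - k) → ℂ) → (Fin m → ℂ) := fun x => H.symm (t, x)
      let V : Set (Fin (m - k) → ℂ) := {x | (t, x) ∈ H.target}
      have hV : IsOpen V := H.open_target.preimage (by fun_prop)
      have hψ : ContDiffOn ℂ ω ψ V :=
        hHs.comp (contDiffOn_const.prodMk contDiffOn_id) fun x hx => hx
      have hψW : Set.MapsTo ψ V W := fun x hx => hHW2 (H.map_target hx)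
      refine Set.Countable.measure_zero ((countable_criticalValues (m - k) V
        ((fun z => f z 0) ∘ ψ) hV (hf0.comp hψ hψW)).mono ?_) _
      rintro c ⟨y, ⟨hyH, hyB⟩, hy⟩
      have hy0 : f y 0 = c := by rw [hy]; rfl
      have hyt : f' y = t := by funext j; change f y j.succ = t j; rw [hy]; rfl
      have hHy : H y = (t, P y) := by rw [hHf, ← hyt]
      have hPy : P y ∈ V := by
        change (t, P y) ∈ H.target
        rw [← hHy]
        exact H.map_source hyH
      have hψy : ψ (P y) = y := by
        change H.symm (t, P y) = y
        rw [← hHy, H.left_inv hyH]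
      refine ⟨P y, ⟨hPy, ?_⟩, by simp [hψy, hy0]⟩
      have hψd : DifferentiableAt ℂ ψ (P y) :=
        (hψ.contDiffAt (hV.mem_nhds hPy)).differentiableAt (by simp)
      have hyW : y ∈ W := hHW2 hyH
      by_contra hne
      have hcomp : fderiv ℂ ((fun z => f z 0) ∘ ψ) (P y) =
          (fderiv ℂ (fun z => f z 0) y).comp (fderiv ℂ ψ (P y)) := by
        rw [fderiv_comp _ ((hf0.contDiffAt (hW.mem_nhds (hψW hPy))).differentiableAt (by simp)) hψd,
          hψy]
      obtain ⟨v, hv⟩ : ∃ v, fderiv ℂ (fun z => f z 0) y (fderiv ℂ ψ (P y) v) ≠ 0 := by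
        by_contra hcon
        push Not at hcon
        exact hne (by ext v; rw [hcomp]; exact hcon v)
      set d := fderiv ℂ ψ (P y) v
      have hd : fderiv ℂ f' y d = 0 := by
        have h1 : f' ∘ ψ =ᶠ[𝓝 (P y)] fun _ => t := by
          filter_upwards [hV.mem_nhds hPy] with x hx
          have h2 : H (ψ x) = (t, x) := H.right_inv hx
          rw [hHf] at h2
          exact congrArg Prod.fst h2
        have h3 := h1.fderiv_eq (𝕜 := ℂ)
        rw [fderiv_comp _ ((hf'.contDiffAt (hW.mem_nhds (hψW hPy))).differentiableAt (by simp)) hψd,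
          hψy] at h3
        have := DFunLike.congr_fun h3 v
        simpa using this
      refine hyB.2.2 fun b => ?_
      obtain ⟨u, hu⟩ := hyB.2.1 (fun j => b j.succ)
      -- If `f · 0` had a nonzero derivative along a vector `d` tangent to the fibre, adding a
      -- multiple of `d` would correct the zeroth component without changing the others, and the
      -- differential of `f` would be surjective.
      refine ⟨u + ((b 0 - fderiv ℂ f y u 0) / fderiv ℂ (fun z => f z 0) y d) • d, ?_⟩
      funext j
      refine Fin.cases ?_ (fun j => ?_) j
      · have h1 := hfd hyW d 0
        rw [map_add, map_smul, Pi.add_apply, Pi.smul_apply, h1, smul_eq_mul, div_mul_cancel₀ _ hv]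
        ring
      · have h1 := hfd' hyW d j
        have h2 := hfd' hyW u j
        rw [hd] at h1
        rw [hu] at h2
        simp only [map_add, map_smul, Pi.add_apply, Pi.smul_apply]
        rw [← h1, ← h2]
        simp

end Sard

/-! ### The incidence variety as a graph -/

section Graph

variable {m k : ℕ} {n : Fin k → ℕ}

/-- The distinguished coefficients for which `z` is a common zero, as a function of `z` and of the
other coefficients. -/
def graphMap (g : ∀ j, (Fin m → ℂ) → Fin (n j) → ℂ) (q : (Fin m → ℂ) × (∀ j, Fin (n j) → ℂ)) :
    Fin k → ℂ := fun j => -∑ l, q.2 j l * g j q.1 l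

/-- The differential in `z` of `graphMap`. -/
def graphDeriv (g : ∀ j, (Fin m → ℂ) → Fin (n j) → ℂ) (z : Fin m → ℂ)
    (a : ∀ j, Fin (n j) → ℂ) (j : Fin k) : (Fin m → ℂ) →L[ℂ] ℂ :=
  -∑ l, a j l • fderiv ℂ (fun z => g j z l) z

variable {g : ∀ j, (Fin m → ℂ) → Fin (n j) → ℂ} {W : Set (Fin m → ℂ)}

lemma contDiffOn_graphMap (hg : ∀ j, ContDiffOn ℂ ω (g j) W) :
    ContDiffOn ℂ ω (graphMap g) (W ×ˢ Set.univ) := by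
  refine contDiffOn_pi.2 fun j => ContDiffOn.neg (ContDiffOn.sum fun l _ => ?_)
  refine ContDiffOn.mul ?_ ?_
  · exact contDiffOn_pi.1 (contDiffOn_pi.1 contDiffOn_snd j) l
  · exact (contDiffOn_pi.1 (hg j) l).comp contDiffOn_fst fun q hq => hq.1

lemma hasFDerivAt_graphMap (hW : IsOpen W) (hg : ∀ j, ContDiffOn ℂ ω (g j) W) {z : Fin m → ℂ}
    (hz : z ∈ W) (a : ∀ j, Fin (n j) → ℂ) :
    HasFDerivAt (fun z => graphMap g (z, a)) (ContinuousLinearMap.pi (graphDeriv g z a)) z := by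
  refine hasFDerivAt_pi.2 fun j => HasFDerivAt.neg (HasFDerivAt.fun_sum fun l _ => ?_)
  exact (((contDiffOn_pi.1 (hg j) l).contDiffAt (hW.mem_nhds hz)).differentiableAt
    (by simp)).hasFDerivAt.const_mul _

/-- A chart of the incidence variety in which the distinguished coefficients and the other ones are
coordinate functions; `inv` is the point as a function of the coordinates. -/
structure GraphChart (g : ∀ j, (Fin m → ℂ) → Fin (n j) → ℂ) (W : Set (Fin m → ℂ)) where
  /-- the domain -/
  src : Set ((Fin m → ℂ) × (∀ j, Fin (n j) → ℂ))
  /-- the image -/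
  tgt : Set ((∀ j, Fin (n j) → ℂ) × (Fin k → ℂ) × (Fin (m - k) → ℂ))
  /-- the inverse -/
  inv : (∀ j, Fin (n j) → ℂ) × (Fin k → ℂ) × (Fin (m - k) → ℂ) → (Fin m → ℂ)
  /-- the remaining coordinates -/
  proj : (Fin m → ℂ) →L[ℂ] (Fin (m - k) → ℂ)
  isOpen_src : IsOpen src
  isOpen_tgt : IsOpen tgt
  src_subset : ∀ q ∈ src, q.1 ∈ W
  contDiffOn_inv : ContDiffOn ℂ ω inv tgt
  inv_mem : ∀ t ∈ tgt, (inv t, t.1) ∈ src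
  graphMap_inv : ∀ t ∈ tgt, graphMap g (inv t, t.1) = t.2.1
  proj_inv : ∀ t ∈ tgt, proj (inv t) = t.2.2
  mem_tgt : ∀ q ∈ src, (q.2, graphMap g q, proj q.1) ∈ tgt
  inv_apply : ∀ q ∈ src, inv (q.2, graphMap g q, proj q.1) = q.1
  equiv : ∀ q ∈ src, ∃ e : (Fin m → ℂ) ≃L[ℂ] (Fin k → ℂ) × (Fin (m - k) → ℂ),
    (e : (Fin m → ℂ) →L[ℂ] (Fin k → ℂ) × (Fin (m - k) → ℂ)) =
      (ContinuousLinearMap.pi (graphDeriv g q.1 q.2)).prod proj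

variable (g W) in
/-- The chart with empty domain. -/
def GraphChart.empty : GraphChart g W where
  src := ∅
  tgt := ∅
  inv := 0
  proj := 0
  isOpen_src := isOpen_empty
  isOpen_tgt := isOpen_empty
  src_subset := by simp
  contDiffOn_inv := by simp
  inv_mem := by simp
  graphMap_inv := by simp
  proj_inv := by simp
  mem_tgt := by simp
  inv_apply := by simp
  equiv := by simp

lemma GraphChart.surjective (c : GraphChart g W) {q} (hq : q ∈ c.src) :
    Function.Surjective (ContinuousLinearMap.pi (graphDeriv g q.1 q.2)) := by
  obtain ⟨e, he⟩ := c.equiv q hq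
  intro y
  refine ⟨e.symm (y, 0), ?_⟩
  have := DFunLike.congr_fun he (e.symm (y, 0))
  simp only [ContinuousLinearEquiv.coe_coe, ContinuousLinearEquiv.apply_symm_apply] at this
  exact (congrArg Prod.fst this).symm

lemma exists_graphChart (hW : IsOpen W) (hg : ∀ j, ContDiffOn ℂ ω (g j) W)
    {q : (Fin m → ℂ) × (∀ j, Fin (n j) → ℂ)} (hq : q.1 ∈ W)
    (hs : Function.Surjective (ContinuousLinearMap.pi (graphDeriv g q.1 q.2))) :
    ∃ c : GraphChart g W, q ∈ c.src := by
  have hkm : k ≤ m := by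
    simpa using LinearMap.finrank_le_finrank_of_surjective
      (f := (ContinuousLinearMap.pi (graphDeriv g q.1 q.2)).toLinearMap) hs
  obtain ⟨P, e, he⟩ := exists_complement (p := m - k) (by simp; omega) hs
  have hΩ : IsOpen (W ×ˢ (Set.univ : Set (∀ j, Fin (n j) → ℂ))) := hW.prod isOpen_univ
  have hG := contDiffOn_graphMap hg
  -- Keeping the coefficients `a` as coordinates makes the differential of `J` block triangular, so
  -- it is invertible as soon as its restriction to the slice of fixed `a` is. The dependence of the
  -- slice charts on `a` is then holomorphic too.
  let J : (Fin m → ℂ) × (∀ j, Fin (n j) → ℂ) →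
      (∀ j, Fin (n j) → ℂ) × (Fin k → ℂ) × (Fin (m - k) → ℂ) :=
    fun q => (q.2, graphMap g q, P q.1)
  have hJ : ContDiffOn ℂ ω J (W ×ˢ Set.univ) :=
    contDiffOn_snd.prodMk (hG.prodMk (P.contDiff.comp_contDiffOn contDiffOn_fst))
  -- the differential of `J` on vectors tangent to the slices
  have hJd (x : (Fin m → ℂ) × (∀ j, Fin (n j) → ℂ)) (hx : x.1 ∈ W) (v : Fin m → ℂ) :
      fderiv ℂ J x (v, 0) = (0, ContinuousLinearMap.pi (graphDeriv g x.1 x.2) v, P v) := by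
    have hd : HasFDerivAt J (fderiv ℂ J x) x :=
      ((hJ.contDiffAt (hΩ.mem_nhds ⟨hx, trivial⟩)).differentiableAt (by simp)).hasFDerivAt
    have h1 : HasFDerivAt (fun z : Fin m → ℂ => (z, x.2))
        (ContinuousLinearMap.inl ℂ (Fin m → ℂ) (∀ j, Fin (n j) → ℂ)) x.1 :=
      hasFDerivAt_prodMk_left x.1 x.2
    have h2 : HasFDerivAt (fun z : Fin m → ℂ => J (z, x.2)) _ x.1 := HasFDerivAt.comp x.1 hd h1
    have h3 : HasFDerivAt (fun z : Fin m → ℂ => J (z, x.2)) _ x.1 :=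
      (hasFDerivAt_const x.2 x.1).prodMk ((hasFDerivAt_graphMap hW hg hx x.2).prodMk
        P.hasFDerivAt)
    have := DFunLike.congr_fun (h2.unique h3) v
    simpa using this
  have hJ1 (x : (Fin m → ℂ) × (∀ j, Fin (n j) → ℂ)) (hx : x.1 ∈ W)
      (v : (Fin m → ℂ) × (∀ j, Fin (n j) → ℂ)) : (fderiv ℂ J x v).1 = v.2 := by
    have hd : HasFDerivAt J (fderiv ℂ J x) x :=
      ((hJ.contDiffAt (hΩ.mem_nhds ⟨hx, trivial⟩)).differentiableAt (by simp)).hasFDerivAt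
    have h1 : HasFDerivAt (fun q => (J q).1) _ x := hd.fst
    have h2 : HasFDerivAt (fun q => (J q).1)
      (ContinuousLinearMap.snd ℂ (Fin m → ℂ) (∀ j, Fin (n j) → ℂ)) x := hasFDerivAt_snd
    exact DFunLike.congr_fun (h1.unique h2) v
  have hequiv : ∃ e : ((Fin m → ℂ) × (∀ j, Fin (n j) → ℂ)) ≃L[ℂ]
      (∀ j, Fin (n j) → ℂ) × (Fin k → ℂ) × (Fin (m - k) → ℂ),
      (e : _ →L[ℂ] (∀ j, Fin (n j) → ℂ) × (Fin k → ℂ) × (Fin (m - k) → ℂ)) = fderiv ℂ J q := by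
    have hinj : Function.Injective (fderiv ℂ J q).toLinearMap := by
      rw [← LinearMap.ker_eq_bot, LinearMap.ker_eq_bot']
      rintro ⟨v, b⟩ hv
      have hv' : fderiv ℂ J q (v, b) = 0 := hv
      have hb : b = 0 := by
        have := hJ1 q hq (v, b)
        rw [hv'] at this
        exact this.symm
      subst hb
      rw [hJd q hq] at hv'
      have h2 : e v = 0 := by
        have := DFunLike.congr_fun he v
        rw [ContinuousLinearEquiv.coe_coe] at this
        rw [this]
        exact congrArg Prod.snd hv'
      have : v = 0 := by simpa using h2
      rw [this]
      rfl
    have hfr : Module.finrank ℂ ((Fin m → ℂ) × (∀ j, Fin (n j) → ℂ)) =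
        Module.finrank ℂ ((∀ j, Fin (n j) → ℂ) × (Fin k → ℂ) × (Fin (m - k) → ℂ)) := by
      rw [Module.finrank_prod, Module.finrank_prod, e.toLinearEquiv.finrank_eq, add_comm]
    exact ⟨(LinearEquiv.ofInjectiveOfFinrankEq _ hinj hfr).toContinuousLinearEquiv, by ext <;> rfl⟩
  obtain ⟨H, hqH, hHΩ, hHJ, hHe, hHs⟩ := exists_holomorphic_chart hΩ hJ ⟨hq, trivial⟩ hequiv
  have hinv2 (t) (ht : t ∈ H.target) : (H.symm t).2 = t.1 := by
    have := H.right_inv ht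
    rw [hHJ] at this
    exact congrArg Prod.fst this
  have hpair (t) (ht : t ∈ H.target) : ((H.symm t).1, t.1) = H.symm t :=
    Prod.ext rfl (hinv2 t ht).symm
  refine ⟨{ src := H.source, tgt := H.target, inv := fun t => (H.symm t).1, proj := P,
            isOpen_src := H.open_source, isOpen_tgt := H.open_target,
            src_subset := fun q hq => (hHΩ hq).1,
            contDiffOn_inv := hHs.fst,
            inv_mem := fun t ht => by rw [hpair t ht]; exact H.map_target ht,
            graphMap_inv := fun t ht => ?_,
            proj_inv := fun t ht => ?_,
            mem_tgt := fun q hq => ?_,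
            inv_apply := fun q hq => ?_,
            equiv := fun x hx => ?_ }, hqH⟩
  · rw [hpair t ht]
    have := H.right_inv ht
    rw [hHJ] at this
    exact congrArg (fun t => t.2.1) this
  · have := H.right_inv ht
    rw [hHJ] at this
    exact congrArg (fun t => t.2.2) this
  · have := H.map_source hq
    rw [hHJ] at this
    exact this
  · have := H.left_inv hq
    rw [hHJ] at this
    exact congrArg Prod.fst this
  · obtain ⟨e', he'⟩ := hHe x hx
    have hxW := (hHΩ hx).1
    have hinj : Function.Injective
        ((ContinuousLinearMap.pi (graphDeriv g x.1 x.2)).prod P).toLinearMap := by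
      rw [← LinearMap.ker_eq_bot, LinearMap.ker_eq_bot']
      intro v hv
      have h1 : fderiv ℂ J x (v, 0) = 0 := by
        rw [hJd x hxW]
        exact Prod.ext rfl hv
      rw [← he'] at h1
      have h2 : ((v, 0) : (Fin m → ℂ) × (∀ j, Fin (n j) → ℂ)) = 0 := by simpa using h1
      exact congrArg Prod.fst h2
    exact ⟨(LinearEquiv.ofInjectiveOfFinrankEq _ hinj
      e.toLinearEquiv.finrank_eq).toContinuousLinearEquiv, by ext <;> rfl⟩

/-- Countably many charts cover the part of the incidence variety on which the projection to the
coefficients is a submersion. -/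
lemma exists_graphChart_cover (hW : IsOpen W) (hg : ∀ j, ContDiffOn ℂ ω (g j) W) :
    ∃ c : ℕ → GraphChart g W, (⋃ i, (c i).src) =
      {q | q.1 ∈ W ∧ Function.Surjective (ContinuousLinearMap.pi (graphDeriv g q.1 q.2))} := by
  classical
  set R := {q : (Fin m → ℂ) × (∀ j, Fin (n j) → ℂ) | q.1 ∈ W ∧
    Function.Surjective (ContinuousLinearMap.pi (graphDeriv g q.1 q.2))} with hR
  have h : ∀ q, ∃ c : GraphChart g W, q ∈ R → q ∈ c.src := fun q => by
    by_cases hq : q ∈ R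
    · obtain ⟨c, hc⟩ := exists_graphChart hW hg hq.1 hq.2
      exact ⟨c, fun _ => hc⟩
    · exact ⟨GraphChart.empty g W, fun h => absurd h hq⟩
  choose c hc using h
  obtain ⟨t, -, ht, hcov⟩ := TopologicalSpace.countable_cover_nhdsWithin
    (f := fun q => (c q).src) (s := R)
    fun q hq => mem_nhdsWithin_of_mem_nhds ((c q).isOpen_src.mem_nhds (hc q hq))
  -- An extra index makes the countable set nonempty, so that it can be enumerated by ℕ. It does no
  -- harm, since the source of every chart lies in the submersive locus.
  obtain ⟨e, he⟩ := (ht.insert 0).exists_eq_range (Set.insert_nonempty _ _)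
  refine ⟨fun i => c (e i), Set.Subset.antisymm ?_ ?_⟩
  · refine Set.iUnion_subset fun i q hq => ?_
    exact ⟨(c _).src_subset q hq, (c _).surjective hq⟩
  · refine hcov.trans (Set.iUnion₂_subset fun q hq => ?_)
    have : q ∈ Set.range e := he ▸ Set.mem_insert_of_mem _ hq
    obtain ⟨i, rfl⟩ := this
    exact Set.subset_iUnion (fun i => (c (e i)).src) i

end Graph

/-! ### The splitting of ℂ^m into ℂ^k and ℂ^(m-k) -/

section Join

variable {m k : ℕ}

/-- The index equivalence behind `ℂ^k × ℂ^{m-k} = ℂ^m`. -/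
def joinIndex (hk : k ≤ m) : Fin k ⊕ Fin (m - k) ≃ Fin m :=
  finSumFinEquiv.trans (finCongr (by omega))

/-- `ℂ^k × ℂ^{m-k} = ℂ^m`. -/
def joinEquiv (hk : k ≤ m) : ((Fin k → ℂ) × (Fin (m - k) → ℂ)) ≃L[ℂ] (Fin m → ℂ) :=
  ((LinearEquiv.sumArrowLequivProdArrow (Fin k) (Fin (m - k)) ℂ ℂ).symm.trans
    (LinearEquiv.funCongrLeft ℂ ℂ (joinIndex hk).symm)).toContinuousLinearEquiv

lemma joinEquiv_apply (hk : k ≤ m) (x : (Fin k → ℂ) × (Fin (m - k) → ℂ)) (i : Fin m) :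
    joinEquiv hk x i = Sum.elim x.1 x.2 ((joinIndex hk).symm i) := rfl

lemma joinEquiv_castLE (hk : k ≤ m) (x : (Fin k → ℂ) × (Fin (m - k) → ℂ)) (j : Fin k) :
    joinEquiv hk x (Fin.castLE hk j) = x.1 j := by
  have : Fin.castLE hk j = joinIndex hk (Sum.inl j) := by
    ext; simp [joinIndex]
  rw [joinEquiv_apply, this, Equiv.symm_apply_apply]
  rfl

/-- The complex coordinate number `i / 2` is shifted by `k`, so the real frame index is shifted by
`2k`, as required in `wedgeCoeff_tauForm_mul`. -/
lemma joinEquiv_zero_stdFrame (hk : k ≤ m) (i : Fin (2 * (m - k))) :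
    joinEquiv hk (0, stdFrame (m - k) i) = stdFrame m ⟨2 * k + i, by omega⟩ := by
  funext l
  obtain ⟨l, rfl⟩ := (joinIndex hk).surjective l
  rw [joinEquiv_apply, Equiv.symm_apply_apply]
  rcases l with l | l
  · simp only [Sum.elim_inl, Pi.zero_apply, stdFrame, Pi.single_apply, Fin.ext_iff]
    rw [if_neg]
    simp [joinIndex]
    omega
  · simp only [Sum.elim_inr, stdFrame, Pi.single_apply, Fin.ext_iff]
    have h1 : ((l : ℕ) = (i : ℕ) / 2) ↔
        (((joinIndex hk (Sum.inr l) : Fin m) : ℕ) = (2 * k + (i : ℕ)) / 2) := by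
      simp [joinIndex]
      omega
    have h2 : (2 * k + (i : ℕ)) % 2 = (i : ℕ) % 2 := by omega
    simp only [h1, h2]

lemma measurePreserving_joinEquiv (hk : k ≤ m) : MeasurePreserving (joinEquiv hk) := by
  have h1 := volume_measurePreserving_sumPiEquivProdPi_symm
    (fun _ : Fin k ⊕ Fin (m - k) => ℂ)
  have h2 := volume_measurePreserving_piCongrLeft (fun _ : Fin m => ℂ) (joinIndex hk)
  have h3 := h2.comp h1
  convert! h3 using 1
  funext x i
  obtain ⟨i, rfl⟩ := (joinIndex hk).surjective i
  rw [joinEquiv_apply, Equiv.symm_apply_apply, Function.comp_apply, MeasurableEquiv.coe_piCongrLeft,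
    Equiv.piCongrLeft_apply_apply]
  rcases i with i | i <;> rfl

lemma measurableEmbedding_joinEquiv (hk : k ≤ m) : MeasurableEmbedding (joinEquiv hk) :=
  (joinEquiv hk).toHomeomorph.measurableEmbedding

end Join

/-! ### Change of variables on the slices of fixed coefficients -/

section ChangeOfVariables

variable {m k : ℕ} {n : Fin k → ℕ} {g : ∀ j, (Fin m → ℂ) → Fin (n j) → ℂ} {W : Set (Fin m → ℂ)}

namespace GraphChart

variable (c : GraphChart g W)

/-- The density of the form `φ` on the zero sets, in the coordinates of a chart. -/
def dens (φ : (Fin m → ℂ) → Alt m (2 * (m - k)))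
    (t : (∀ j, Fin (n j) → ℂ) × (Fin k → ℂ) × (Fin (m - k) → ℂ)) : ℂ :=
  φ (c.inv t) fun i => fderiv ℂ (fun w => c.inv (t.1, t.2.1, w)) t.2.2 (stdFrame (m - k) i)

/-- The coordinates of a subset of the domain. -/
def coords (B : Set ((Fin m → ℂ) × (∀ j, Fin (n j) → ℂ))) :
    Set ((∀ j, Fin (n j) → ℂ) × (Fin k → ℂ) × (Fin (m - k) → ℂ)) :=
  {t | t ∈ c.tgt ∧ (c.inv t, t.1) ∈ B}

/-- The change of variables on a slice. -/
def sliceMap (hk : k ≤ m) (a : ∀ j, Fin (n j) → ℂ) (z : Fin m → ℂ) : Fin m → ℂ :=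
  joinEquiv hk (graphMap g (z, a), c.proj z)

/-- Its differential. -/
def sliceDeriv (hk : k ≤ m) (a : ∀ j, Fin (n j) → ℂ) (z : Fin m → ℂ) :
    (Fin m → ℂ) →L[ℂ] (Fin m → ℂ) :=
  ((joinEquiv hk : _ →L[ℂ] (Fin m → ℂ))).comp
    ((ContinuousLinearMap.pi (graphDeriv g z a)).prod c.proj)

lemma hasFDerivAt_sliceMap (hk : k ≤ m) (hW : IsOpen W) (hg : ∀ j, ContDiffOn ℂ ω (g j) W)
    {q : (Fin m → ℂ) × (∀ j, Fin (n j) → ℂ)} (hq : q ∈ c.src) :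
    HasFDerivAt (c.sliceMap hk q.2) (c.sliceDeriv hk q.2 q.1) q.1 :=
  (joinEquiv hk).hasFDerivAt.comp q.1
    ((hasFDerivAt_graphMap hW hg (c.src_subset q hq) q.2).prodMk c.proj.hasFDerivAt)

lemma hasFDerivAt_inv_slice {t : (∀ j, Fin (n j) → ℂ) × (Fin k → ℂ) × (Fin (m - k) → ℂ)}
    (ht : t ∈ c.tgt) :
    HasFDerivAt (fun w => c.inv (t.1, t.2.1, w))
      (fderiv ℂ (fun w => c.inv (t.1, t.2.1, w)) t.2.2) t.2.2 := by
  have h1 : ContDiffAt ℂ ω (fun w => c.inv (t.1, t.2.1, w)) t.2.2 := by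
    refine ContDiffAt.comp (g := c.inv) t.2.2
      (c.contDiffOn_inv.contDiffAt (c.isOpen_tgt.mem_nhds ht)) ?_
    exact contDiffAt_const.prodMk (contDiffAt_const.prodMk contDiffAt_id)
  exact (h1.differentiableAt (by simp)).hasFDerivAt

/-- Differentiates in `w` the identity saying that the slice map sends the point with coordinates
`(t.1, t.2.1, w)` to `(t.2.1, w)`. It identifies the tangent vectors of the zero sets as preimages
of the last coordinate directions. -/
lemma sliceDeriv_fderiv_inv (hk : k ≤ m) (hW : IsOpen W) (hg : ∀ j, ContDiffOn ℂ ω (g j) W)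
    {t : (∀ j, Fin (n j) → ℂ) × (Fin k → ℂ) × (Fin (m - k) → ℂ)} (ht : t ∈ c.tgt)
    (x : Fin (m - k) → ℂ) :
    c.sliceDeriv hk t.1 (c.inv t) (fderiv ℂ (fun w => c.inv (t.1, t.2.1, w)) t.2.2 x) =
      joinEquiv hk (0, x) := by
  have h1 := c.hasFDerivAt_sliceMap hk hW hg (c.inv_mem t ht)
  have h2 : HasFDerivAt (fun w => c.sliceMap hk t.1 (c.inv (t.1, t.2.1, w))) _ t.2.2 :=
    HasFDerivAt.comp (g := c.sliceMap hk t.1) (f := fun w => c.inv (t.1, t.2.1, w)) t.2.2 h1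
      (c.hasFDerivAt_inv_slice ht)
  have h3 : (fun w => c.sliceMap hk t.1 (c.inv (t.1, t.2.1, w))) =ᶠ[𝓝 t.2.2]
      fun w => joinEquiv hk (t.2.1, w) := by
    have : ∀ᶠ w in 𝓝 t.2.2, (t.1, t.2.1, w) ∈ c.tgt :=
      (c.isOpen_tgt.preimage (f := fun w => (t.1, t.2.1, w)) (by fun_prop)).mem_nhds ht
    filter_upwards [this] with w hw
    have e1 := c.graphMap_inv _ hw
    have e2 := c.proj_inv _ hw
    simp only [sliceMap, e1, e2]
  have h4 : HasFDerivAt (fun w : Fin (m - k) → ℂ => joinEquiv hk (t.2.1, w)) _ t.2.2 :=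
    (joinEquiv hk).hasFDerivAt.comp t.2.2 (hasFDerivAt_prodMk_right t.2.1 t.2.2)
  have h5 := (h2.congr_of_eventuallyEq h3.symm).unique h4
  have := DFunLike.congr_fun h5 x
  simpa using this

lemma injective_fderiv_inv (hk : k ≤ m) (hW : IsOpen W) (hg : ∀ j, ContDiffOn ℂ ω (g j) W)
    {t : (∀ j, Fin (n j) → ℂ) × (Fin k → ℂ) × (Fin (m - k) → ℂ)} (ht : t ∈ c.tgt) :
    Function.Injective (fderiv ℂ (fun w => c.inv (t.1, t.2.1, w)) t.2.2) := by
  intro x y hxy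
  have h1 := c.sliceDeriv_fderiv_inv hk hW hg ht x
  rw [hxy, c.sliceDeriv_fderiv_inv hk hW hg ht y] at h1
  exact (congrArg Prod.snd ((joinEquiv hk).injective h1)).symm

/-- The Jacobian formula for the density. -/
lemma det_smul_dens (hk : k ≤ m) (hW : IsOpen W) (hg : ∀ j, ContDiffOn ℂ ω (g j) W)
    (φ : (Fin m → ℂ) → Alt m (2 * (m - k)))
    {q : (Fin m → ℂ) × (∀ j, Fin (n j) → ℂ)} (hq : q ∈ c.src) :
    |((c.sliceDeriv hk q.2 q.1).restrictScalars ℝ).det| •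
        c.dens φ (q.2, graphMap g q, c.proj q.1) =
      wedgeCoeff hk (φ q.1) fun j => tauForm (graphDeriv g q.1 q.2 j) (graphDeriv g q.1 q.2 j) := by
  obtain ⟨e, he⟩ := c.equiv q hq
  have ht := c.mem_tgt q hq
  have hinv := c.inv_apply q hq
  -- The inverse of the slice derivative is a frame adapted to the forms `graphDeriv`. Its last
  -- vectors are tangent to the zero set, and its determinant cancels the Jacobian.
  let T : (Fin m → ℂ) ≃L[ℂ] (Fin m → ℂ) := (e.trans (joinEquiv hk)).symm
  have hTe (w) : c.sliceDeriv hk q.2 q.1 (T w) = w := by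
    rw [sliceDeriv, ← he]
    change joinEquiv hk (e (T w)) = w
    exact (e.trans (joinEquiv hk)).apply_symm_apply w
  have hTe' (w) : T (c.sliceDeriv hk q.2 q.1 w) = w := by
    rw [sliceDeriv, ← he]
    exact (e.trans (joinEquiv hk)).symm_apply_apply w
  have h1 := wedgeCoeff_tauForm_mul hk (graphDeriv g q.1 q.2) (φ q.1) T.toLinearEquiv.toLinearMap
    fun j w => by
      have h2 := hTe w
      have h3 := congrFun h2 (Fin.castLE hk j)
      rw [sliceDeriv, ContinuousLinearMap.comp_apply, ContinuousLinearEquiv.coe_coe,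
        joinEquiv_castLE] at h3
      exact h3
  have h4 : (fun i : Fin (2 * (m - k)) => T (stdFrame m ⟨2 * k + i, by omega⟩)) =
      fun i => fderiv ℂ (fun w => c.inv (q.2, graphMap g q, w)) (c.proj q.1)
        (stdFrame (m - k) i) := by
    funext i
    rw [← joinEquiv_zero_stdFrame hk]
    have h5 := c.sliceDeriv_fderiv_inv hk hW hg ht (stdFrame (m - k) i)
    rw [← h5, hinv]
    exact hTe' _
  have h6 : c.dens φ (q.2, graphMap g q, c.proj q.1) =
      φ q.1 (fun i => T (stdFrame m ⟨2 * k + i, by omega⟩)) := by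
    rw [h4, dens, hinv]
  have hdet : LinearMap.det (c.sliceDeriv hk q.2 q.1).toLinearMap *
      LinearMap.det T.toLinearEquiv.toLinearMap = 1 := by
    rw [← LinearMap.det_comp]
    have : (c.sliceDeriv hk q.2 q.1).toLinearMap ∘ₗ T.toLinearEquiv.toLinearMap =
        LinearMap.id := LinearMap.ext hTe
    rw [this, LinearMap.det_id]
  have hdetR : |((c.sliceDeriv hk q.2 q.1).restrictScalars ℝ).det| =
      ‖LinearMap.det (c.sliceDeriv hk q.2 q.1).toLinearMap‖ ^ 2 := by
    have : ((c.sliceDeriv hk q.2 q.1).restrictScalars ℝ).det =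
        LinearMap.det ((c.sliceDeriv hk q.2 q.1).toLinearMap.restrictScalars ℝ) := rfl
    rw [this, LinearMap.det_restrictScalars, Algebra.norm_complex_apply,
      Complex.normSq_eq_norm_sq, abs_of_nonneg (by positivity)]
  have h7 : (‖LinearMap.det (c.sliceDeriv hk q.2 q.1).toLinearMap‖ ^ 2) *
      (‖LinearMap.det T.toLinearEquiv.toLinearMap‖ ^ 2) = 1 := by
    rw [← mul_pow, ← norm_mul, hdet]; simp
  rw [h6, hdetR]
  change _ • (φ q.1) (fun i => T.toLinearEquiv.toLinearMap _) = _
  rw [← h1, Complex.real_smul, ← mul_assoc, ← Complex.ofReal_mul, h7]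
  simp

lemma sliceMap_image (hk : k ≤ m) {B : Set ((Fin m → ℂ) × (∀ j, Fin (n j) → ℂ))}
    (hB : B ⊆ c.src) (a : ∀ j, Fin (n j) → ℂ) :
    c.sliceMap hk a '' {z | (z, a) ∈ B} = joinEquiv hk '' {x | (a, x) ∈ c.coords B} := by
  ext y
  constructor
  · rintro ⟨z, hz, rfl⟩
    refine ⟨_, ⟨c.mem_tgt _ (hB hz), ?_⟩, rfl⟩
    rw [c.inv_apply _ (hB hz)]
    exact hz
  · rintro ⟨x, ⟨hx, hx'⟩, rfl⟩
    refine ⟨c.inv (a, x), hx', ?_⟩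
    rw [sliceMap, c.proj_inv _ hx, c.graphMap_inv _ hx]

lemma sliceMap_injOn (hk : k ≤ m) {B : Set ((Fin m → ℂ) × (∀ j, Fin (n j) → ℂ))}
    (hB : B ⊆ c.src) (a : ∀ j, Fin (n j) → ℂ) :
    Set.InjOn (c.sliceMap hk a) {z | (z, a) ∈ B} := by
  intro z hz z' hz' h
  have h1 := (joinEquiv hk).injective h
  have e1 := c.inv_apply _ (hB hz)
  have e2 := c.inv_apply _ (hB hz')
  simp only [Prod.mk.injEq] at h1 e1 e2
  rw [← e1, ← e2, h1.1, h1.2]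

variable {F : Type*} [NormedAddCommGroup F] [NormedSpace ℝ F]

/-- For fixed `a` the slice map is an injective change of variables on ℂ^m, and `joinEquiv`
preserves volume. The values are in a general space because the formula is needed for densities and
for their norms. -/
lemma setIntegral_coords (hk : k ≤ m) (hW : IsOpen W) (hg : ∀ j, ContDiffOn ℂ ω (g j) W)
    {B : Set ((Fin m → ℂ) × (∀ j, Fin (n j) → ℂ))} (hBm : MeasurableSet B)
    (hB : B ⊆ c.src) (a : ∀ j, Fin (n j) → ℂ) (f : (Fin k → ℂ) × (Fin (m - k) → ℂ) → F) :
    ∫ x in {x | (a, x) ∈ c.coords B}, f x =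
      ∫ z in {z | (z, a) ∈ B}, |((c.sliceDeriv hk a z).restrictScalars ℝ).det| •
        f (graphMap g (z, a), c.proj z) := by
  have hS : MeasurableSet {z : Fin m → ℂ | (z, a) ∈ B} :=
    (measurable_id.prodMk measurable_const : Measurable fun z : Fin m → ℂ => (z, a)) hBm
  have hD : ∀ z ∈ {z : Fin m → ℂ | (z, a) ∈ B}, HasFDerivWithinAt (c.sliceMap hk a)
      ((c.sliceDeriv hk a z).restrictScalars ℝ) {z | (z, a) ∈ B} z := fun z hz =>
    ((c.hasFDerivAt_sliceMap hk hW hg (hB hz)).restrictScalars ℝ).hasFDerivWithinAt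
  have h1 := (measurePreserving_joinEquiv hk).setIntegral_image_emb
    (measurableEmbedding_joinEquiv hk) (fun y => f ((joinEquiv hk).symm y))
    {x | (a, x) ∈ c.coords B}
  simp only [ContinuousLinearEquiv.symm_apply_apply] at h1
  rw [← h1, ← c.sliceMap_image hk hB,
    integral_image_eq_integral_abs_det_fderiv_smul _ hS hD (c.sliceMap_injOn hk hB a)]
  simp [sliceMap]

lemma integrableOn_coords_iff (hk : k ≤ m) (hW : IsOpen W) (hg : ∀ j, ContDiffOn ℂ ω (g j) W)
    {B : Set ((Fin m → ℂ) × (∀ j, Fin (n j) → ℂ))} (hBm : MeasurableSet B)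
    (hB : B ⊆ c.src) (a : ∀ j, Fin (n j) → ℂ) (f : (Fin k → ℂ) × (Fin (m - k) → ℂ) → F) :
    IntegrableOn f {x | (a, x) ∈ c.coords B} ↔
      IntegrableOn (fun z => |((c.sliceDeriv hk a z).restrictScalars ℝ).det| •
        f (graphMap g (z, a), c.proj z)) {z | (z, a) ∈ B} := by
  have hS : MeasurableSet {z : Fin m → ℂ | (z, a) ∈ B} :=
    (measurable_id.prodMk measurable_const : Measurable fun z : Fin m → ℂ => (z, a)) hBm
  have hD : ∀ z ∈ {z : Fin m → ℂ | (z, a) ∈ B}, HasFDerivWithinAt (c.sliceMap hk a)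
      ((c.sliceDeriv hk a z).restrictScalars ℝ) {z | (z, a) ∈ B} z := fun z hz =>
    ((c.hasFDerivAt_sliceMap hk hW hg (hB hz)).restrictScalars ℝ).hasFDerivWithinAt
  have h1 := (measurePreserving_joinEquiv hk).integrableOn_image
    (measurableEmbedding_joinEquiv hk) (f := fun y => f ((joinEquiv hk).symm y))
    (s := {x | (a, x) ∈ c.coords B})
  have h2 : (fun y => f ((joinEquiv hk).symm y)) ∘ joinEquiv hk = f := by
    funext x; simp
  rw [h2] at h1
  rw [← h1, ← c.sliceMap_image hk hB,
    integrableOn_image_iff_integrableOn_abs_det_fderiv_smul _ hS hD (c.sliceMap_injOn hk hB a)]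
  simp [sliceMap]

end GraphChart
end ChangeOfVariables

/-! ### Averaging over the remaining coefficients -/

section Expectation

variable {m k : ℕ} {n : Fin k → ℕ}

/-- The density with respect to Lebesgue measure of the current of integration over the incidence
variety, paired with a form `φ` and weighted by the Gaussian density. -/
def incidenceDensity (g : ∀ j, (Fin m → ℂ) → Fin (n j) → ℂ) (hk : k ≤ m)
    (φ : (Fin m → ℂ) → Alt m (2 * (m - k))) (q : (Fin m → ℂ) × (∀ j, Fin (n j) → ℂ)) : ℂ :=
  (∏ j, gaussDensity (graphMap g q j)) •
    wedgeCoeff hk (φ q.1) fun j => tauForm (graphDeriv g q.1 q.2 j) (graphDeriv g q.1 q.2 j)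

variable {g : ∀ j, (Fin m → ℂ) → Fin (n j) → ℂ} {W : Set (Fin m → ℂ)}
  {φ : (Fin m → ℂ) → Alt m (2 * (m - k))}

/-- The differentials of the coefficient functions. -/
def coeffDeriv (g : ∀ j, (Fin m → ℂ) → Fin (n j) → ℂ) (z : Fin m → ℂ) (j : Fin k)
    (l : Fin (n j)) : (Fin m → ℂ) →L[ℂ] ℂ := fderiv ℂ (fun z => g j z l) z

/-- Multilinear expansion separates the variables: each term is a function of `a`, itself a product
over the independent sections, times a function of `z`. -/
lemma wedgeCoeff_graphDeriv (hk : k ≤ m) (ψ : Alt m (2 * (m - k))) (z : Fin m → ℂ)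
    (a : ∀ j, Fin (n j) → ℂ) :
    wedgeCoeff hk ψ (fun j => tauForm (graphDeriv g z a j) (graphDeriv g z a j)) =
      ∑ r : ∀ j, Fin (n j) × Fin (n j), (∏ j, a j (r j).1 * starRingEnd ℂ (a j (r j).2)) *
        wedgeCoeff hk ψ
          (fun j => tauForm (coeffDeriv g z j (r j).1) (coeffDeriv g z j (r j).2)) := by
  have h1 : (fun j => tauForm (graphDeriv g z a j) (graphDeriv g z a j)) = fun j =>
      ∑ q : Fin (n j) × Fin (n j), (a j q.1 * starRingEnd ℂ (a j q.2)) •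
        tauForm (coeffDeriv g z j q.1) (coeffDeriv g z j q.2) := by
    funext j
    rw [graphDeriv, tauForm_neg_neg, tauForm_sum]
    rfl
  rw [h1, MultilinearMap.map_sum]
  refine Finset.sum_congr rfl fun r _ => ?_
  rw [MultilinearMap.map_smul_univ, smul_eq_mul]

/-- Up to the Gaussian weight, which is bounded by 1, the density is a finite sum of products of an
integrable function of `z` and a product of second moments of independent vectors. -/
lemma integrable_incidenceDensity (hk : k ≤ m) (hg : ∀ j, ContDiffOn ℂ ω (g j) W)
    {B : Set (Fin m → ℂ)} (hBm : MeasurableSet B) (hB : B ⊆ W)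
    (hint : ∀ r : ∀ j, Fin (n j) × Fin (n j), IntegrableOn (fun z => wedgeCoeff hk (φ z)
      (fun j => tauForm (coeffDeriv g z j (r j).1) (coeffDeriv g z j (r j).2))) B) :
    IntegrableOn (incidenceDensity g hk φ) (B ×ˢ Set.univ) (volume.prod (restMeasure n)) := by
  have hμ : (volume.prod (restMeasure n)).restrict (B ×ˢ Set.univ) =
      (volume.restrict B).prod (restMeasure n) := by
    rw [← Measure.prod_restrict, Measure.restrict_univ]
  rw [IntegrableOn, hμ]
  have h1 : Integrable (fun q : (Fin m → ℂ) × (∀ j, Fin (n j) → ℂ) =>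
      ∑ r : ∀ j, Fin (n j) × Fin (n j), wedgeCoeff hk (φ q.1)
          (fun j => tauForm (coeffDeriv g q.1 j (r j).1) (coeffDeriv g q.1 j (r j).2)) *
        (∏ j, q.2 j (r j).1 * starRingEnd ℂ (q.2 j (r j).2)))
      ((volume.restrict B).prod (restMeasure n)) := by
    refine integrable_finsetSum _ fun r _ => ?_
    refine Integrable.mul_prod (f := fun z => wedgeCoeff hk (φ z)
          (fun j => tauForm (coeffDeriv g z j (r j).1) (coeffDeriv g z j (r j).2)))
      (g := fun a : ∀ j, Fin (n j) → ℂ => ∏ j, a j (r j).1 * starRingEnd ℂ (a j (r j).2))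
      (hint r) ?_
    exact Integrable.fintype_prod_dep
      (f := fun j (c : Fin (n j) → ℂ) => c (r j).1 * starRingEnd ℂ (c (r j).2))
      fun j => integrable_moment _ _
  have h2 : AEStronglyMeasurable (fun q : (Fin m → ℂ) × (∀ j, Fin (n j) → ℂ) =>
      ((∏ j, gaussDensity (graphMap g q j) : ℝ) : ℂ))
      ((volume.restrict B).prod (restMeasure n)) := by
    rw [← hμ]
    refine ContinuousOn.aestronglyMeasurable ?_ (hBm.prod .univ)
    have h3 : ContinuousOn (graphMap g) (B ×ˢ Set.univ) :=
      (contDiffOn_graphMap hg).continuousOn.mono (Set.prod_mono_left hB)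
    refine Complex.continuous_ofReal.comp_continuousOn (continuousOn_finsetProd _ fun j _ => ?_)
    exact continuous_gaussDensity.comp_continuousOn ((continuous_apply j).comp_continuousOn h3)
  refine (h1.bdd_mul (c := 1) h2 (.of_forall fun q => ?_)).congr (.of_forall fun q => ?_)
  · rw [Complex.norm_real, Real.norm_of_nonneg (Finset.prod_nonneg fun j _ => gaussDensity_nonneg _)]
    exact Finset.prod_le_one (fun j _ => gaussDensity_nonneg _) fun j _ => gaussDensity_le _
  · simp only [incidenceDensity, wedgeCoeff_graphDeriv, Complex.real_smul]
    congr 1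
    exact Finset.sum_congr rfl fun r _ => mul_comm _ _

/-- The second moments weighted by the Gaussian density of a linear form. -/
def weightedMoment {d : ℕ} (w : Fin d → ℂ) (q : Fin d × Fin d) : ℂ :=
  ∫ c, (gaussDensity (-∑ l, c l * w l) : ℂ) * (c q.1 * starRingEnd ℂ (c q.2))
    ∂stdComplexGaussian d

lemma integrable_weightedMoment {d : ℕ} (w : Fin d → ℂ) (q : Fin d × Fin d) :
    Integrable (fun c => (gaussDensity (-∑ l, c l * w l) : ℂ) * (c q.1 * starRingEnd ℂ (c q.2)))
      (stdComplexGaussian d) := by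
  refine (integrable_moment q.1 q.2).bdd_mul (c := 1) ?_ (.of_forall fun c => ?_)
  · exact (by fun_prop : Continuous fun c : Fin d → ℂ =>
      (gaussDensity (-∑ l, c l * w l) : ℂ)).aestronglyMeasurable
  · rw [Complex.norm_real, Real.norm_of_nonneg (gaussDensity_nonneg _)]
    exact gaussDensity_le _

/-- The sum over index pairs reassembles the integral of `integral_exp_mul_dot_mul_conj_dot`; the
factor 1/π is the normalisation of `gaussDensity`. -/
lemma sum_weightedMoment {d : ℕ} (w u v : Fin d → ℂ) :
    ∑ q, weightedMoment w q * (u q.1 * starRingEnd ℂ (v q.2)) =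
      (Real.pi : ℂ)⁻¹ * ((((1 + ∑ l, ‖w l‖ ^ 2 : ℝ) : ℂ))⁻¹ *
      (∑ l, u l * starRingEnd ℂ (v l) - (((1 + ∑ l, ‖w l‖ ^ 2 : ℝ) : ℂ))⁻¹ *
        ((∑ l, u l * starRingEnd ℂ (w l)) * ∑ l, w l * starRingEnd ℂ (v l)))) := by
  rw [← integral_exp_mul_dot_mul_conj_dot, ← integral_const_mul]
  simp only [weightedMoment, ← integral_mul_const]
  rw [← integral_finsetSum _ fun q _ => (integrable_weightedMoment w q).mul_const _]
  congr 1
  funext c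
  rw [Fintype.sum_prod_type, map_sum, Finset.sum_mul_sum]
  simp only [Finset.mul_sum]
  refine Finset.sum_congr rfl fun l _ => Finset.sum_congr rfl fun l' _ => ?_
  simp only [gaussDensity, norm_neg, map_mul]
  push_cast
  ring

/-- The identity for a single section: inverting the rank one perturbed quadratic form gives the
same matrix as differentiating log(1 + |g|²) twice. The constant i/2 of `tauForm` and the 1/π of the
Gaussian combine to i/(2π). -/
lemma sum_weightedMoment_smul_tauForm (hW : IsOpen W) (hg : ∀ j, ContDiffOn ℂ ω (g j) W)
    {z : Fin m → ℂ} (hz : z ∈ W) (j : Fin k) :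
    ∑ q, weightedMoment (g j z) q • tauForm (coeffDeriv g z j q.1) (coeffDeriv g z j q.2) =
      ddc (fun z => Real.log (1 + ∑ l, ‖g j z l‖ ^ 2)) z := by
  have hgz : ContDiffAt ℂ ω (g j) z := (hg j).contDiffAt (hW.mem_nhds hz)
  have hpos : (1 : ℝ) + ∑ l, ‖g j z l‖ ^ 2 ≠ 0 := by positivity
  rw [ddc_comp (u := fun w => Real.log (1 + ∑ l, ‖w l‖ ^ 2)) ((contDiffAt_log_normSq hpos).of_le
    le_top) hgz]
  ext v
  rw [altSum_apply, AlternatingMap.compLinearMap_apply, ddc_log_normSq hpos]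
  have hd (x : Fin m → ℂ) (l : Fin (n j)) : fderiv ℂ (g j) z x l = coeffDeriv g z j l x := by
    rw [coeffDeriv, fderiv_apply (hgz.differentiableAt (by simp))]
    rfl
  simp only [AlternatingMap.smul_apply, tauForm_apply, smul_eq_mul, ContinuousLinearMap.coe_coe,
    ContinuousLinearMap.coe_restrictScalars', hd]
  have h0 := sum_weightedMoment (g j z) (fun l => coeffDeriv g z j l (v 0))
    (fun l => coeffDeriv g z j l (v 1))
  have h1 := sum_weightedMoment (g j z) (fun l => coeffDeriv g z j l (v 1))
    (fun l => coeffDeriv g z j l (v 0))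
  calc _ = Complex.I / 2 * (∑ q, weightedMoment (g j z) q *
        (coeffDeriv g z j q.1 (v 0) * starRingEnd ℂ (coeffDeriv g z j q.2 (v 1))) -
        ∑ q, weightedMoment (g j z) q *
        (coeffDeriv g z j q.1 (v 1) * starRingEnd ℂ (coeffDeriv g z j q.2 (v 0)))) := by
        rw [← Finset.sum_sub_distrib, Finset.mul_sum]
        exact Finset.sum_congr rfl fun q _ => by ring
    _ = _ := by
        rw [h0, h1]
        have hpi : (Real.pi : ℂ) ≠ 0 := by exact_mod_cast Real.pi_ne_zero
        field_simp

/-- Here the expectation of the wedge becomes the wedge of expectations. After expansion each term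
is a product over `j` of functions of independent variables, so its mean is a product of weighted
moments, and multilinearity collects the terms again. -/
lemma integral_incidenceDensity (hk : k ≤ m) (hW : IsOpen W) (hg : ∀ j, ContDiffOn ℂ ω (g j) W)
    {z : Fin m → ℂ} (hz : z ∈ W) :
    ∫ a, incidenceDensity g hk φ (z, a) ∂restMeasure n =
      wedgeCoeff hk (φ z) fun j => ddc (fun z => Real.log (1 + ∑ l, ‖g j z l‖ ^ 2)) z := by
  have h1 : (fun a => incidenceDensity g hk φ (z, a)) = fun a =>
      ∑ r : ∀ j, Fin (n j) × Fin (n j),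
        (∏ j, (gaussDensity (-∑ l, a j l * g j z l) : ℂ) *
          (a j (r j).1 * starRingEnd ℂ (a j (r j).2))) * wedgeCoeff hk (φ z)
          (fun j => tauForm (coeffDeriv g z j (r j).1) (coeffDeriv g z j (r j).2)) := by
    funext a
    simp only [incidenceDensity, wedgeCoeff_graphDeriv, Complex.real_smul, Finset.mul_sum,
      Finset.prod_mul_distrib, graphMap]
    push_cast
    exact Finset.sum_congr rfl fun r _ => by ring
  rw [h1, integral_finsetSum]
  · simp only [integral_mul_const, restMeasure]
    simp only [← sum_weightedMoment_smul_tauForm hW hg hz]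
    rw [MultilinearMap.map_sum]
    refine Finset.sum_congr rfl fun r _ => ?_
    rw [MultilinearMap.map_smul_univ, smul_eq_mul]
    congr 1
    exact integral_fintype_prod_eq_prod (fun j (c : Fin (n j) → ℂ) =>
      (gaussDensity (-∑ l, c l * g j z l) : ℂ) * (c (r j).1 * starRingEnd ℂ (c (r j).2)))
  · intro r _
    refine Integrable.mul_const ?_ _
    exact Integrable.fintype_prod_dep (f := fun j (c : Fin (n j) → ℂ) =>
      (gaussDensity (-∑ l, c l * g j z l) : ℂ) * (c (r j).1 * starRingEnd ℂ (c (r j).2)))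
      fun j => integrable_weightedMoment _ _

end Expectation

/-! ### The Gaussian law of the distinguished coefficients as a weight -/

section Weight

variable {A Q F : Type*} [MeasurableSpace A] [MeasurableSpace Q] [NormedAddCommGroup F]
  [NormedSpace ℝ F] {k : ℕ} (ρ : Measure A) (μ : Measure Q) [SFinite μ]

/-- The change of variables concerns Lebesgue measure, so the law of the distinguished coefficients
is written as a density, while the other coefficients keep their probability measure. -/
lemma prod_stdComplexGaussian_prod :
    MeasurePreserving MeasurableEquiv.prodAssoc ((ρ.prod (stdComplexGaussian k)).prod μ)
      ((ρ.prod ((volume : Measure (Fin k → ℂ)).prod μ)).withDensity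
        fun t => ENNReal.ofReal (∏ j, gaussDensity (t.2.1 j))) := by
  have hm : Measurable fun y : Fin k → ℂ => ENNReal.ofReal (∏ j, gaussDensity (y j)) :=
    (by fun_prop : Continuous fun y : Fin k → ℂ => ∏ j, gaussDensity (y j)).measurable.ennreal_ofReal
  have h1 := measurePreserving_prodAssoc ρ (stdComplexGaussian k) μ
  have h2 : stdComplexGaussian k =
      volume.withDensity fun y => ENNReal.ofReal (∏ j, gaussDensity (y j)) := by
    rw [stdComplexGaussian_eq_pi, pi_gaussOne]
  have h3 : ρ.prod ((stdComplexGaussian k).prod μ) =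
      (ρ.prod ((volume : Measure (Fin k → ℂ)).prod μ)).withDensity
        fun t => ENNReal.ofReal (∏ j, gaussDensity (t.2.1 j)) := by
    rw [h2, prod_withDensity_left hm, prod_withDensity_right (by fun_prop)]
  rwa [h3] at h1

lemma integrable_prod_stdComplexGaussian_iff (f : A × (Fin k → ℂ) × Q → F) :
    Integrable (fun p : (A × (Fin k → ℂ)) × Q => f (p.1.1, p.1.2, p.2))
        ((ρ.prod (stdComplexGaussian k)).prod μ) ↔
      Integrable (fun t => (∏ j, gaussDensity (t.2.1 j)) • f t) (ρ.prod (volume.prod μ)) := by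
  have h := (prod_stdComplexGaussian_prod (k := k) ρ μ).integrable_comp_emb
    MeasurableEquiv.prodAssoc.measurableEmbedding (g := f)
  have hc : Continuous fun y : Fin k → ℂ => ∏ j, gaussDensity (y j) := by fun_prop
  have hm : Measurable fun t : A × (Fin k → ℂ) × Q =>
      ENNReal.ofReal (∏ j, gaussDensity (t.2.1 j)) :=
    (hc.measurable.comp (measurable_fst.comp measurable_snd)).ennreal_ofReal
  rw [integrable_withDensity_iff_integrable_smul'
    hm (.of_forall fun _ => ENNReal.ofReal_lt_top)] at h
  refine Iff.trans (Iff.of_eq ?_) (h.trans (Iff.of_eq ?_))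
  · rfl
  · congr 1
    funext t
    rw [ENNReal.toReal_ofReal (Finset.prod_nonneg fun j _ => gaussDensity_nonneg _)]

lemma integral_prod_stdComplexGaussian (f : A × (Fin k → ℂ) × Q → F) :
    ∫ p : (A × (Fin k → ℂ)) × Q, f (p.1.1, p.1.2, p.2) ∂((ρ.prod (stdComplexGaussian k)).prod μ) =
      ∫ t : A × (Fin k → ℂ) × Q, (∏ j, gaussDensity (t.2.1 j)) • f t ∂(ρ.prod (volume.prod μ)) := by
  have h := (prod_stdComplexGaussian_prod (k := k) ρ μ).integral_comp
    MeasurableEquiv.prodAssoc.measurableEmbedding f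
  have hc : Continuous fun y : Fin k → ℂ => ∏ j, gaussDensity (y j) := by fun_prop
  have hm : Measurable fun t : A × (Fin k → ℂ) × Q =>
      ENNReal.ofReal (∏ j, gaussDensity (t.2.1 j)) :=
    (hc.measurable.comp (measurable_fst.comp measurable_snd)).ennreal_ofReal
  rw [integral_withDensity_eq_integral_toReal_smul
    hm (.of_forall fun _ => ENNReal.ofReal_lt_top)] at h
  refine Eq.trans ?_ (h.trans ?_)
  · rfl
  · congr 1
    funext t
    rw [ENNReal.toReal_ofReal (Finset.prod_nonneg fun j _ => gaussDensity_nonneg _)]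

end Weight

/-! ### The coarea formula on the incidence variety -/

section Coarea

variable {m k : ℕ} {n : Fin k → ℕ} {g : ∀ j, (Fin m → ℂ) → Fin (n j) → ℂ} {W : Set (Fin m → ℂ)}

/-- Forms are only known to be continuous on fixed vectors; for moving vectors the value is expanded
in a real basis. -/
lemma continuousOn_alternating_apply {X : Type*} [TopologicalSpace X] {q : ℕ} {s : Set X}
    {ψ : X → Alt m q} {v : X → Fin q → Fin m → ℂ} (hψ : ∀ u, ContinuousOn (fun x => ψ x u) s)
    (hv : ∀ i, ContinuousOn (fun x => v x i) s) : ContinuousOn (fun x => ψ x (v x)) s := by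
  let b := Module.finBasis ℝ (Fin m → ℂ)
  have h1 : (fun x => ψ x (v x)) = fun x => ∑ r : Fin q → Fin (Module.finrank ℝ (Fin m → ℂ)),
      (∏ i, b.repr (v x i) (r i)) • ψ x (fun i => b (r i)) := by
    funext x
    have h2 : v x = fun i => ∑ l, b.repr (v x i) l • b l := by
      funext i
      exact (b.sum_repr (v x i)).symm
    conv_lhs => rw [h2]
    change (ψ x).toMultilinearMap _ = _
    rw [MultilinearMap.map_sum]
    refine Finset.sum_congr rfl fun r _ => ?_
    rw [MultilinearMap.map_smul_univ]
    rfl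
  rw [h1]
  refine continuousOn_finsetSum _ fun r _ => ContinuousOn.fun_smul ?_ (hψ _)
  refine continuousOn_finsetProd _ fun i _ => ?_
  exact ((b.coord (r i)).continuous_of_finiteDimensional).comp_continuousOn (hv i)

lemma measurableSet_preimage_inter_of_continuousOn {X Y : Type*} [TopologicalSpace X]
    [MeasurableSpace X] [BorelSpace X] [TopologicalSpace Y] [MeasurableSpace Y] [BorelSpace Y]
    {f : X → Y} {s : Set X} (hf : ContinuousOn f s) (hs : MeasurableSet s) {t : Set Y}
    (ht : MeasurableSet t) : MeasurableSet (s ∩ f ⁻¹' t) := by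
  have h1 : MeasurableSet ((s.domRestrict f) ⁻¹' t) :=
    (continuousOn_iff_continuous_domRestrict.1 hf).measurable ht
  have h2 := hs.subtype_image h1
  convert h2 using 1
  ext x
  simp [Set.domRestrict, and_comm]

namespace GraphChart

variable (c : GraphChart g W)

lemma measurableSet_coords {D : Set ((Fin m → ℂ) × (∀ j, Fin (n j) → ℂ))}
    (hD : MeasurableSet D) : MeasurableSet (c.coords D) :=
  measurableSet_preimage_inter_of_continuousOn
    (c.contDiffOn_inv.continuousOn.prodMk continuousOn_fst) c.isOpen_tgt.measurableSet hD

lemma continuousOn_dens {φ : (Fin m → ℂ) → Alt m (2 * (m - k))}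
    (hφ : ∀ v, ContinuousOn (fun z => φ z v) W) : ContinuousOn (c.dens φ) c.tgt := by
  refine continuousOn_alternating_apply (fun u => ?_) fun i => ?_
  · exact (hφ u).comp c.contDiffOn_inv.continuousOn fun t ht => c.src_subset _ (c.inv_mem t ht)
  -- The slice derivative is the total derivative of the inverse restricted to the last factor,
  -- hence continuous jointly in all coordinates.
  · have h1 : ContinuousOn (fun t => fderiv ℂ c.inv t (0, 0, stdFrame (m - k) i)) c.tgt :=
      (contDiffOn_fderiv_of_isOpen c.isOpen_tgt c.contDiffOn_inv).continuousOn.clm_apply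
        continuousOn_const
    refine h1.congr fun t ht => ?_
    have h2 : HasFDerivAt c.inv (fderiv ℂ c.inv t) t :=
      ((c.contDiffOn_inv.contDiffAt (c.isOpen_tgt.mem_nhds ht)).differentiableAt
        (by simp)).hasFDerivAt
    have h3 : HasFDerivAt (fun w : Fin (m - k) → ℂ => (t.1, t.2.1, w)) _ t.2.2 :=
      (hasFDerivAt_const t.1 t.2.2).prodMk
        (show HasFDerivAt (fun w : Fin (m - k) → ℂ => (t.2.1, w))
          (.inr ℂ (Fin k → ℂ) (Fin (m - k) → ℂ)) t.2.2 from
          hasFDerivAt_prodMk_right t.2.1 t.2.2)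
    have h4 : HasFDerivAt (fun w : Fin (m - k) → ℂ => c.inv (t.1, t.2.1, w)) _ t.2.2 :=
      HasFDerivAt.comp (g := c.inv) t.2.2 h2 h3
    change fderiv ℂ (fun w => c.inv (t.1, t.2.1, w)) t.2.2 _ = _
    rw [h4.fderiv]
    simp

variable {F : Type*} [NormedAddCommGroup F] [NormedSpace ℝ F]

/-- Change of variables in the incidence variety. -/
lemma integrable_coords (hk : k ≤ m) (hW : IsOpen W) (hg : ∀ j, ContDiffOn ℂ ω (g j) W)
    {D : Set ((Fin m → ℂ) × (∀ j, Fin (n j) → ℂ))} (hDm : MeasurableSet D) (hD : D ⊆ c.src)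
    {f : (∀ j, Fin (n j) → ℂ) × (Fin k → ℂ) × (Fin (m - k) → ℂ) → F}
    {K : (Fin m → ℂ) × (∀ j, Fin (n j) → ℂ) → F} (ρ : Measure (∀ j, Fin (n j) → ℂ)) [SFinite ρ]
    (hf : ContinuousOn f c.tgt)
    (hK : IntegrableOn K D (volume.prod ρ))
    (hfK : ∀ q ∈ D, |((c.sliceDeriv hk q.2 q.1).restrictScalars ℝ).det| •
      f (q.2, graphMap g q, c.proj q.1) = K q) :
    Integrable ((c.coords D).indicator f) (ρ.prod volume) ∧
      ∫ t, (c.coords D).indicator f t ∂(ρ.prod volume) = ∫ q in D, K q ∂(volume.prod ρ) := by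
  have hS := c.measurableSet_coords hDm
  have hSa (a) : MeasurableSet {x | (a, x) ∈ c.coords D} := measurable_prodMk_left hS
  have hTa (a) : MeasurableSet {z | (z, a) ∈ D} := measurable_prodMk_right hDm
  have hf' : AEStronglyMeasurable ((c.coords D).indicator f) (ρ.prod volume) := by
    refine (aestronglyMeasurable_indicator_iff hS).2 ?_
    exact (hf.mono fun t ht => ht.1).aestronglyMeasurable hS
  have hK' : Integrable (D.indicator K) (volume.prod ρ) := (integrable_indicator_iff hDm).2 hK
  have e1 (a) : (fun x => (c.coords D).indicator f (a, x)) =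
      {x | (a, x) ∈ c.coords D}.indicator fun x => f (a, x) := rfl
  have e2 (a) : (fun z => D.indicator K (z, a)) =
      {z | (z, a) ∈ D}.indicator fun z => K (z, a) := rfl
  -- By Tonelli's theorem, integrability on almost every slice of fixed `a`, and of the slicewise
  -- norms, suffices; both are transported from `K` by the change of variables.
  have hI : Integrable ((c.coords D).indicator f) (ρ.prod volume) := by
    rw [integrable_prod_iff hf']
    constructor
    · filter_upwards [hK'.prod_left_ae] with a ha
      rw [e2, integrable_indicator_iff (hTa a)] at ha
      rw [e1, integrable_indicator_iff (hSa a), c.integrableOn_coords_iff hk hW hg hDm hD]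
      exact ha.congr_fun (fun z hz => (hfK (z, a) hz).symm) (hTa a)
    · refine hK'.norm.integral_prod_right.congr (.of_forall fun a => ?_)
      change ∫ z, ‖D.indicator K (z, a)‖ = ∫ x, ‖(c.coords D).indicator f (a, x)‖
      have e3 : (fun x => ‖(c.coords D).indicator f (a, x)‖) =
          {x | (a, x) ∈ c.coords D}.indicator fun x => ‖f (a, x)‖ := by
        funext x; exact norm_indicator_eq_indicator_norm (f := f) (a, x)
      have e4 : (fun z => ‖D.indicator K (z, a)‖) =
          {z | (z, a) ∈ D}.indicator fun z => ‖K (z, a)‖ := by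
        funext z; exact norm_indicator_eq_indicator_norm (f := K) (z, a)
      rw [e3, e4, integral_indicator (hSa a), integral_indicator (hTa a),
        c.setIntegral_coords hk hW hg hDm hD]
      refine setIntegral_congr_fun (hTa a) fun z hz => ?_
      simp only [← hfK (z, a) hz, norm_smul, Real.norm_eq_abs, abs_abs, smul_eq_mul]
  refine ⟨hI, ?_⟩
  rw [integral_prod _ hI, ← integral_indicator hDm, integral_prod_symm _ hK']
  congr 1
  funext a
  rw [e1, e2, integral_indicator (hSa a), integral_indicator (hTa a),
    c.setIntegral_coords hk hW hg hDm hD]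
  exact setIntegral_congr_fun (hTa a) fun z hz => hfK (z, a) hz

/-- The density of the zero sets in the coordinates of a chart, restricted to a piece. -/
def pieceDens (φ : (Fin m → ℂ) → Alt m (2 * (m - k)))
    (D : Set ((Fin m → ℂ) × (∀ j, Fin (n j) → ℂ)))
    (p : ((∀ j, Fin (n j) → ℂ) × (Fin k → ℂ)) × (Fin (m - k) → ℂ)) : ℂ :=
  (c.coords D).indicator (c.dens φ) (p.1.1, p.1.2, p.2)

/-- The change of variables is applied to the density and to its norm. The identity for the norms
yields summability over the pieces, since these are disjoint in an incidence variety of finite total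
mass. -/
lemma integrable_pieceDens (hk : k ≤ m) (hW : IsOpen W) (hg : ∀ j, ContDiffOn ℂ ω (g j) W)
    {φ : (Fin m → ℂ) → Alt m (2 * (m - k))} (hφ : ∀ v, ContinuousOn (fun z => φ z v) W)
    {D : Set ((Fin m → ℂ) × (∀ j, Fin (n j) → ℂ))} (hDm : MeasurableSet D) (hD : D ⊆ c.src)
    (hK : IntegrableOn (incidenceDensity g hk φ) D (volume.prod (restMeasure n))) :
    Integrable (c.pieceDens φ D) (((restMeasure n).prod (stdComplexGaussian k)).prod volume) ∧
    ∫ p, c.pieceDens φ D p ∂(((restMeasure n).prod (stdComplexGaussian k)).prod volume) =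
      ∫ q in D, incidenceDensity g hk φ q ∂(volume.prod (restMeasure n)) ∧
    ∫ p, ‖c.pieceDens φ D p‖ ∂(((restMeasure n).prod (stdComplexGaussian k)).prod volume) =
      ∫ q in D, ‖incidenceDensity g hk φ q‖ ∂(volume.prod (restMeasure n)) := by
  have hw : Continuous fun t : (∀ j, Fin (n j) → ℂ) × (Fin k → ℂ) × (Fin (m - k) → ℂ) =>
      ∏ j, gaussDensity (t.2.1 j) := by fun_prop
  have hdens := c.continuousOn_dens hφ
  have hpos (y : Fin k → ℂ) : 0 ≤ ∏ j, gaussDensity (y j) :=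
    Finset.prod_nonneg fun j _ => gaussDensity_nonneg _
  have h0 : ∀ q ∈ D, |((c.sliceDeriv hk q.2 q.1).restrictScalars ℝ).det| •
      ((∏ j, gaussDensity (graphMap g q j)) • c.dens φ (q.2, graphMap g q, c.proj q.1)) =
        incidenceDensity g hk φ q := fun q hq => by
    rw [smul_comm, c.det_smul_dens hk hW hg φ (hD hq)]
    rfl
  have h1 := c.integrable_coords hk hW hg hDm hD (restMeasure n)
    (f := fun t => (∏ j, gaussDensity (t.2.1 j)) • c.dens φ t) (hw.continuousOn.smul hdens) hK h0
  have h2 := c.integrable_coords hk hW hg hDm hD (restMeasure n)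
    (f := fun t => (∏ j, gaussDensity (t.2.1 j)) • ‖c.dens φ t‖)
    (hw.continuousOn.smul hdens.norm) hK.norm fun q hq => by
      rw [← h0 q hq, norm_smul, norm_smul, Real.norm_eq_abs, abs_abs,
        Real.norm_of_nonneg (hpos _), smul_eq_mul, smul_eq_mul]
  have e1 : (c.coords D).indicator (fun t => (∏ j, gaussDensity (t.2.1 j)) • c.dens φ t) =
      fun t => (∏ j, gaussDensity (t.2.1 j)) • (c.coords D).indicator (c.dens φ) t := by
    funext t
    by_cases ht : t ∈ c.coords D <;> simp [ht]
  have e2 : (c.coords D).indicator (fun t => (∏ j, gaussDensity (t.2.1 j)) • ‖c.dens φ t‖) =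
      fun t => (∏ j, gaussDensity (t.2.1 j)) • ‖(c.coords D).indicator (c.dens φ) t‖ := by
    funext t
    by_cases ht : t ∈ c.coords D <;> simp [ht]
  rw [e1] at h1
  rw [e2] at h2
  refine ⟨(integrable_prod_stdComplexGaussian_iff _ _ _).2 h1.1, ?_, ?_⟩
  · exact (integral_prod_stdComplexGaussian _ _ _).trans h1.2
  · exact (integral_prod_stdComplexGaussian _ _
      (fun t => ‖(c.coords D).indicator (c.dens φ) t‖)).trans h2.2

end GraphChart

variable (g W) in
/-- Charts and disjoint pieces of the incidence variety over `B`. -/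
structure GraphPieces (B : Set (Fin m → ℂ)) where
  /-- the charts -/
  chart : ℕ → GraphChart g W
  /-- the pieces -/
  piece : ℕ → Set ((Fin m → ℂ) × (∀ j, Fin (n j) → ℂ))
  measurableSet_piece : ∀ i, MeasurableSet (piece i)
  piece_subset : ∀ i, piece i ⊆ (chart i).src
  disjoint : Pairwise fun i i' => Disjoint (piece i) (piece i')
  iUnion_piece : ⋃ i, piece i =
    {q | q.1 ∈ B ∧ Function.Surjective (ContinuousLinearMap.pi (graphDeriv g q.1 q.2))}

lemma nonempty_graphPieces (hW : IsOpen W) (hg : ∀ j, ContDiffOn ℂ ω (g j) W)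
    {B : Set (Fin m → ℂ)} (hBm : MeasurableSet B) (hB : B ⊆ W) : Nonempty (GraphPieces g W B) := by
  obtain ⟨c, hc⟩ := exists_graphChart_cover hW hg
  refine ⟨⟨c, fun i => (Prod.fst ⁻¹' B) ∩ disjointed (fun i => (c i).src) i, fun i => ?_,
    fun i => ?_, ?_, ?_⟩⟩
  · exact (measurable_fst hBm).inter
      (MeasurableSet.disjointed (fun i => (c i).isOpen_src.measurableSet) i)
  · exact Set.inter_subset_right.trans (disjointed_subset _ i)
  · exact fun i i' h => ((disjoint_disjointed _ h).mono Set.inter_subset_right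
      Set.inter_subset_right)
  · rw [← Set.inter_iUnion, iUnion_disjointed, hc]
    ext q
    exact ⟨fun h => ⟨h.1, h.2.2⟩, fun h => ⟨h.1, hB h.1, h.2⟩⟩

/-- The expected current of integration over the zero sets, locally. -/
lemma GraphPieces.hasSum_integral (hk : k ≤ m) (hW : IsOpen W)
    (hg : ∀ j, ContDiffOn ℂ ω (g j) W) {φ : (Fin m → ℂ) → Alt m (2 * (m - k))}
    (hφ : ∀ v, ContinuousOn (fun z => φ z v) W) {B : Set (Fin m → ℂ)} (hBm : MeasurableSet B)
    (hB : B ⊆ W) (P : GraphPieces g W B)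
    (hint : ∀ r : ∀ j, Fin (n j) × Fin (n j), IntegrableOn (fun z => wedgeCoeff hk (φ z)
      (fun j => tauForm (coeffDeriv g z j (r j).1) (coeffDeriv g z j (r j).2))) B) :
    (∀ i, Integrable ((P.chart i).pieceDens φ (P.piece i))
      (((restMeasure n).prod (stdComplexGaussian k)).prod volume)) ∧
    (Summable fun i => ∫ p, ‖(P.chart i).pieceDens φ (P.piece i) p‖
      ∂(((restMeasure n).prod (stdComplexGaussian k)).prod volume)) ∧
    HasSum (fun i => ∫ p, (P.chart i).pieceDens φ (P.piece i) p
      ∂(((restMeasure n).prod (stdComplexGaussian k)).prod volume))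
      (∫ z in B, wedgeCoeff hk (φ z)
        fun j => ddc (fun z => Real.log (1 + ∑ l, ‖g j z l‖ ^ 2)) z) ∧
    IntegrableOn (fun z => wedgeCoeff hk (φ z)
      fun j => ddc (fun z => Real.log (1 + ∑ l, ‖g j z l‖ ^ 2)) z) B := by
  have hK := integrable_incidenceDensity hk hg hBm hB hint
  have hsub : ⋃ i, P.piece i ⊆ B ×ˢ Set.univ := by
    rw [P.iUnion_piece]
    exact fun q hq => ⟨hq.1, trivial⟩
  have hKi (i) : IntegrableOn (incidenceDensity g hk φ) (P.piece i)
      (volume.prod (restMeasure n)) := hK.mono_set ((Set.subset_iUnion _ i).trans hsub)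
  have hp (i) := (P.chart i).integrable_pieceDens hk hW hg hφ (P.measurableSet_piece i)
    (P.piece_subset i) (hKi i)
  have hKB : Integrable (incidenceDensity g hk φ) ((volume.restrict B).prod (restMeasure n)) := by
    have := hK
    rwa [IntegrableOn, ← Measure.prod_restrict, Measure.restrict_univ] at this
  have hae : ∀ᵐ z ∂(volume.restrict B), ∫ a, incidenceDensity g hk φ (z, a) ∂restMeasure n =
      wedgeCoeff hk (φ z) fun j => ddc (fun z => Real.log (1 + ∑ l, ‖g j z l‖ ^ 2)) z := by
    filter_upwards [ae_restrict_mem hBm] with z hz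
    exact integral_incidenceDensity hk hW hg (hB hz)
  refine ⟨fun i => (hp i).1, ?_, ?_, ?_⟩
  · simp only [fun i => (hp i).2.2]
    exact (hasSum_integral_iUnion P.measurableSet_piece P.disjoint (IntegrableOn.mono_set hK.norm hsub)).summable
  · simp only [fun i => (hp i).2.1]
    have h1 := hasSum_integral_iUnion P.measurableSet_piece P.disjoint (hK.mono_set hsub)
    suffices h4 : ∫ z in B, wedgeCoeff hk (φ z)
        (fun j => ddc (fun z => Real.log (1 + ∑ l, ‖g j z l‖ ^ 2)) z) =
        ∫ q in ⋃ i, P.piece i, incidenceDensity g hk φ q ∂(volume.prod (restMeasure n)) by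
      rw [h4]; exact h1
    -- The pieces miss only points with dependent differentials, where the incidence density is
    -- zero. The union may thus be replaced by the product of `B` with the coefficient space, and
    -- Fubini's theorem averages over the coefficients.
    rw [← setIntegral_eq_of_subset_of_forall_sdiff_eq_zero (hBm.prod .univ) hsub, ← integral_congr_ae hae,
      ← Measure.prod_restrict, Measure.restrict_univ, integral_prod _ hKB]
    intro q hq
    have h2 : ¬Function.Surjective (ContinuousLinearMap.pi (graphDeriv g q.1 q.2)) := fun h =>
      hq.2 (by rw [P.iUnion_piece]; exact ⟨hq.1.1, h⟩)
    have h3 : wedgeCoeff hk (φ q.1)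
        (fun j => tauForm (graphDeriv g q.1 q.2 j) (graphDeriv g q.1 q.2 j)) = 0 := by
      change wedgeTop hk (wedgeAll k _) (φ q.1) (stdFrame m) = 0
      rw [wedgeAll_tauForm_eq_zero_of_not_surjective _ h2]
      have := wedge_smul_left (0 : ℂ) (0 : Alt m (2 * k)) (φ q.1)
      simp only [zero_smul] at this
      rw [wedgeTop, this]
      rfl
    rw [incidenceDensity, h3, smul_zero]
  · exact hKB.integral_prod_left.congr hae

end Coarea

/-! ### Almost sure regularity of the zeros in a chart -/

section Regular

variable {m k : ℕ} {n : Fin k → ℕ} {g : ∀ j, (Fin m → ℂ) → Fin (n j) → ℂ} {W : Set (Fin m → ℂ)}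

lemma stdComplexGaussian_absolutelyContinuous (d : ℕ) : stdComplexGaussian d ≪ volume :=
  withDensity_absolutelyContinuous _ _

/-- Almost surely, the common zeros in `W` are regular. -/
lemma ae_surjective_graphDeriv (hW : IsOpen W) (hg : ∀ j, ContDiffOn ℂ ω (g j) W) :
    ∀ᵐ p ∂((restMeasure n).prod (stdComplexGaussian k)), ∀ z ∈ W, graphMap g (z, p.1) = p.2 →
      Function.Surjective (ContinuousLinearMap.pi (graphDeriv g z p.1)) := by
  obtain ⟨c, hc⟩ := exists_graphChart_cover hW hg
  -- `N` is the critical part of the incidence variety. Being σ-compact it has a Borel image in the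
  -- coefficient space, so nullity can be tested on slices of fixed `a`, where the image lies in the
  -- critical values of `graphMap g (·, a)`.
  let N : Set ((Fin m → ℂ) × (∀ j, Fin (n j) → ℂ)) := (W ×ˢ Set.univ) ∩ (⋃ i, (c i).src)ᶜ
  have hN : IsSigmaCompact N := IsOpen.isSigmaCompact_inter (hW.prod isOpen_univ)
    (isOpen_iUnion fun i => (c i).isOpen_src).isClosed_compl
  have hmem (q) : q ∈ N ↔ q.1 ∈ W ∧
      ¬Function.Surjective (ContinuousLinearMap.pi (graphDeriv g q.1 q.2)) := by
    simp only [N, hc, Set.mem_inter_iff, Set.mem_prod, Set.mem_univ, and_true, Set.mem_compl_iff,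
      Set.mem_ofPred_eq]
    tauto
  let G : (Fin m → ℂ) × (∀ j, Fin (n j) → ℂ) → (∀ j, Fin (n j) → ℂ) × (Fin k → ℂ) :=
    fun q => (q.2, graphMap g q)
  have hG : ContinuousOn G N := (continuousOn_snd.prodMk
    (contDiffOn_graphMap hg).continuousOn).mono Set.inter_subset_left
  have hm : MeasurableSet (G '' N) := IsSigmaCompact.measurableSet (hN.image_of_continuousOn hG)
  have h0 : ((restMeasure n).prod (stdComplexGaussian k)) (G '' N) = 0 := by
    rw [Measure.measure_prod_null hm]
    refine .of_forall fun a => ?_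
    refine measure_mono_null ?_ (stdComplexGaussian_absolutelyContinuous k
      (sard k m W (fun z => graphMap g (z, a)) hW ((contDiffOn_graphMap hg).comp
        (contDiffOn_id.prodMk contDiffOn_const) fun z hz => ⟨hz, trivial⟩)))
    rintro y ⟨⟨z, a'⟩, hz, hy⟩
    obtain ⟨rfl, rfl⟩ := Prod.mk.inj hy
    have h1 := (hmem _).1 hz
    refine ⟨z, ⟨h1.1, ?_⟩, rfl⟩
    rw [(hasFDerivAt_graphMap hW hg h1.1 a').fderiv]
    exact h1.2
  filter_upwards [compl_mem_ae_iff.2 h0] with p hp z hz hy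
  by_contra h
  exact hp ⟨(z, p.1), (hmem _).2 ⟨hz, h⟩, Prod.ext rfl hy⟩

end Regular

/-! ### Sections in local trivializations -/

section Sections

variable {m : ℕ} {M : Type*} [TopologicalSpace M] [ChartedSpace (Fin m → ℂ) M]
  {L : M → Type*} [∀ x, TopologicalSpace (L x)] [TopologicalSpace (TotalSpace ℂ L)]
  [∀ x, AddCommGroup (L x)] [∀ x, Module ℂ (L x)] [FiberBundle ℂ L] [VectorBundle ℂ ℂ L]

/-- The trivialization at `x₀` on the fibre over `z`. -/
def fiberEquiv (L : M → Type*) [∀ x, TopologicalSpace (L x)] [TopologicalSpace (TotalSpace ℂ L)]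
    [∀ x, AddCommGroup (L x)] [∀ x, Module ℂ (L x)] [FiberBundle ℂ L] [VectorBundle ℂ ℂ L]
    {x₀ z : M} (hz : z ∈ (trivializationAt ℂ L x₀).baseSet) : L z ≃ₗ[ℂ] ℂ :=
  (trivializationAt ℂ L x₀).linearEquivAt ℂ z hz

lemma localRep_eq_fiberEquiv (s : HolSection (m := m) L) {x₀ z : M}
    (hz : z ∈ (trivializationAt ℂ L x₀).baseSet) : localRep s x₀ z = fiberEquiv L hz (s z) := rfl

lemma localFrame_eq_fiberEquiv {x₀ z : M} (hz : z ∈ (trivializationAt ℂ L x₀).baseSet) :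
    localFrame L x₀ z = (fiberEquiv L hz).symm 1 := rfl

lemma localRep_smul_localFrame (s : HolSection (m := m) L) {x₀ z : M}
    (hz : z ∈ (trivializationAt ℂ L x₀).baseSet) :
    localRep s x₀ z • localFrame L x₀ z = s z := by
  rw [localRep_eq_fiberEquiv s hz, localFrame_eq_fiberEquiv hz, ← map_smul, smul_eq_mul, mul_one,
    LinearEquiv.symm_apply_apply]

lemma localRep_eq_zero_iff (s : HolSection (m := m) L) {x₀ z : M}
    (hz : z ∈ (trivializationAt ℂ L x₀).baseSet) : localRep s x₀ z = 0 ↔ s z = 0 := by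
  rw [localRep_eq_fiberEquiv s hz, LinearEquiv.map_eq_zero_iff]

lemma localRep_sum_smul {ι : Type*} [Fintype ι] (c : ι → ℂ) (s : ι → HolSection (m := m) L)
    {x₀ z : M} (hz : z ∈ (trivializationAt ℂ L x₀).baseSet) :
    localRep (∑ l, c l • s l) x₀ z = ∑ l, c l * localRep (s l) x₀ z := by
  have h1 : (∑ l, c l • s l : HolSection (m := m) L) z = ∑ l, c l • s l z := by
    have h2 : ⇑(∑ l, c l • s l : HolSection (m := m) L) = ∑ l, ⇑(c l • s l) :=
      map_sum (ContMDiffSection.coeAddHom 𝓘(ℂ, Fin m → ℂ) ℂ ω L) _ _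
    rw [h2, Finset.sum_apply]
    rfl
  rw [localRep_eq_fiberEquiv _ hz, h1, map_sum]
  simp only [map_smul, smul_eq_mul, localRep_eq_fiberEquiv _ hz]

/-- The transition factor does not depend on the section, so quotients of sections are well defined
functions on the manifold. -/
lemma exists_localRep_eq_mul {x₀ x₁ z : M} (h0 : z ∈ (trivializationAt ℂ L x₀).baseSet)
    (h1 : z ∈ (trivializationAt ℂ L x₁).baseSet) :
    ∃ t : ℂ, t ≠ 0 ∧ ∀ s : HolSection (m := m) L, localRep s x₁ z = t * localRep s x₀ z := by
  refine ⟨fiberEquiv L h1 ((fiberEquiv L h0).symm 1), by simp, fun s => ?_⟩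
  rw [localRep_eq_fiberEquiv s h1, localRep_eq_fiberEquiv s h0, mul_comm, ← smul_eq_mul,
    ← map_smul, ← map_smul, smul_eq_mul, mul_one, LinearEquiv.symm_apply_apply]

/-- The meromorphic function `s / t`. -/
def sectionRatio (s t : HolSection (m := m) L) (z : M) : ℂ := localRep s z z / localRep t z z

lemma sectionRatio_eq (s t : HolSection (m := m) L) {x₀ z : M}
    (hz : z ∈ (trivializationAt ℂ L x₀).baseSet) :
    sectionRatio s t z = localRep s x₀ z / localRep t x₀ z := by
  obtain ⟨u, hu, h⟩ := exists_localRep_eq_mul (m := m) (L := L) hz (FiberBundle.mem_baseSet_trivializationAt' z)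
  rw [sectionRatio, h s, h t, mul_div_mul_left _ _ hu]

lemma normSq_eq (h : HermitianMetric (m := m) L) (s : HolSection (m := m) L) {x₀ z : M}
    (hz : z ∈ (trivializationAt ℂ L x₀).baseSet) :
    h.normSq (s z) = ‖localRep s x₀ z‖ ^ 2 * h.normSq (localFrame L x₀ z) := by
  let _ := h.core z
  conv_lhs => rw [← localRep_smul_localFrame s hz]
  have h1 (c : ℂ) (v : L z) : (h.core z).inner (c • v) (c • v) =
      (‖c‖ ^ 2 : ℝ) * (h.core z).inner v v := by
    have h2 : (h.core z).inner (c • v) (c • v) =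
      starRingEnd ℂ c * (c * (h.core z).inner v v) := by
      rw [(h.core z).smul_left]
      congr 1
      exact InnerProductSpace.Core.inner_smul_right (𝕜 := ℂ) v v
    rw [h2, ← mul_assoc, Complex.conj_mul']
    push_cast
    rfl
  rw [HermitianMetric.normSq, h1, Complex.re_ofReal_mul, HermitianMetric.normSq]

lemma normSq_localFrame_pos (h : HermitianMetric (m := m) L) {x₀ z : M}
    (hz : z ∈ (trivializationAt ℂ L x₀).baseSet) : 0 < h.normSq (localFrame L x₀ z) := by
  have h0 : localFrame L x₀ z ≠ 0 := by rw [localFrame_eq_fiberEquiv hz]; simp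
  have h1 : 0 ≤ h.normSq (localFrame L x₀ z) := (h.core z).re_inner_nonneg _
  refine lt_of_le_of_ne h1 fun h2 => h0 ((h.core z).definite _ ?_)
  let _ := (h.core z).toCore
  refine Complex.ext h2.symm ?_
  exact InnerProductSpace.Core.inner_self_im (𝕜 := ℂ) (localFrame L x₀ z)

variable [ContMDiffVectorBundle ω ℂ L 𝓘(ℂ, Fin m → ℂ)]

lemma contMDiffOn_localRep (s : HolSection (m := m) L) (x₀ : M) :
    ContMDiffOn 𝓘(ℂ, Fin m → ℂ) 𝓘(ℂ, ℂ) ω (localRep s x₀) (trivializationAt ℂ L x₀).baseSet :=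
  ((trivializationAt ℂ L x₀).contMDiffOn_section_baseSet_iff (n := ω)
    (IB := 𝓘(ℂ, Fin m → ℂ))).1 s.contMDiff.contMDiffOn

lemma contMDiffAt_localRep (s : HolSection (m := m) L) {x₀ z : M}
    (hz : z ∈ (trivializationAt ℂ L x₀).baseSet) :
    ContMDiffAt 𝓘(ℂ, Fin m → ℂ) 𝓘(ℂ, ℂ) ω (localRep s x₀) z :=
  (contMDiffOn_localRep s x₀).contMDiffAt
    ((trivializationAt ℂ L x₀).open_baseSet.mem_nhds hz)

lemma isOpen_ne_zero (s : HolSection (m := m) L) : IsOpen {z | s z ≠ 0} := by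
  refine isOpen_iff_mem_nhds.2 fun z hz => ?_
  have hb := FiberBundle.mem_baseSet_trivializationAt' (F := ℂ) (E := L) z
  have h1 : localRep s z z ≠ 0 := fun h => hz ((localRep_eq_zero_iff s hb).1 h)
  filter_upwards [(contMDiffAt_localRep s hb).continuousAt.eventually_ne h1,
    (trivializationAt ℂ L z).open_baseSet.mem_nhds hb] with y hy hy'
  exact fun h => hy ((localRep_eq_zero_iff s hy').2 h)

lemma contMDiffAt_sectionRatio (s : HolSection (m := m) L) {t : HolSection (m := m) L} {z : M}
    (hz : t z ≠ 0) : ContMDiffAt 𝓘(ℂ, Fin m → ℂ) 𝓘(ℂ, ℂ) ω (sectionRatio s t) z := by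
  have hb := FiberBundle.mem_baseSet_trivializationAt' (F := ℂ) (E := L) z
  have h1 : localRep t z z ≠ 0 := fun h => hz ((localRep_eq_zero_iff t hb).1 h)
  have h2 : ContMDiffAt 𝓘(ℂ, Fin m → ℂ) 𝓘(ℂ, ℂ) ω (fun y => localRep s z y / localRep t z y) z :=
    (contMDiffAt_localRep s hb).div₀ (contMDiffAt_localRep t hb) h1
  refine h2.congr_of_eventuallyEq ?_
  filter_upwards [(trivializationAt ℂ L z).open_baseSet.mem_nhds hb] with y hy
  exact sectionRatio_eq s t hy

end Sections

/-! ### The underlying real manifold and its charts -/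

section RealStructure

variable {m : ℕ} {M : Type*} [TopologicalSpace M] [ChartedSpace (Fin m → ℂ) M]

/-- Holomorphic transition maps are real analytic. The real structure is needed because forms are
pulled back by real differentials. -/
lemma isManifold_real [IsManifold 𝓘(ℂ, Fin m → ℂ) ω M] : IsManifold 𝓘(ℝ, Fin m → ℂ) ω M := by
  refine isManifold_of_contDiffOn _ _ _ fun e e' he he' => ?_
  have h1 := contMDiffOn_iff_contDiffOn.1 (contMDiffOn_of_mem_contDiffGroupoid
    ((contDiffGroupoid ω 𝓘(ℂ, Fin m → ℂ)).compatible he he'))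
  simpa only [mfld_simps] using h1.restrict_scalars ℝ

lemma mfderiv_eq_fderiv_chart {𝕜 : Type*} [NontriviallyNormedField 𝕜] {E F : Type*}
    [NormedAddCommGroup E] [NormedSpace 𝕜 E] [NormedAddCommGroup F] [NormedSpace 𝕜 F]
    {N P : Type*} [TopologicalSpace N] [ChartedSpace E N] [TopologicalSpace P] [ChartedSpace F P]
    {f : N → P} {x : N} (hf : MDifferentiableAt 𝓘(𝕜, E) 𝓘(𝕜, F) f x) :
    mfderiv 𝓘(𝕜, E) 𝓘(𝕜, F) f x =
      fderiv 𝕜 (chartAt F (f x) ∘ f ∘ (chartAt E x).symm) (chartAt E x x) := by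
  rw [hf.mfderiv]
  simp only [writtenInExtChartAt, mfld_simps, fderivWithin_univ]
  rfl

variable [IsManifold 𝓘(ℂ, Fin m → ℂ) ω M]

lemma mdifferentiable_chart_real (x : M) :
    (chartAt (Fin m → ℂ) x).MDifferentiable 𝓘(ℝ, Fin m → ℂ) 𝓘(ℝ, Fin m → ℂ) := by
  have := isManifold_real (m := m) (M := M)
  have : IsManifold 𝓘(ℝ, Fin m → ℂ) 1 M := .of_le (n := ω) le_top
  exact mdifferentiable_chart x

lemma mdifferentiable_chart_complex (x : M) :
    (chartAt (Fin m → ℂ) x).MDifferentiable 𝓘(ℂ, Fin m → ℂ) 𝓘(ℂ, Fin m → ℂ) := by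
  have : IsManifold 𝓘(ℂ, Fin m → ℂ) 1 M := .of_le (n := ω) le_top
  exact mdifferentiable_chart x

/-- Tangent vectors are read in the preferred chart at their base point, so the differential of an
inverse chart is that of a transition map, and the target chart varies with the point. -/
lemma realDeriv_chart_symm {x₀ : M} {y : Fin m → ℂ} (hy : y ∈ (chartAt (Fin m → ℂ) x₀).target) :
    realDeriv (m := m) (p := m) (chartAt (Fin m → ℂ) x₀).symm y =
      fderiv ℝ (chartAt (Fin m → ℂ) ((chartAt (Fin m → ℂ) x₀).symm y) ∘
        (chartAt (Fin m → ℂ) x₀).symm) y :=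
  mfderiv_eq_fderiv_chart ((mdifferentiable_chart_real x₀).mdifferentiableAt_symm hy)

lemma injective_realDeriv_chart_symm {x₀ : M} {y : Fin m → ℂ}
    (hy : y ∈ (chartAt (Fin m → ℂ) x₀).target) :
    Function.Injective (realDeriv (m := m) (p := m) (chartAt (Fin m → ℂ) x₀).symm y) :=
  (mdifferentiable_chart_real x₀).symm.mfderiv_injective hy

lemma realDeriv_chart_symm_comp {p : ℕ} {x₀ : M} {f : (Fin p → ℂ) → Fin m → ℂ} {w : Fin p → ℂ}
    (hw : f w ∈ (chartAt (Fin m → ℂ) x₀).target) (hf : DifferentiableAt ℝ f w) :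
    realDeriv (m := m) (p := p) (fun w => (chartAt (Fin m → ℂ) x₀).symm (f w)) w =
      (realDeriv (m := m) (p := m) (chartAt (Fin m → ℂ) x₀).symm (f w)).comp (fderiv ℝ f w) := by
  have h1 := (mdifferentiable_chart_real x₀).mdifferentiableAt_symm hw
  have h2 : MDifferentiableAt 𝓘(ℝ, Fin p → ℂ) 𝓘(ℝ, Fin m → ℂ) f w := hf.mdifferentiableAt
  have h3 := mfderiv_comp (I := 𝓘(ℝ, Fin p → ℂ)) (I' := 𝓘(ℝ, Fin m → ℂ))
    (I'' := 𝓘(ℝ, Fin m → ℂ)) w h1 h2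
  rw [mfderiv_eq_fderiv] at h3
  exact h3

lemma pullback_chart_symm_comp {p q : ℕ} (η : DForm m M q) {x₀ : M}
    {f : (Fin p → ℂ) → Fin m → ℂ} {w : Fin p → ℂ}
    (hw : f w ∈ (chartAt (Fin m → ℂ) x₀).target) (hf : DifferentiableAt ℝ f w)
    (v : Fin q → Fin p → ℂ) :
    pullback (m := m) (p := p) (fun w => (chartAt (Fin m → ℂ) x₀).symm (f w)) η w v =
      pullback (p := m) (chartAt (Fin m → ℂ) x₀).symm η (f w) fun i => fderiv ℝ f w (v i) := by
  simp only [pullback, realDeriv_chart_symm_comp hw hf]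
  rfl

/-- The holomorphic transition map from the chart at `x₀` to the preferred chart at a point. -/
lemma contDiffAt_transition {x₀ x : M} {y : Fin m → ℂ}
    (hy : y ∈ (chartAt (Fin m → ℂ) x₀).target)
    (hx : (chartAt (Fin m → ℂ) x₀).symm y ∈ (chartAt (Fin m → ℂ) x).source) :
    ContDiffAt ℂ ω (chartAt (Fin m → ℂ) x ∘ (chartAt (Fin m → ℂ) x₀).symm) y := by
  have h1 : ContMDiffAt 𝓘(ℂ, Fin m → ℂ) 𝓘(ℂ, Fin m → ℂ) ω (chartAt (Fin m → ℂ) x₀).symm y :=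
    contMDiffOn_chart_symm.contMDiffAt ((chartAt (Fin m → ℂ) x₀).open_target.mem_nhds hy)
  have h2 : ContMDiffAt 𝓘(ℂ, Fin m → ℂ) 𝓘(ℂ, Fin m → ℂ) ω (chartAt (Fin m → ℂ) x)
      ((chartAt (Fin m → ℂ) x₀).symm y) :=
    contMDiffOn_chart.contMDiffAt ((chartAt (Fin m → ℂ) x).open_source.mem_nhds hx)
  exact contMDiffAt_iff_contDiffAt.1 (h2.comp y h1)

end RealStructure

/-! ### The curvature form, the Szegő kernel and the Kodaira map -/

section ExpectedForm

variable {m : ℕ} {M : Type*} [TopologicalSpace M] [ChartedSpace (Fin m → ℂ) M]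
  {L : M → Type*} [∀ x, TopologicalSpace (L x)] [TopologicalSpace (TotalSpace ℂ L)]
  [∀ x, AddCommGroup (L x)] [∀ x, Module ℂ (L x)] [FiberBundle ℂ L] [VectorBundle ℂ ℂ L]
  (h : HermitianMetric (m := m) L) {S : Submodule ℂ (HolSection (m := m) L)} {n : ℕ}
  (b : Module.Basis (Fin (n + 1)) ℂ S)

/-- The Kodaira map in the `i`-th affine coordinates. -/
def ratioMap (i : Fin (n + 1)) (z : M) (l : Fin n) : ℂ :=
  sectionRatio (b (i.succAbove l) : HolSection (m := m) L) (b i) z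

variable {b} {i : Fin (n + 1)}

lemma sum_normSq_localRep {x₀ z : M} (hz : z ∈ (trivializationAt ℂ L x₀).baseSet)
    (hi : (b i : HolSection (m := m) L) z ≠ 0) :
    ∑ l, ‖localRep (b l : HolSection (m := m) L) x₀ z‖ ^ 2 =
      ‖localRep (b i : HolSection (m := m) L) x₀ z‖ ^ 2 * (1 + ∑ l, ‖ratioMap b i z l‖ ^ 2) := by
  have h0 : localRep (b i : HolSection (m := m) L) x₀ z ≠ 0 :=
    fun h => hi ((localRep_eq_zero_iff _ hz).1 h)
  have h1 : ‖localRep (b i : HolSection (m := m) L) x₀ z‖ ≠ 0 := norm_ne_zero_iff.2 h0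
  rw [Fin.sum_univ_succAbove _ i, mul_add, mul_one, Finset.mul_sum]
  congr 1
  refine Finset.sum_congr rfl fun l _ => ?_
  rw [ratioMap, sectionRatio_eq _ _ hz, norm_div]
  field_simp

/-- Factoring out the distinguished section leaves three summands: a pluriharmonic one, the
Fubini–Study potential, and the logarithm of the metric, which the Chern form removes. -/
lemma log_szegoDiag {x₀ z : M} (hz : z ∈ (trivializationAt ℂ L x₀).baseSet)
    (hi : (b i : HolSection (m := m) L) z ≠ 0) :
    Real.log (szegoDiag h b z) = Real.log (‖localRep (b i : HolSection (m := m) L) x₀ z‖ ^ 2) +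
      Real.log (1 + ∑ l, ‖ratioMap b i z l‖ ^ 2) + Real.log (h.normSq (localFrame L x₀ z)) := by
  have h0 : localRep (b i : HolSection (m := m) L) x₀ z ≠ 0 :=
    fun h => hi ((localRep_eq_zero_iff _ hz).1 h)
  have h1 : ‖localRep (b i : HolSection (m := m) L) x₀ z‖ ^ 2 ≠ 0 := by simpa using h0
  have h2 : 1 + ∑ l, ‖ratioMap b i z l‖ ^ 2 ≠ 0 := by positivity
  rw [← Real.log_mul h1 h2, ← Real.log_mul (mul_ne_zero h1 h2) (normSq_localFrame_pos h hz).ne',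
    ← sum_normSq_localRep hz hi, szegoDiag, Finset.sum_mul]
  simp only [normSq_eq h _ hz]

lemma kodairaMap_mem {z : M} (hi : (b i : HolSection (m := m) L) z ≠ 0) :
    kodairaMap b z ∈ (affineChart i).source ∧ affineChart i (kodairaMap b z) = ratioMap b i z := by
  have h0 : localRep (b i : HolSection (m := m) L) z z ≠ 0 := fun h =>
    hi ((localRep_eq_zero_iff _ (FiberBundle.mem_baseSet_trivializationAt' z)).1 h)
  have h1 : (fun l => localRep (b l : HolSection (m := m) L) z z) ≠ 0 := fun h =>
    h0 (congrFun h i)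
  have h2 : kodairaMap b z = Projectivization.mk ℂ _ h1 := dif_pos h1
  rw [h2]
  exact ⟨h0, rfl⟩

variable [ContMDiffVectorBundle ω ℂ L 𝓘(ℂ, Fin m → ℂ)]

lemma contMDiffAt_ratioMap {z : M} (hi : (b i : HolSection (m := m) L) z ≠ 0) :
    ContMDiffAt 𝓘(ℂ, Fin m → ℂ) 𝓘(ℂ, Fin n → ℂ) ω (ratioMap b i) z :=
  contMDiffAt_pi_space.2 fun _ => contMDiffAt_sectionRatio _ hi

variable [IsManifold 𝓘(ℂ, Fin m → ℂ) ω M]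

/-- The Kodaira map in affine coordinates and in the chart at `x₀`. -/
def chartRatio (b : Module.Basis (Fin (n + 1)) ℂ S) (i : Fin (n + 1)) (x₀ : M) (y : Fin m → ℂ) :
    Fin n → ℂ := ratioMap b i ((chartAt (Fin m → ℂ) x₀).symm y)

lemma contMDiffAt_chart_symm {x₀ : M} {y : Fin m → ℂ}
    (hy : y ∈ (chartAt (Fin m → ℂ) x₀).target) :
    ContMDiffAt 𝓘(ℂ, Fin m → ℂ) 𝓘(ℂ, Fin m → ℂ) ω (chartAt (Fin m → ℂ) x₀).symm y :=
  contMDiffOn_chart_symm.contMDiffAt ((chartAt (Fin m → ℂ) x₀).open_target.mem_nhds hy)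

lemma contDiffAt_chartRatio {x₀ : M} {y : Fin m → ℂ} (hy : y ∈ (chartAt (Fin m → ℂ) x₀).target)
    (hi : (b i : HolSection (m := m) L) ((chartAt (Fin m → ℂ) x₀).symm y) ≠ 0) :
    ContDiffAt ℂ ω (chartRatio b i x₀) y :=
  contMDiffAt_iff_contDiffAt.1 ((contMDiffAt_ratioMap hi).comp y (contMDiffAt_chart_symm hy))

lemma contDiffAt_log_chartRatio {x₀ : M} {y : Fin m → ℂ}
    (hy : y ∈ (chartAt (Fin m → ℂ) x₀).target)
    (hi : (b i : HolSection (m := m) L) ((chartAt (Fin m → ℂ) x₀).symm y) ≠ 0) :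
    ContDiffAt ℝ ω (fun y => Real.log (1 + ∑ l, ‖chartRatio b i x₀ y l‖ ^ 2)) y :=
  ContDiffAt.comp y (contDiffAt_log_normSq (ε := 1) (w := chartRatio b i x₀ y) (by positivity))
    ((contDiffAt_chartRatio hy hi).restrict_scalars ℝ)

/-- The metric terms cancel before any derivative of them is computed, and log |f|² is
pluriharmonic. This links the global expression to the one produced by the Gaussian integral. -/
lemma expectedForm_eq_ddc {x : M} (hi : (b i : HolSection (m := m) L) x ≠ 0) :
    expectedForm h b x = ddc (fun y => Real.log (1 + ∑ l, ‖chartRatio b i x y l‖ ^ 2))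
      (chartAt (Fin m → ℂ) x x) := by
  set κ := chartAt (Fin m → ℂ) x with hκ
  have hx : x ∈ κ.source := mem_chart_source _ x
  have hy : κ x ∈ κ.target := κ.map_source hx
  have hxy : κ.symm (κ x) = x := κ.left_inv hx
  have hi' : (b i : HolSection (m := m) L) (κ.symm (κ x)) ≠ 0 := by rwa [hxy]
  have hb := FiberBundle.mem_baseSet_trivializationAt' (F := ℂ) (E := L) x
  let f : (Fin m → ℂ) → ℂ := fun y => localRep (b i : HolSection (m := m) L) x (κ.symm y)
  let r : (Fin m → ℂ) → ℝ := fun y => Real.log (1 + ∑ l, ‖chartRatio b i x y l‖ ^ 2)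
  let a : (Fin m → ℂ) → ℝ := fun y => h.normSq (localFrame L x (κ.symm y))
  have hf : ContDiffAt ℂ ω f (κ x) := by
    refine contMDiffAt_iff_contDiffAt.1 ?_
    exact ContMDiffAt.comp (I' := 𝓘(ℂ, Fin m → ℂ)) (κ x)
      (g := localRep (b i : HolSection (m := m) L) x)
      (by rw [hxy]; exact contMDiffAt_localRep _ hb) (contMDiffAt_chart_symm hy)
  have hf0 : f (κ x) ≠ 0 := by
    change localRep _ x (κ.symm (κ x)) ≠ 0
    rw [hxy]
    exact fun h => hi ((localRep_eq_zero_iff _ hb).1 h)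
  have hr : ContDiffAt ℝ 2 r (κ x) := (contDiffAt_log_chartRatio hy hi').of_le le_top
  have ha : ContDiffAt ℝ 2 a (κ x) := by
    have := isManifold_real (m := m) (M := M)
    have h1 : ContMDiffAt 𝓘(ℝ, Fin m → ℂ) 𝓘(ℝ, ℝ) 2 (fun y => h.normSq (localFrame L x y))
        (κ.symm (κ x)) := by
      rw [hxy]
      exact ((h.smooth x).contMDiffAt ((trivializationAt ℂ L x).open_baseSet.mem_nhds hb)).of_le
        (WithTop.coe_le_coe.2 (le_top : (2 : ℕ∞) ≤ ⊤))
    have h2 : ContMDiffAt 𝓘(ℝ, Fin m → ℂ) 𝓘(ℝ, Fin m → ℂ) 2 κ.symm (κ x) :=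
      ((contMDiffOn_chart_symm (n := ω)).contMDiffAt (κ.open_target.mem_nhds hy)).of_le le_top
    exact contMDiffAt_iff_contDiffAt.1 (h1.comp (κ x) h2)
  have ha0 : a (κ x) ≠ 0 := by
    change h.normSq (localFrame L x (κ.symm (κ x))) ≠ 0
    rw [hxy]
    exact (normSq_localFrame_pos h hb).ne'
  have hlf : ContDiffAt ℝ 2 (fun y => Real.log (‖f y‖ ^ 2)) (κ x) :=
    (((hf.restrict_scalars ℝ).of_le le_top).norm_sq ℝ).log (by simpa using hf0)
  have hla : ContDiffAt ℝ 2 (fun y => Real.log (a y)⁻¹) (κ x) :=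
    (ha.inv ha0).log (inv_ne_zero ha0)
  have hev : ∀ᶠ y in 𝓝 (κ x), κ.symm y ∈ (trivializationAt ℂ L x).baseSet ∧
      (b i : HolSection (m := m) L) (κ.symm y) ≠ 0 := by
    have hc : Filter.Tendsto κ.symm (𝓝 (κ x)) (𝓝 x) := by
      have := κ.continuousAt_symm hy
      rwa [ContinuousAt, hxy] at this
    exact (hc.eventually ((trivializationAt ℂ L x).open_baseSet.mem_nhds hb)).and
      (hc.eventually ((isOpen_ne_zero _).mem_nhds hi))
  have hlog : ((fun z => Real.log (szegoDiag h b z)) ∘ κ.symm) =ᶠ[𝓝 (κ x)]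
      fun y => (Real.log (‖f y‖ ^ 2) + r y) + Real.log (a y) := by
    filter_upwards [hev] with y hy
    exact log_szegoDiag h hy.1 hy.2
  have hinv : ((fun y => Real.log (h.normSq (localFrame L x y))⁻¹) ∘ κ.symm) =
      fun y => Real.log (a y)⁻¹ := rfl
  rw [expectedForm, chernForm, ddcAt, ddcAt, ← hκ, hinv, ddc_congr hlog,
    ← ddc_add ((hlf.add hr).add (ha.log ha0)) hla]
  have e1 : (fun y => (Real.log (‖f y‖ ^ 2) + r y) + Real.log (a y) + Real.log (a y)⁻¹) =
      fun y => Real.log (‖f y‖ ^ 2) + r y := by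
    funext y
    rw [Real.log_inv]
    ring
  rw [e1, ddc_add hlf hr, ddc_log_normSq_holomorphic hf hf0, zero_add]

/-- `expectedForm` is computed at each point in the preferred chart of that point. Holomorphic
invariance of ∂∂̄ replaces these varying charts by the single chart at `x₀`. -/
lemma pullback_expectedForm {x₀ : M} {y : Fin m → ℂ}
    (hy : y ∈ (chartAt (Fin m → ℂ) x₀).target)
    (hi : (b i : HolSection (m := m) L) ((chartAt (Fin m → ℂ) x₀).symm y) ≠ 0) :
    pullback (p := m) (chartAt (Fin m → ℂ) x₀).symm (expectedForm h b) y =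
      ddc (fun y => Real.log (1 + ∑ l, ‖chartRatio b i x₀ y l‖ ^ 2)) y := by
  set x := (chartAt (Fin m → ℂ) x₀).symm y with hx
  have hxs : x ∈ (chartAt (Fin m → ℂ) x).source := mem_chart_source _ x
  have hτ := contDiffAt_transition (x := x) hy (by rw [← hx]; exact hxs)
  have h1 : (fun y => Real.log (1 + ∑ l, ‖chartRatio b i x₀ y l‖ ^ 2)) =ᶠ[𝓝 y]
      fun y => (fun y => Real.log (1 + ∑ l, ‖chartRatio b i x y l‖ ^ 2))
        ((chartAt (Fin m → ℂ) x ∘ (chartAt (Fin m → ℂ) x₀).symm) y) := by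
    have hc := (chartAt (Fin m → ℂ) x₀).continuousAt_symm hy
    filter_upwards [hc ((chartAt (Fin m → ℂ) x).open_source.mem_nhds hxs)] with w hw
    have : (chartAt (Fin m → ℂ) x).symm (chartAt (Fin m → ℂ) x
        ((chartAt (Fin m → ℂ) x₀).symm w)) = (chartAt (Fin m → ℂ) x₀).symm w :=
      (chartAt (Fin m → ℂ) x).left_inv hw
    simp only [chartRatio, Function.comp_apply, this]
  have h2 : ContDiffAt ℝ 2 (fun y => Real.log (1 + ∑ l, ‖chartRatio b i x y l‖ ^ 2))
      ((chartAt (Fin m → ℂ) x ∘ (chartAt (Fin m → ℂ) x₀).symm) y) :=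
    (contDiffAt_log_chartRatio ((chartAt (Fin m → ℂ) x).map_source hxs) (by
      rw [(chartAt (Fin m → ℂ) x).left_inv hxs]; exact hi)).of_le le_top
  rw [ddc_congr h1, ddc_comp h2 hτ, pullback, realDeriv_chart_symm hy, ← hx,
    expectedForm_eq_ddc h hi]
  congr 1
  rw [(hτ.differentiableAt (by simp)).fderiv_restrictScalars ℝ]

lemma smoothFormOn_expectedForm {U : Set M}
    (hbase : ∀ z ∈ U, ∃ i, (b i : HolSection (m := m) L) z ≠ 0) :
    SmoothFormOn (expectedForm h b) U := by
  intro x₀ v y hy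
  obtain ⟨i, hi⟩ := hbase _ hy.2
  let Ω : Set (Fin m → ℂ) := (chartAt (Fin m → ℂ) x₀).target ∩
    (chartAt (Fin m → ℂ) x₀).symm ⁻¹' {z | (b i : HolSection (m := m) L) z ≠ 0}
  have hΩ : IsOpen Ω := (chartAt (Fin m → ℂ) x₀).isOpen_inter_preimage_symm (isOpen_ne_zero _)
  have h1 : ContDiffOn ℝ ∞ (fun y => Real.log (1 + ∑ l, ‖chartRatio b i x₀ y l‖ ^ 2)) Ω :=
    fun w hw => ((contDiffAt_log_chartRatio hw.1 hw.2).of_le le_top).contDiffWithinAt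
  have h2 := (contDiffOn_ddc hΩ h1 v).contDiffAt (hΩ.mem_nhds ⟨hy.1, hi⟩)
  refine (h2.congr_of_eventuallyEq ?_).contDiffWithinAt
  filter_upwards [hΩ.mem_nhds ⟨hy.1, hi⟩] with w hw
  rw [pullback_expectedForm h hw.1 hw.2]

lemma expectedForm_eq_pullback_fubiniStudy {x : M}
    (hbase : ∃ i, (b i : HolSection (m := m) L) x ≠ 0) :
    expectedForm h b x = pullback (kodairaMap b) (fubiniStudy n) x := by
  have h0 : (fun l => localRep (b l : HolSection (m := m) L) x x) ≠ 0 := fun h => by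
    obtain ⟨i, hi⟩ := hbase
    exact hi ((localRep_eq_zero_iff _ (FiberBundle.mem_baseSet_trivializationAt' x)).1
      (congrFun h i))
  have hmk : kodairaMap b x = Projectivization.mk ℂ _ h0 := dif_pos h0
  -- The preferred chart of projective space is an affine chart with a chosen index. This index
  -- dictates the distinguished section, which does not vanish at `x` because the image point lies
  -- in the chart.
  obtain ⟨i, hi⟩ : ∃ i, chartAt (Fin n → ℂ) (kodairaMap b x) = affineChart i := ⟨_, rfl⟩
  have hi' : kodairaMap b x ∈ (affineChart i).source := hi ▸ mem_chart_source _ (kodairaMap b x)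
  have hbi : (b i : HolSection (m := m) L) x ≠ 0 := by
    rw [hmk] at hi'
    have h1 : localRep (b i : HolSection (m := m) L) x x ≠ 0 := hi'
    exact fun h => h1 ((localRep_eq_zero_iff _ (FiberBundle.mem_baseSet_trivializationAt' x)).2 h)
  have hxs : x ∈ (chartAt (Fin m → ℂ) x).source := mem_chart_source _ x
  have hxt := (chartAt (Fin m → ℂ) x).map_source hxs
  have hxy := (chartAt (Fin m → ℂ) x).left_inv hxs
  have hcont : ContinuousAt (kodairaMap b) x := by
    have h1 : kodairaMap b =ᶠ[𝓝 x] (affineChart i).symm ∘ ratioMap b i := by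
      filter_upwards [(isOpen_ne_zero (b i : HolSection (m := m) L)).mem_nhds hbi] with z hz
      rw [Function.comp_apply, ← (kodairaMap_mem hz).2,
        (affineChart i).left_inv (kodairaMap_mem hz).1]
    refine ContinuousAt.congr ?_ h1.symm
    exact ((affineChart i).continuousAt_symm (Set.mem_univ _)).comp
      (contMDiffAt_ratioMap hbi).continuousAt
  have hbi' : (b i : HolSection (m := m) L)
      ((chartAt (Fin m → ℂ) x).symm (chartAt (Fin m → ℂ) x x)) ≠ 0 := by rwa [hxy]
  have hloc : (affineChart i ∘ kodairaMap b ∘ (chartAt (Fin m → ℂ) x).symm) =ᶠ[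
      𝓝 (chartAt (Fin m → ℂ) x x)] chartRatio b i x := by
    have hc := (chartAt (Fin m → ℂ) x).continuousAt_symm hxt
    filter_upwards [hc ((isOpen_ne_zero (b i : HolSection (m := m) L)).mem_nhds hbi')] with w hw
    exact (kodairaMap_mem hw).2
  have hR := contDiffAt_chartRatio hxt hbi'
  have hdR : DifferentiableAt ℝ (chartRatio b i x) (chartAt (Fin m → ℂ) x x) :=
    (hR.differentiableAt (by simp)).restrictScalars ℝ
  have hmd : MDifferentiableAt 𝓘(ℝ, Fin m → ℂ) 𝓘(ℝ, Fin n → ℂ) (kodairaMap b) x := by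
    refine (mdifferentiableAt_iff _ _).2 ⟨hcont, ?_⟩
    simp only [writtenInExtChartAt, mfld_simps]
    rw [differentiableWithinAt_univ, hi]
    exact hdR.congr_of_eventuallyEq hloc
  have hval : chartRatio b i x (chartAt (Fin m → ℂ) x x) = affineChart i (kodairaMap b x) := by
    rw [chartRatio, hxy, (kodairaMap_mem hbi).2]
  rw [expectedForm_eq_ddc h hbi, pullback, realDeriv, mfderiv_eq_fderiv_chart hmd, hi,
    hloc.fderiv_eq, fubiniStudy, hi, ← hval,
    ddc_comp (u := fun w => Real.log (1 + ∑ l, ‖w l‖ ^ 2))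
      ((contDiffAt_log_normSq (by positivity)).of_le le_top) hR,
    (hR.differentiableAt (by simp)).fderiv_restrictScalars ℝ]

end ExpectedForm

/-! ### Independence of differentials as surjectivity -/

section Independence

variable {E : Type*} [NormedAddCommGroup E] [NormedSpace ℂ E] {k : ℕ}

/-- A proper range is annihilated by a nonzero functional on ℂ^k, whose coefficients form a linear
relation; conversely, evaluation at a preimage of a basis vector isolates one coefficient of a
relation. -/
lemma linearIndependent_iff_surjective_pi (lam : Fin k → E →L[ℂ] ℂ) :
    LinearIndependent ℂ lam ↔ Function.Surjective (ContinuousLinearMap.pi lam) := by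
  constructor
  · intro h
    by_contra hs
    have h1 : (ContinuousLinearMap.pi lam).toLinearMap.range < ⊤ :=
      lt_top_iff_ne_top.2 fun h2 => hs (LinearMap.range_eq_top.1 h2)
    obtain ⟨f, hf, hle⟩ := Submodule.exists_le_ker_of_lt_top _ h1
    have h2 : ∀ j, f (fun i => if j = i then 1 else 0) = 0 := by
      refine Fintype.linearIndependent_iff.1 h (fun j => f fun i => if j = i then 1 else 0) ?_
      ext v
      have h3 : f (ContinuousLinearMap.pi lam v) = 0 :=
        hle (LinearMap.mem_range_self (ContinuousLinearMap.pi lam).toLinearMap v)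
      rw [LinearMap.pi_apply_eq_sum_univ f] at h3
      simpa [mul_comm] using h3
    refine hf (LinearMap.ext fun y => ?_)
    rw [LinearMap.pi_apply_eq_sum_univ f]
    simp [h2]
  · intro h
    refine Fintype.linearIndependent_iff.2 fun c hc j => ?_
    obtain ⟨v, hv⟩ := h (Pi.single j 1)
    have h1 := DFunLike.congr_fun hc v
    have h2 (i) : lam i v = (Pi.single j 1 : Fin k → ℂ) i := congrFun hv i
    simpa [h2, Pi.single_apply] using h1

/-- Submersivity is insensitive to changes of coordinates and to multiplying each equation by a
nonzero factor; this absorbs the change from frames to quotients of sections. -/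
lemma surjective_pi_iff_of_comp {E' : Type*} [NormedAddCommGroup E'] [NormedSpace ℂ E']
    {lam : Fin k → E →L[ℂ] ℂ} {mu : Fin k → E' →L[ℂ] ℂ} {T : E' →L[ℂ] E}
    (hT : Function.Surjective T) {u : Fin k → ℂ} (hu : ∀ j, u j ≠ 0)
    (h : ∀ j, (lam j).comp T = u j • mu j) :
    Function.Surjective (ContinuousLinearMap.pi lam) ↔
      Function.Surjective (ContinuousLinearMap.pi mu) := by
  have h1 (v j) : lam j (T v) = u j * mu j v := DFunLike.congr_fun (h j) v
  constructor
  · intro hs y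
    obtain ⟨w, hw⟩ := hs fun j => u j * y j
    obtain ⟨v, rfl⟩ := hT w
    refine ⟨v, funext fun j => mul_left_cancel₀ (hu j) ?_⟩
    rw [ContinuousLinearMap.pi_apply, ← h1]
    exact congrFun hw j
  · intro hs y
    obtain ⟨v, hv⟩ := hs fun j => (u j)⁻¹ * y j
    refine ⟨T v, funext fun j => ?_⟩
    have h2 : mu j v = (u j)⁻¹ * y j := congrFun hv j
    rw [ContinuousLinearMap.pi_apply, h1, h2, mul_inv_cancel_left₀ (hu j)]

end Independence

/-! ### The zero equation of one section -/

section SingleSection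

variable {m : ℕ} {M : Type*} [TopologicalSpace M] [ChartedSpace (Fin m → ℂ) M]
  {L : M → Type*} [∀ x, TopologicalSpace (L x)] [TopologicalSpace (TotalSpace ℂ L)]
  [∀ x, AddCommGroup (L x)] [∀ x, Module ℂ (L x)] [FiberBundle ℂ L] [VectorBundle ℂ ℂ L]
  {S : Submodule ℂ (HolSection (m := m) L)} {n : ℕ}
  {b : Module.Basis (Fin (n + 1)) ℂ S} {i : Fin (n + 1)}

/-- Division by the distinguished section makes the equation `s z = 0` affine in the coefficients,
with coefficient one at the distinguished one. -/
lemma localRep_eq_mul (s : S) {x₀ z : M} (hz : z ∈ (trivializationAt ℂ L x₀).baseSet)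
    (hi : (b i : HolSection (m := m) L) z ≠ 0) :
    localRep (s : HolSection (m := m) L) x₀ z = localRep (b i : HolSection (m := m) L) x₀ z *
      (b.equivFun s i + ∑ l, b.equivFun s (i.succAbove l) * ratioMap b i z l) := by
  have h0 : localRep (b i : HolSection (m := m) L) x₀ z ≠ 0 :=
    fun h => hi ((localRep_eq_zero_iff _ hz).1 h)
  have h1 : (s : HolSection (m := m) L) =
      ∑ l, b.equivFun s l • (b l : HolSection (m := m) L) := by
    conv_lhs => rw [← b.sum_equivFun s]
    rw [Submodule.coe_sum]
    rfl
  conv_lhs => rw [h1]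
  rw [localRep_sum_smul _ _ hz, Fin.sum_univ_succAbove _ i, mul_add, Finset.mul_sum]
  congr 1
  · ring
  · refine Finset.sum_congr rfl fun l _ => ?_
    rw [ratioMap, sectionRatio_eq _ _ hz]
    field_simp

lemma section_eq_zero_iff (s : S) {z : M} (hi : (b i : HolSection (m := m) L) z ≠ 0) :
    (s : HolSection (m := m) L) z = 0 ↔
      -∑ l, b.equivFun s (i.succAbove l) * ratioMap b i z l = b.equivFun s i := by
  have hz := FiberBundle.mem_baseSet_trivializationAt' (F := ℂ) (E := L) z
  have h0 : localRep (b i : HolSection (m := m) L) z z ≠ 0 :=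
    fun h => hi ((localRep_eq_zero_iff _ hz).1 h)
  rw [← localRep_eq_zero_iff _ hz, localRep_eq_mul s hz hi, mul_eq_zero, or_iff_right h0,
    add_eq_zero_iff_eq_neg]
  exact eq_comm

variable [IsManifold 𝓘(ℂ, Fin m → ℂ) ω M] [ContMDiffVectorBundle ω ℂ L 𝓘(ℂ, Fin m → ℂ)]

/-- By the Leibniz rule, and since the affine factor vanishes at a zero, the derivative of the
distinguished section drops out. The two signs match the convention of `graphDeriv`. -/
lemma sectionDeriv_comp (s : S) {x₀ : M} {y : Fin m → ℂ}
    (hy : y ∈ (chartAt (Fin m → ℂ) x₀).target)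
    (hi : (b i : HolSection (m := m) L) ((chartAt (Fin m → ℂ) x₀).symm y) ≠ 0)
    (hs : (s : HolSection (m := m) L) ((chartAt (Fin m → ℂ) x₀).symm y) = 0) :
    (sectionDeriv (s : HolSection (m := m) L) ((chartAt (Fin m → ℂ) x₀).symm y)).comp
      (mfderiv 𝓘(ℂ, Fin m → ℂ) 𝓘(ℂ, Fin m → ℂ) (chartAt (Fin m → ℂ) x₀).symm y :
        (Fin m → ℂ) →L[ℂ] (Fin m → ℂ)) =
      (-localRep (b i : HolSection (m := m) L) ((chartAt (Fin m → ℂ) x₀).symm y)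
        ((chartAt (Fin m → ℂ) x₀).symm y)) •
      (-∑ l, b.equivFun s (i.succAbove l) • fderiv ℂ (fun y => chartRatio b i x₀ y l) y) := by
  set κ := chartAt (Fin m → ℂ) x₀ with hκ
  set z := κ.symm y with hz
  have hb := FiberBundle.mem_baseSet_trivializationAt' (F := ℂ) (E := L) z
  have hψ := contMDiffAt_chart_symm hy
  have hd : MDifferentiableAt 𝓘(ℂ, Fin m → ℂ) 𝓘(ℂ, Fin m → ℂ) κ.symm y :=
    hψ.mdifferentiableAt (by simp)
  have hcomp (t : HolSection (m := m) L) :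
      ContDiffAt ℂ ω (fun w => localRep t z (κ.symm w)) y :=
    contMDiffAt_iff_contDiffAt.1 ((contMDiffAt_localRep t hb).comp y hψ)
  have h1 : (sectionDeriv (s : HolSection (m := m) L) z).comp
      (mfderiv 𝓘(ℂ, Fin m → ℂ) 𝓘(ℂ, Fin m → ℂ) κ.symm y : (Fin m → ℂ) →L[ℂ] (Fin m → ℂ)) =
      fderiv ℂ (fun w => localRep (s : HolSection (m := m) L) z (κ.symm w)) y := by
    rw [← mfderiv_eq_fderiv]
    exact (mfderiv_comp y ((contMDiffAt_localRep _ hb).mdifferentiableAt (by simp)) hd).symm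
  have h2 : (fun w => localRep (s : HolSection (m := m) L) z (κ.symm w)) =ᶠ[𝓝 y] fun w =>
      localRep (b i : HolSection (m := m) L) z (κ.symm w) *
        (b.equivFun s i + ∑ l, b.equivFun s (i.succAbove l) * chartRatio b i x₀ w l) := by
    filter_upwards [hψ.continuousAt ((trivializationAt ℂ L z).open_baseSet.mem_nhds hb),
      hψ.continuousAt ((isOpen_ne_zero _).mem_nhds hi)] with w hw hw'
    exact localRep_eq_mul s hw hw'
  have hR (l) : HasFDerivAt (fun y => chartRatio b i x₀ y l)
      (fderiv ℂ (fun y => chartRatio b i x₀ y l) y) y :=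
    ((contDiffAt_pi.1 (contDiffAt_chartRatio hy hi) l).differentiableAt (by simp)).hasFDerivAt
  have h3 : HasFDerivAt (fun w => b.equivFun s i +
      ∑ l, b.equivFun s (i.succAbove l) * chartRatio b i x₀ w l)
      (∑ l, b.equivFun s (i.succAbove l) • fderiv ℂ (fun y => chartRatio b i x₀ y l) y) y :=
    (HasFDerivAt.fun_sum fun l _ => (hR l).const_mul _).const_add _
  have h4 : HasFDerivAt (fun w => localRep (b i : HolSection (m := m) L) z (κ.symm w)) _ y :=
    ((hcomp (b i)).differentiableAt (by simp)).hasFDerivAt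
  have h5 : b.equivFun s i + ∑ l, b.equivFun s (i.succAbove l) * chartRatio b i x₀ y l = 0 := by
    rw [← (section_eq_zero_iff s hi).1 hs]
    exact neg_add_cancel _
  refine h1.trans (h2.fderiv_eq.trans ((h4.fun_mul h3).fderiv.trans ?_))
  have h6 (A B : (Fin m → ℂ) →L[ℂ] ℂ) (t : ℂ) : t • A + (0 : ℂ) • B = (-t) • (-A) := by
    ext v; simp
  rw [h5]
  exact h6 _ _ _

end SingleSection

/-! ### The zero equations of a tuple of sections -/

section Tuple

variable {m : ℕ} {M : Type*} [TopologicalSpace M] [ChartedSpace (Fin m → ℂ) M]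
  {k : ℕ} {L : Fin k → M → Type*} [∀ j x, TopologicalSpace (L j x)]
  [∀ j, TopologicalSpace (TotalSpace ℂ (L j))]
  [∀ j x, AddCommGroup (L j x)] [∀ j x, Module ℂ (L j x)] [∀ j, FiberBundle ℂ (L j)]
  [∀ j, VectorBundle ℂ ℂ (L j)]
  {S : ∀ j, Submodule ℂ (HolSection (m := m) (L j))} {n : Fin k → ℕ}
  {b : ∀ j, Module.Basis (Fin (n j + 1)) ℂ (S j)} {l : ∀ j, Fin (n j + 1)}

variable (b l) in
/-- The coefficient functions of the zero equations, in the chart at `x₀`. -/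
def chartCoeff (x₀ : M) (j : Fin k) : (Fin m → ℂ) → Fin (n j) → ℂ := chartRatio (b j) (l j) x₀

variable (b l) in
/-- The domain of the chart at `x₀` on which the distinguished sections do not vanish. -/
def coeffDomain (x₀ : M) : Set (Fin m → ℂ) :=
  {y | y ∈ (chartAt (Fin m → ℂ) x₀).target ∧
    ∀ j, (b j (l j) : HolSection (m := m) (L j)) ((chartAt (Fin m → ℂ) x₀).symm y) ≠ 0}

lemma mem_zeroSet_iff (s : ∀ j, S j) {x₀ : M} {y : Fin m → ℂ} (hy : y ∈ coeffDomain b l x₀) :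
    (chartAt (Fin m → ℂ) x₀).symm y ∈ zeroSet (fun j => (s j : HolSection (m := m) (L j))) ↔
      graphMap (chartCoeff b l x₀) (y, (splitCoeff b l s).1) = (splitCoeff b l s).2 := by
  rw [funext_iff]
  exact forall_congr' fun j => section_eq_zero_iff (s j) (hy.2 j)

variable [∀ j, ContMDiffVectorBundle ω ℂ (L j) 𝓘(ℂ, Fin m → ℂ)]

lemma isOpen_coeffDomain (x₀ : M) : IsOpen (coeffDomain b l x₀) := by
  have h1 : coeffDomain b l x₀ = (chartAt (Fin m → ℂ) x₀).target ∩
      (chartAt (Fin m → ℂ) x₀).symm ⁻¹'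
        ⋂ j, {z | (b j (l j) : HolSection (m := m) (L j)) z ≠ 0} := by
    ext y
    simp [coeffDomain]
  rw [h1]
  exact (chartAt (Fin m → ℂ) x₀).isOpen_inter_preimage_symm
    (isOpen_iInter_of_finite fun j => isOpen_ne_zero _)

variable [IsManifold 𝓘(ℂ, Fin m → ℂ) ω M]

lemma contDiffOn_chartCoeff (x₀ : M) (j : Fin k) :
    ContDiffOn ℂ ω (chartCoeff b l x₀ j) (coeffDomain b l x₀) :=
  fun _ hy => (contDiffAt_chartRatio hy.1 (hy.2 j)).contDiffWithinAt

/-- Regular zeros correspond exactly to the points where the incidence variety projects submersively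
to the coefficients, hence to the domains of the charts of the graph. -/
lemma mem_regularZeros_iff (s : ∀ j, S j) {x₀ : M} {y : Fin m → ℂ}
    (hy : y ∈ coeffDomain b l x₀) :
    (chartAt (Fin m → ℂ) x₀).symm y ∈
        regularZeros (fun j => (s j : HolSection (m := m) (L j))) ↔
      graphMap (chartCoeff b l x₀) (y, (splitCoeff b l s).1) = (splitCoeff b l s).2 ∧
      Function.Surjective
        (ContinuousLinearMap.pi (graphDeriv (chartCoeff b l x₀) y (splitCoeff b l s).1)) := by
  rw [← mem_zeroSet_iff s hy]
  refine and_congr_right fun hs => ?_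
  rw [linearIndependent_iff_surjective_pi]
  refine surjective_pi_iff_of_comp
    (T := (mfderiv 𝓘(ℂ, Fin m → ℂ) 𝓘(ℂ, Fin m → ℂ) (chartAt (Fin m → ℂ) x₀).symm y :
        (Fin m → ℂ) →L[ℂ] (Fin m → ℂ)))
    ((mdifferentiable_chart_complex x₀).symm.mfderiv_surjective hy.1) (u := fun j =>
      -localRep (b j (l j) : HolSection (m := m) (L j)) ((chartAt (Fin m → ℂ) x₀).symm y)
        ((chartAt (Fin m → ℂ) x₀).symm y)) (fun j => ?_) fun j =>
      sectionDeriv_comp (s j) hy.1 (hy.2 j) (hs j)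
  refine neg_ne_zero.2 fun h => hy.2 j ((localRep_eq_zero_iff _ ?_).1 h)
  exact FiberBundle.mem_baseSet_trivializationAt' _

lemma ae_zeroSet_subset_regularZeros_chart (x₀ : M) (l : ∀ j, Fin (n j + 1)) :
    ∀ᵐ s ∂(Measure.pi fun j => gaussianMeasure (b j)), ∀ y ∈ coeffDomain b l x₀,
      (chartAt (Fin m → ℂ) x₀).symm y ∈ zeroSet (fun j => (s j : HolSection (m := m) (L j))) →
      (chartAt (Fin m → ℂ) x₀).symm y ∈
        regularZeros (fun j => (s j : HolSection (m := m) (L j))) := by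
  have h1 := (measurePreserving_splitCoeff b l).quasiMeasurePreserving.ae
    (ae_surjective_graphDeriv (isOpen_coeffDomain (b := b) (l := l) x₀)
      (contDiffOn_chartCoeff x₀))
  filter_upwards [h1] with s hs y hy hz
  have h2 := (mem_zeroSet_iff s hy).1 hz
  exact (mem_regularZeros_iff s hy).2 ⟨h2, hs y hy h2⟩

end Tuple

/-! ### Expectation of a series of random integrals -/

section RandomSum

/-- Fubini's theorem for a series of functions with summable `L¹` norms. -/
lemma hasSum_integral_slices {Ω Q ι F : Type*} [MeasurableSpace Ω] [MeasurableSpace Q] [Countable ι]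
    [NormedAddCommGroup F] [NormedSpace ℝ F] [CompleteSpace F]
    {P : Measure Ω} {μ : Measure Q} [SFinite P] [SFinite μ] {G : ι → Ω × Q → F}
    (hG : ∀ i, Integrable (G i) (P.prod μ)) (hs : Summable fun i => ∫ x, ‖G i x‖ ∂(P.prod μ)) :
    (∀ᵐ s ∂P, (∀ i, Integrable (fun w => G i (s, w)) μ) ∧
      (Summable fun i => ∫ w, ‖G i (s, w)‖ ∂μ) ∧
      HasSum (fun i => ∫ w, G i (s, w) ∂μ) (∑' i, ∫ w, G i (s, w) ∂μ)) ∧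
    Integrable (fun s => ∑' i, ∫ w, G i (s, w) ∂μ) P ∧
    HasSum (fun i => ∫ x, G i x ∂(P.prod μ)) (∫ s, ∑' i, ∫ w, G i (s, w) ∂μ ∂P) := by
  have hf (i) : Integrable (fun s => ∫ w, ‖G i (s, w)‖ ∂μ) P := (hG i).norm.integral_prod_left
  have hfint (i) : ∫ s, ∫ w, ‖G i (s, w)‖ ∂μ ∂P = ∫ x, ‖G i x‖ ∂(P.prod μ) :=
    (integral_prod _ (hG i).norm).symm
  have hf0 (i s) : 0 ≤ ∫ w, ‖G i (s, w)‖ ∂μ := integral_nonneg fun _ => norm_nonneg _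
  -- Finiteness of the total L¹ norm gives both the almost sure summability of the slices and the
  -- integrability of the sum.
  have hlint : ∑' i, ∫⁻ s, ‖∫ w, ‖G i (s, w)‖ ∂μ‖ₑ ∂P ≠ ⊤ := by
    have h1 (i) : ∫⁻ s, ‖∫ w, ‖G i (s, w)‖ ∂μ‖ₑ ∂P =
        ‖∫ x, ‖G i x‖ ∂(P.prod μ)‖ₑ := by
      rw [← hfint, Real.enorm_of_nonneg (integral_nonneg (hf0 i)),
        ofReal_integral_eq_lintegral_ofReal (hf i) (.of_forall (hf0 i))]
      exact lintegral_congr fun s => Real.enorm_of_nonneg (hf0 i s)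
    rw [funext h1]
    exact tsum_enorm_ne_top_iff_summable_norm.2 hs.norm
  have hsum : ∀ᵐ s ∂P, Summable fun i => ∫ w, ‖G i (s, w)‖ ∂μ := by
    have h1 := summable_norm_of_tsum_eLpNorm_ne_top (μ := P) (p := 1) le_rfl
      (f := fun i s => ∫ w, ‖G i (s, w)‖ ∂μ) (fun i => (hf i).1)
      (by simpa only [eLpNorm_one_eq_lintegral_enorm] using hlint)
    filter_upwards [h1] with s hs
    simpa only [Real.norm_of_nonneg (hf0 _ s)] using hs
  have hX (s) (h : Summable fun i => ∫ w, ‖G i (s, w)‖ ∂μ) :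
      Summable fun i => ∫ w, G i (s, w) ∂μ :=
    h.of_norm_bounded fun i => norm_integral_le_integral_norm _
  have hsl (i) : Integrable (fun s => ∫ w, G i (s, w) ∂μ) P := (hG i).integral_prod_left
  have hle (i s) : ‖∫ w, G i (s, w) ∂μ‖ₑ ≤ ‖∫ w, ‖G i (s, w)‖ ∂μ‖ₑ := by
    refine enorm_le_iff_norm_le.2 ?_
    rw [Real.norm_of_nonneg (hf0 i s)]
    exact norm_integral_le_integral_norm _
  refine ⟨?_, ⟨?_, ?_⟩, ?_⟩
  · filter_upwards [ae_all_iff.2 fun i => (hG i).prod_right_ae, hsum] with s h1 h2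
    exact ⟨h1, h2, (hX s h2).hasSum⟩
  -- The sum is almost everywhere the limit of its finite partial sums, along finite subsets of a
  -- countable index set.
  · refine aestronglyMeasurable_of_tendsto_ae Filter.atTop
      (f := fun (t : Finset ι) s => ∑ i ∈ t, ∫ w, G i (s, w) ∂μ) (fun t => ?_) ?_
    · exact (integrable_finsetSum t fun i _ => hsl i).1
    · filter_upwards [hsum] with s h2
      exact (hX s h2).hasSum
  · have h1 : ∫⁻ s, ‖∑' i, ∫ w, G i (s, w) ∂μ‖ₑ ∂P ≤
        ∫⁻ s, ∑' i, ‖∫ w, ‖G i (s, w)‖ ∂μ‖ₑ ∂P :=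
      lintegral_mono fun s => enorm_tsum_le_tsum_enorm.trans (ENNReal.tsum_le_tsum fun i => hle i s)
    rw [lintegral_tsum fun i => (hf i).1.enorm] at h1
    exact h1.trans_lt (lt_top_iff_ne_top.2 hlint)
  · have h1 := hasSum_integral_of_summable_integral_norm hsl
      (Summable.of_nonneg_of_le (fun i => integral_nonneg fun s => norm_nonneg _) (fun i => ?_) hs)
    · simpa only [← integral_prod _ (hG _)] using h1
    · rw [← hfint]
      exact integral_mono (hsl i).norm (hf i) fun s => norm_integral_le_integral_norm _

end RandomSum

/-! ### Cutting the open set into chart pieces -/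

section Cover

variable {m : ℕ} {M : Type*} [TopologicalSpace M] [ChartedSpace (Fin m → ℂ) M]
  {k : ℕ} {L : Fin k → M → Type*} [∀ j x, TopologicalSpace (L j x)]
  [∀ j, TopologicalSpace (TotalSpace ℂ (L j))]
  [∀ j x, AddCommGroup (L j x)] [∀ j x, Module ℂ (L j x)] [∀ j, FiberBundle ℂ (L j)]
  [∀ j, VectorBundle ℂ ℂ (L j)]
  {S : ∀ j, Submodule ℂ (HolSection (m := m) (L j))} {n : Fin k → ℕ}
  (b : ∀ j, Module.Basis (Fin (n j + 1)) ℂ (S j))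

/-- A decomposition of `U` into countably many pieces, each of them contained in a compact subset
of a chart on which suitable basis sections do not vanish. -/
structure CoverPieces (U : Set M) where
  /-- the centres of the charts -/
  center : ℕ → M
  /-- the indices of the distinguished basis sections -/
  idx : ℕ → ∀ j, Fin (n j + 1)
  /-- the pieces, in the charts -/
  base : ℕ → Set (Fin m → ℂ)
  /-- compact sets containing them -/
  comp : ℕ → Set (Fin m → ℂ)
  measurableSet_base : ∀ r, MeasurableSet (base r)
  base_subset : ∀ r, base r ⊆ comp r
  isCompact_comp : ∀ r, IsCompact (comp r)
  comp_subset : ∀ r, comp r ⊆ coeffDomain b (idx r) (center r)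
  disjoint : Pairwise fun r r' =>
    Disjoint ((chartAt (Fin m → ℂ) (center r)).symm '' base r)
      ((chartAt (Fin m → ℂ) (center r')).symm '' base r')
  iUnion_eq : ⋃ r, (chartAt (Fin m → ℂ) (center r)).symm '' base r = U
  eventually_disjoint : ∀ K ⊆ U, IsCompact K → ∃ R, ∀ r ≥ R,
    Disjoint ((chartAt (Fin m → ℂ) (center r)).symm '' base r) K

variable {b} in
-- The compact set, available by local compactness of ℂ^m, is there to make continuous coefficient
-- functions integrable on the piece.
lemma exists_compact_piece [∀ j, ContMDiffVectorBundle ω ℂ (L j) 𝓘(ℂ, Fin m → ℂ)] {U : Set M}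
    (hU : IsOpen U) (hbase : ∀ j, ∀ z ∈ U, ∃ i, (b j i : HolSection (m := m) (L j)) z ≠ 0) {x : M}
    (hx : x ∈ U) : ∃ (l : ∀ j, Fin (n j + 1)) (V C : Set (Fin m → ℂ)), IsOpen V ∧ V ⊆ C ∧
      IsCompact C ∧ C ⊆ coeffDomain b l x ∧
      (chartAt (Fin m → ℂ) x).symm '' V ⊆ U ∧ x ∈ (chartAt (Fin m → ℂ) x).symm '' V := by
  choose l hl using fun j => hbase j x hx
  set κ := chartAt (Fin m → ℂ) x
  have hxs : x ∈ κ.source := mem_chart_source _ x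
  have hxy : κ.symm (κ x) = x := κ.left_inv hxs
  have hopen : IsOpen (coeffDomain b l x ∩ (κ.target ∩ κ.symm ⁻¹' U)) :=
    (isOpen_coeffDomain x).inter (κ.isOpen_inter_preimage_symm hU)
  have hmem : κ x ∈ coeffDomain b l x ∩ (κ.target ∩ κ.symm ⁻¹' U) := by
    refine ⟨⟨κ.map_source hxs, fun j => ?_⟩, κ.map_source hxs, ?_⟩
    · change (b j (l j) : HolSection (m := m) (L j)) (κ.symm (κ x)) ≠ 0
      rw [hxy]; exact hl j
    · change κ.symm (κ x) ∈ U
      rwa [hxy]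
  obtain ⟨C, hC, hxC, hCs⟩ := exists_compact_subset hopen hmem
  refine ⟨l, interior C, C, isOpen_interior, interior_subset, hC,
    hCs.trans Set.inter_subset_left, ?_, ⟨κ x, hxC, hxy⟩⟩
  rintro _ ⟨y, hy, rfl⟩
  exact (hCs (interior_subset hy)).2.2

lemma nonempty_coverPieces [SecondCountableTopology M]
    [∀ j, ContMDiffVectorBundle ω ℂ (L j) 𝓘(ℂ, Fin m → ℂ)] {U : Set M}
    (hU : IsOpen U) (hne : U.Nonempty)
    (hbase : ∀ j, ∀ z ∈ U, ∃ i, (b j i : HolSection (m := m) (L j)) z ≠ 0) :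
    Nonempty (CoverPieces b U) := by
  choose! l V C hV hVC hC hCs hVU hxV using fun x (hx : x ∈ U) =>
    exists_compact_piece (b := b) hU hbase hx
  let N : M → Set M := fun x => (chartAt (Fin m → ℂ) x).symm '' V x
  have hVt : ∀ x ∈ U, V x ⊆ (chartAt (Fin m → ℂ) x).target := fun x hx y hy =>
    (hCs x hx (hVC x hx hy)).1
  have hN : ∀ x ∈ U, IsOpen (N x) := fun x hx =>
    (chartAt (Fin m → ℂ) x).isOpen_image_symm_of_subset_target (hV x hx) (hVt x hx)
  obtain ⟨t, htU, htc, ht⟩ := TopologicalSpace.countable_cover_nhdsWithin (f := N) (s := U)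
    fun x hx => mem_nhdsWithin_of_mem_nhds ((hN x hx).mem_nhds (hxV x hx))
  have htne : t.Nonempty := by
    obtain ⟨x, hx⟩ := hne
    obtain ⟨y, hy, -⟩ := Set.mem_iUnion₂.1 (ht hx)
    exact ⟨y, hy⟩
  obtain ⟨c, rfl⟩ := htc.exists_eq_range htne
  have hcU (r) : c r ∈ U := htU ⟨r, rfl⟩
  have hcov : U = ⋃ r, N (c r) := by
    refine Set.Subset.antisymm (fun x hx => ?_) (Set.iUnion_subset fun r => hVU _ (hcU r))
    obtain ⟨y, ⟨r, rfl⟩, hy⟩ := Set.mem_iUnion₂.1 (ht hx)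
    exact Set.mem_iUnion.2 ⟨r, hy⟩
  -- The cover is made disjoint by removing the earlier neighbourhoods, expressed in the coordinates
  -- of each chart.
  let B : ℕ → Set (Fin m → ℂ) := fun r =>
    V (c r) \ ((chartAt (Fin m → ℂ) (c r)).target ∩
      (chartAt (Fin m → ℂ) (c r)).symm ⁻¹' ⋃ i < r, N (c i))
  have himg (r) : (chartAt (Fin m → ℂ) (c r)).symm '' B r =
      disjointed (fun r => N (c r)) r := by
    rw [disjointed_eq_inter_compl]
    ext x
    simp only [Set.mem_inter_iff, Set.mem_iInter, Set.mem_compl_iff]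
    constructor
    · rintro ⟨y, hy, rfl⟩
      exact ⟨⟨y, hy.1, rfl⟩, fun i hi hy' =>
        hy.2 ⟨hVt _ (hcU r) hy.1, Set.mem_iUnion₂.2 ⟨i, hi, hy'⟩⟩⟩
    · rintro ⟨⟨y, hy, rfl⟩, h2⟩
      refine ⟨y, ⟨hy, fun h3 => ?_⟩, rfl⟩
      obtain ⟨i, hi, hy'⟩ := Set.mem_iUnion₂.1 h3.2
      exact h2 i hi hy'
  refine ⟨⟨c, fun r => l (c r), B, fun r => C (c r), fun r => ?_, fun r => ?_, fun r => hC _ (hcU r),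
    fun r => hCs _ (hcU r), ?_, ?_, ?_⟩⟩
  · refine (hV _ (hcU r)).measurableSet.diff (IsOpen.measurableSet ?_)
    exact (chartAt (Fin m → ℂ) (c r)).isOpen_inter_preimage_symm
      (isOpen_biUnion fun i _ => hN _ (hcU i))
  · exact Set.sdiff_subset.trans (hVC _ (hcU r))
  · intro r r' h
    rw [himg, himg]
    exact disjoint_disjointed _ h
  · simp only [himg]
    rw [iUnion_disjointed, hcov]
  · intro K hK hKc
    -- Finitely many of the neighbourhoods cover `K`, and a later disjointed piece avoids all of
    -- them.
    obtain ⟨T, hT⟩ := hKc.elim_finite_subcover (fun r => N (c r)) (fun r => hN _ (hcU r))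
      (hcov ▸ hK)
    obtain ⟨R, hR⟩ := T.exists_nat_subset_range
    refine ⟨R, fun r hr => ?_⟩
    rw [himg, disjointed_eq_inter_compl]
    refine Set.disjoint_left.2 fun x hx hxK => ?_
    obtain ⟨i, hi, hxi⟩ := Set.mem_iUnion₂.1 (hT hxK)
    exact Set.mem_iInter₂.1 hx.2 i ((Finset.mem_range.1 (hR hi)).trans_le hr) hxi

end Cover

/-! ### Parametrized pieces of the manifold and of the zero sets -/

section Patches

variable {m : ℕ} {M : Type*} [TopologicalSpace M] [ChartedSpace (Fin m → ℂ) M]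
  {k : ℕ} {L : Fin k → M → Type*} [∀ j x, TopologicalSpace (L j x)]
  [∀ j, TopologicalSpace (TotalSpace ℂ (L j))]
  [∀ j x, AddCommGroup (L j x)] [∀ j x, Module ℂ (L j x)] [∀ j, FiberBundle ℂ (L j)]
  [∀ j, VectorBundle ℂ ℂ (L j)]
  {S : ∀ j, Submodule ℂ (HolSection (m := m) (L j))} {n : Fin k → ℕ}
  {b : ∀ j, Module.Basis (Fin (n j + 1)) ℂ (S j)} {l : ∀ j, Fin (n j + 1)}

/-- A form in the chart at `x₀`. -/
def chartForm {q : ℕ} (η : DForm m M q) (x₀ : M) : (Fin m → ℂ) → Alt m q :=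
  pullback (p := m) (chartAt (Fin m → ℂ) x₀).symm η

lemma continuousOn_chartForm {q : ℕ} {η : DForm m M q} (hη : SmoothFormOn η Set.univ) (x₀ : M)
    (v : Fin q → Fin m → ℂ) :
    ContinuousOn (fun z => chartForm η x₀ z v) (chartAt (Fin m → ℂ) x₀).target := by
  have h1 := (hη x₀ v).continuousOn
  rw [Set.preimage_univ, Set.inter_univ] at h1
  exact h1

lemma chartForm_eq_zero {q : ℕ} {η : DForm m M q} {x₀ : M} {y : Fin m → ℂ}
    (h : η ((chartAt (Fin m → ℂ) x₀).symm y) = 0) : chartForm η x₀ y = 0 := by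
  rw [chartForm, pullback, h]
  rfl

/-- The functions which are continuous on a set. -/
def continuousOnSubalgebra {X : Type*} [TopologicalSpace X] (s : Set X) : Subalgebra ℂ (X → ℂ) where
  carrier := {f | ContinuousOn f s}
  mul_mem' hf hg := ContinuousOn.mul hf hg
  add_mem' hf hg := ContinuousOn.add hf hg
  algebraMap_mem' _ := continuousOn_const

lemma continuousOn_wedgeCoeff_coeffDeriv (hk : k ≤ m) {W : Set (Fin m → ℂ)} (hW : IsOpen W)
    {g : ∀ j, (Fin m → ℂ) → Fin (n j) → ℂ} (hg : ∀ j, ContDiffOn ℂ ω (g j) W)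
    {φ : (Fin m → ℂ) → Alt m (2 * (m - k))} (hφ : ∀ v, ContinuousOn (fun z => φ z v) W)
    (r : ∀ j, Fin (n j) × Fin (n j)) :
    ContinuousOn (fun z => wedgeCoeff hk (φ z)
      (fun j => tauForm (coeffDeriv g z j (r j).1) (coeffDeriv g z j (r j).2))) W := by
  refine wedgeCoeff_induction (continuousOnSubalgebra W) hk (fun j v => ?_) hφ
  have h1 (l : Fin (n j)) (v : Fin m → ℂ) : ContinuousOn (fun z => coeffDeriv g z j l v) W :=
    (contDiffOn_fderiv_of_isOpen hW (contDiffOn_pi.1 (hg j) l)).continuousOn.clm_apply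
      continuousOn_const
  simp only [tauForm_apply]
  exact continuousOn_const.mul (((h1 _ _).mul (Complex.continuous_conj.comp_continuousOn (h1 _ _))).sub
    ((h1 _ _).mul (Complex.continuous_conj.comp_continuousOn (h1 _ _))))

lemma hasIntegralOver_empty (p : ℕ) (η : DForm m M (2 * p)) : HasIntegralOver p ∅ η 0 :=
  ⟨Empty, inferInstance, Empty.elim, fun i => i.elim, by simp, fun i => i.elim, .of_finite,
    hasSum_empty⟩

lemma wedgeCoeff_zero_left (hk : k ≤ m) (α : Fin k → Alt m 2) :
    wedgeCoeff hk (0 : Alt m (2 * (m - k))) α = 0 := by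
  change wedgeTop hk (wedgeAll k α) 0 (stdFrame m) = 0
  have := wedge_smul_right (0 : ℂ) (wedgeAll k α) (0 : Alt m (2 * (m - k)))
  rw [zero_smul, zero_smul] at this
  rw [wedgeTop, this]
  rfl

variable [IsManifold 𝓘(ℂ, Fin m → ℂ) ω M] [∀ j, ContMDiffVectorBundle ω ℂ (L j) 𝓘(ℂ, Fin m → ℂ)]

/-- A piece of `M` in a chart. -/
def chartPatch (x₀ : M) (B : Set (Fin m → ℂ)) (hB : B ⊆ (chartAt (Fin m → ℂ) x₀).target)
    (hBm : MeasurableSet B) : Patch m M m where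
  map := (chartAt (Fin m → ℂ) x₀).symm
  dom := (chartAt (Fin m → ℂ) x₀).target
  isOpen_dom := (chartAt (Fin m → ℂ) x₀).open_target
  holo := contMDiffOn_chart_symm
  injOn := (chartAt (Fin m → ℂ) x₀).symm.injOn
  immersion _ hw := injective_realDeriv_chart_symm hw
  carrier := B
  carrier_subset := hB
  measurableSet_carrier := hBm

/-- Pull-back commutes with the wedge product, so in the chart the form reduces to the local
potentials log(1 + |g|²). -/
lemma density_chartPatch (hk : k ≤ m) (h : ∀ j, HermitianMetric (m := m) (L j)) {x₀ : M}
    {B : Set (Fin m → ℂ)} (hB : B ⊆ (chartAt (Fin m → ℂ) x₀).target) (hBm : MeasurableSet B)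
    (φ : DForm m M (2 * (m - k))) {y : Fin m → ℂ} (hy : y ∈ coeffDomain b l x₀) :
    (chartPatch x₀ B hB hBm).density
        (fun x => wedgeTop hk (wedgeAll k fun j => expectedForm (h j) (b j) x) (φ x)) y =
      wedgeCoeff hk (chartForm φ x₀ y)
        fun j => ddc (fun y => Real.log (1 + ∑ i, ‖chartCoeff b l x₀ j y i‖ ^ 2)) y := by
  have h1 (j : Fin k) := pullback_expectedForm (h j) hy.1 (hy.2 j)
  change ((wedgeTop hk (wedgeAll k fun j => expectedForm (h j) (b j) _) (φ _)).compLinearMap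
    (realDeriv (m := m) (p := m) (chartAt (Fin m → ℂ) x₀).symm y).toLinearMap) (stdFrame m) = _
  rw [wedgeTop_compLinearMap, wedgeAll_compLinearMap]
  change _ = wedgeTop hk (wedgeAll k fun j => _) (chartForm φ x₀ y) (stdFrame m)
  simp only [chartCoeff, ← h1]
  rfl

/-- A piece of the zero set. -/
def zeroPatch (hk : k ≤ m) {x₀ : M}
    (c : GraphChart (chartCoeff b l x₀) (coeffDomain b l x₀))
    (D : Set ((Fin m → ℂ) × (∀ j, Fin (n j) → ℂ))) (hD : MeasurableSet D)
    (p : (∀ j, Fin (n j) → ℂ) × (Fin k → ℂ)) : Patch m M (m - k) where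
  map w := (chartAt (Fin m → ℂ) x₀).symm (c.inv (p.1, p.2, w))
  dom := {w | (p.1, p.2, w) ∈ c.tgt}
  isOpen_dom := c.isOpen_tgt.preimage (by fun_prop)
  holo := by
    have h1 : ContDiffOn ℂ ω (fun w => c.inv (p.1, p.2, w)) {w | (p.1, p.2, w) ∈ c.tgt} :=
      c.contDiffOn_inv.comp (contDiffOn_const.prodMk (contDiffOn_const.prodMk contDiffOn_id))
        fun w hw => hw
    exact (contMDiffOn_chart_symm (n := ω)).comp h1.contMDiffOn fun w hw =>
      (c.src_subset _ (c.inv_mem _ hw)).1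
  injOn w hw w' hw' h := by
    have h1 := (chartAt (Fin m → ℂ) x₀).symm.injOn (c.src_subset _ (c.inv_mem _ hw)).1
      (c.src_subset _ (c.inv_mem _ hw')).1 h
    exact (c.proj_inv _ hw).symm.trans ((congrArg c.proj h1).trans (c.proj_inv _ hw'))
  immersion w hw := by
    have ht : (p.1, p.2, w) ∈ c.tgt := hw
    have h1 := (c.hasFDerivAt_inv_slice ht).restrictScalars ℝ
    have h2 := (c.src_subset _ (c.inv_mem _ hw)).1
    rw [realDeriv_chart_symm_comp (f := fun w => c.inv (p.1, p.2, w)) h2 h1.differentiableAt,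
      h1.fderiv]
    exact (injective_realDeriv_chart_symm h2).comp
      (c.injective_fderiv_inv hk (isOpen_coeffDomain x₀) (contDiffOn_chartCoeff x₀) ht)
  carrier := {w | (p.1, p.2, w) ∈ c.coords D}
  carrier_subset _ hw := hw.1
  measurableSet_carrier := by
    have h1 : Measurable fun w : Fin (m - k) → ℂ => (p.1, p.2, w) :=
      measurable_const.prodMk (measurable_const.prodMk measurable_id)
    exact h1 (c.measurableSet_coords hD)

/-- Identifies the geometric density of the zero set with the function integrated in the coarea
formula; the indicator absorbs the dependence of the carrier on the random coefficients. -/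
lemma indicator_density_zeroPatch (hk : k ≤ m) {x₀ : M}
    (c : GraphChart (chartCoeff b l x₀) (coeffDomain b l x₀))
    {D : Set ((Fin m → ℂ) × (∀ j, Fin (n j) → ℂ))} (hD : MeasurableSet D)
    (p : (∀ j, Fin (n j) → ℂ) × (Fin k → ℂ)) (η : DForm m M (2 * (m - k))) :
    (zeroPatch hk c D hD p).carrier.indicator ((zeroPatch hk c D hD p).density η) =
      fun w => c.pieceDens (chartForm η x₀) D (p, w) := by
  funext w
  by_cases hw : (p.1, p.2, w) ∈ c.coords D
  · have h1 := (c.hasFDerivAt_inv_slice hw.1).restrictScalars ℝ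
    have h2 := (c.src_subset _ (c.inv_mem _ hw.1)).1
    rw [Set.indicator_of_mem (show w ∈ (zeroPatch hk c D hD p).carrier from hw),
      GraphChart.pieceDens, Set.indicator_of_mem hw, GraphChart.dens, Patch.density]
    have h3 := pullback_chart_symm_comp η (f := fun w => c.inv (p.1, p.2, w)) h2
      h1.differentiableAt (stdFrame (m - k))
    rw [h1.fderiv] at h3
    exact h3
  · rw [Set.indicator_of_notMem (show w ∉ (zeroPatch hk c D hD p).carrier from hw),
      GraphChart.pieceDens, Set.indicator_of_notMem hw]

end Patches

/-! ### The expected zero current -/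

section Main

variable {m : ℕ} {M : Type*} [TopologicalSpace M] [ChartedSpace (Fin m → ℂ) M]
  {k : ℕ} {L : Fin k → M → Type*} [∀ j x, TopologicalSpace (L j x)]
  [∀ j, TopologicalSpace (TotalSpace ℂ (L j))]
  [∀ j x, AddCommGroup (L j x)] [∀ j x, Module ℂ (L j x)] [∀ j, FiberBundle ℂ (L j)]
  [∀ j, VectorBundle ℂ ℂ (L j)]
  {S : ∀ j, Submodule ℂ (HolSection (m := m) (L j))} {n : Fin k → ℕ}
  {b : ∀ j, Module.Basis (Fin (n j + 1)) ℂ (S j)}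

/-- Charts and pieces of the incidence variety over each piece of `U`. -/
abbrev IncidencePieces {U : Set M} (C : CoverPieces b U) : Type :=
  ∀ r, GraphPieces (chartCoeff b (C.idx r) (C.center r)) (coeffDomain b (C.idx r) (C.center r))
    (C.base r)

namespace IncidencePieces

variable {U : Set M} {C : CoverPieces b U} (Q : IncidencePieces C)

lemma mem_base_of_mem_piece {r i : ℕ} {y : Fin m → ℂ} {a : ∀ j, Fin (n j) → ℂ}
    (h : (y, a) ∈ (Q r).piece i) : y ∈ C.base r ∧ Function.Surjective (ContinuousLinearMap.pi
      (graphDeriv (chartCoeff b (C.idx r) (C.center r)) y a)) := by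
  have h1 : (y, a) ∈ ⋃ i, (Q r).piece i := Set.mem_iUnion.2 ⟨i, h⟩
  rw [(Q r).iUnion_piece] at h1
  exact h1

lemma mem_coeffDomain {r : ℕ} {y : Fin m → ℂ} (h : y ∈ C.base r) :
    y ∈ coeffDomain b (C.idx r) (C.center r) := C.comp_subset r (C.base_subset r h)

/-- The density of the zero set of `s` in a piece. -/
def zeroDensity (φ : DForm m M (2 * (m - k))) (q : ℕ × ℕ)
    (x : (∀ j, S j) × (Fin (m - k) → ℂ)) : ℂ :=
  ((Q q.1).chart q.2).pieceDens (chartForm φ (C.center q.1)) ((Q q.1).piece q.2)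
    (splitCoeff b (C.idx q.1) x.1, x.2)

lemma zeroDensity_eq_zero {φ : DForm m M (2 * (m - k))} {K : Set M} (hφ : ∀ x ∉ K, φ x = 0) {r : ℕ}
    (hr : Disjoint ((chartAt (Fin m → ℂ) (C.center r)).symm '' C.base r) K) (i : ℕ)
    (p : ((∀ j, Fin (n j) → ℂ) × (Fin k → ℂ)) × (Fin (m - k) → ℂ)) :
    ((Q r).chart i).pieceDens (chartForm φ (C.center r)) ((Q r).piece i) p = 0 := by
  rw [GraphChart.pieceDens]
  refine Set.indicator_apply_eq_zero.2 fun hp => ?_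
  have h1 := (Q.mem_base_of_mem_piece hp.2).1
  rw [GraphChart.dens, chartForm_eq_zero (hφ _ fun h => Set.disjoint_left.1 hr ⟨_, h1, rfl⟩ h)]
  rfl

variable [IsManifold 𝓘(ℂ, Fin m → ℂ) ω M]
  [∀ j, ContMDiffVectorBundle ω ℂ (L j) 𝓘(ℂ, Fin m → ℂ)]

lemma nonempty (C : CoverPieces b U) : Nonempty (IncidencePieces C) :=
  Classical.nonempty_pi.2 fun r => nonempty_graphPieces (isOpen_coeffDomain _)
    (contDiffOn_chartCoeff _) (C.measurableSet_base r) ((C.base_subset r).trans (C.comp_subset r))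

/-- The pieces of the zero set of `s` in `U`. -/
def patch (hk : k ≤ m) (s : ∀ j, S j) (q : ℕ × ℕ) : Patch m M (m - k) :=
  zeroPatch hk ((Q q.1).chart q.2) ((Q q.1).piece q.2) ((Q q.1).measurableSet_piece q.2)
    (splitCoeff b (C.idx q.1) s)

lemma mem_image_patch_iff (hk : k ≤ m) (s : ∀ j, S j) (q : ℕ × ℕ) (z : M) :
    z ∈ (Q.patch hk s q).map '' (Q.patch hk s q).carrier ↔
      ∃ y, (y, (splitCoeff b (C.idx q.1) s).1) ∈ (Q q.1).piece q.2 ∧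
        graphMap (chartCoeff b (C.idx q.1) (C.center q.1)) (y, (splitCoeff b (C.idx q.1) s).1) =
          (splitCoeff b (C.idx q.1) s).2 ∧
        (chartAt (Fin m → ℂ) (C.center q.1)).symm y = z := by
  constructor
  · rintro ⟨w, hw, rfl⟩
    exact ⟨_, hw.2, GraphChart.graphMap_inv _ _ hw.1, rfl⟩
  · rintro ⟨y, hy, hg, rfl⟩
    have h1 := (Q q.1).piece_subset q.2 hy
    have h2 := GraphChart.mem_tgt _ _ h1
    have h3 := GraphChart.inv_apply _ _ h1
    rw [hg] at h2 h3
    refine ⟨((Q q.1).chart q.2).proj y, ⟨h2, ?_⟩, ?_⟩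
    · rw [h3]
      exact hy
    · exact congrArg _ h3

lemma disjoint_patch (hk : k ≤ m) (s : ∀ j, S j) : Pairwise fun q q' =>
    Disjoint ((Q.patch hk s q).map '' (Q.patch hk s q).carrier)
      ((Q.patch hk s q').map '' (Q.patch hk s q').carrier) := by
  rintro ⟨r, i⟩ ⟨r', i'⟩ hne
  refine Set.disjoint_left.2 fun z hz hz' => ?_
  obtain ⟨y, hy, -, rfl⟩ := (Q.mem_image_patch_iff hk s _ _).1 hz
  obtain ⟨y', hy', -, hyy⟩ := (Q.mem_image_patch_iff hk s _ _).1 hz'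
  have hb := (Q.mem_base_of_mem_piece hy).1
  have hb' := (Q.mem_base_of_mem_piece hy').1
  by_cases hr : r = r'
  · subst hr
    have hi : i ≠ i' := fun h => hne (by rw [h])
    have : y' = y := (chartAt (Fin m → ℂ) (C.center r)).symm.injOn
      (mem_coeffDomain hb').1 (mem_coeffDomain hb).1 hyy
    subst this
    exact Set.disjoint_left.1 ((Q r).disjoint hi) hy hy'
  · exact Set.disjoint_left.1 (C.disjoint hr) ⟨y, hb, rfl⟩ ⟨y', hb', hyy⟩

/-- The pieces exhaust the submersive locus over `U`, and the slice of that locus belonging to `s`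
is the set of regular zeros, for every `s` and not only almost surely. -/
lemma iUnion_patch (hk : k ≤ m) (s : ∀ j, S j) :
    ⋃ q, (Q.patch hk s q).map '' (Q.patch hk s q).carrier =
      regularZeros (fun j => (s j : HolSection (m := m) (L j))) ∩ U := by
  ext z
  rw [Set.mem_iUnion]
  constructor
  · rintro ⟨q, hq⟩
    obtain ⟨y, hy, hg, rfl⟩ := (Q.mem_image_patch_iff hk s _ _).1 hq
    obtain ⟨hb, hs⟩ := Q.mem_base_of_mem_piece hy
    refine ⟨(mem_regularZeros_iff s (mem_coeffDomain hb)).2 ⟨hg, hs⟩, ?_⟩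
    exact C.iUnion_eq.subset (Set.mem_iUnion.2 ⟨q.1, y, hb, rfl⟩)
  · rintro ⟨hz, hzU⟩
    obtain ⟨r, y, hy, rfl⟩ := Set.mem_iUnion.1 (C.iUnion_eq.superset hzU)
    obtain ⟨hg, hs⟩ := (mem_regularZeros_iff s (mem_coeffDomain hy)).1 hz
    have h1 : (y, (splitCoeff b (C.idx r) s).1) ∈ ⋃ i, (Q r).piece i := by
      rw [(Q r).iUnion_piece]
      exact ⟨hy, hs⟩
    obtain ⟨i, hi⟩ := Set.mem_iUnion.1 h1
    exact ⟨(r, i), (Q.mem_image_patch_iff hk s _ _).2 ⟨y, hi, hg, rfl⟩⟩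

lemma indicator_density_patch (hk : k ≤ m) (s : ∀ j, S j) (q : ℕ × ℕ)
    (φ : DForm m M (2 * (m - k))) :
    (Q.patch hk s q).carrier.indicator ((Q.patch hk s q).density φ) =
      fun w => Q.zeroDensity φ q (s, w) :=
  indicator_density_zeroPatch hk _ _ _ _

/-- The current of integration over the zero set, given by a series of integrals. -/
lemma hasIntegralOver_regularZeros (hk : k ≤ m) (s : ∀ j, S j) (φ : DForm m M (2 * (m - k))) {X : ℂ}
    (h1 : ∀ q, Integrable fun w => Q.zeroDensity φ q (s, w))
    (h2 : Summable fun q => ∫ w, ‖Q.zeroDensity φ q (s, w)‖)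
    (h3 : HasSum (fun q => ∫ w, Q.zeroDensity φ q (s, w)) X) :
    HasIntegralOver (m - k)
      (regularZeros (fun j => (s j : HolSection (m := m) (L j))) ∩ U) φ X := by
  refine ⟨ℕ × ℕ, inferInstance, Q.patch hk s, Q.disjoint_patch hk s, Q.iUnion_patch hk s,
    fun q => ?_, ?_, ?_⟩
  · rw [← integrable_indicator_iff (Patch.measurableSet_carrier _), indicator_density_patch]
    exact h1 q
  · refine h2.congr fun q => ?_
    rw [← integral_indicator (Patch.measurableSet_carrier _)]
    congr 1
    funext w
    rw [← congrFun (Q.indicator_density_patch hk s q φ) w, norm_indicator_eq_indicator_norm]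
  · refine h3.congr_fun fun q => ?_
    rw [← integral_indicator (Patch.measurableSet_carrier _), indicator_density_patch]

end IncidencePieces

variable [IsManifold 𝓘(ℂ, Fin m → ℂ) ω M]
  [∀ j, ContMDiffVectorBundle ω ℂ (L j) 𝓘(ℂ, Fin m → ℂ)]

/-- The expected zero current of independent Gaussian random sections. -/
theorem expectedCurrentEq_regularZeros [SecondCountableTopology M] (hk : k ≤ m)
    (h : ∀ j, HermitianMetric (m := m) (L j)) {U : Set M} (hU : IsOpen U)
    (hbase : ∀ j, ∀ z ∈ U, ∃ i, (b j i : HolSection (m := m) (L j)) z ≠ 0) :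
    ExpectedCurrentEq (Measure.pi fun j => gaussianMeasure (b j))
      (fun s => regularZeros fun j => (s j : HolSection (m := m) (L j))) U hk
      (fun x => wedgeAll k fun j => expectedForm (h j) (b j) x) := by
  rintro φ ⟨hφs, K, hK, hKU, hφ0⟩
  -- The pieces are enumerated by ℕ with centres in `M`, which requires a point of `U`.
  rcases U.eq_empty_or_nonempty with rfl | hne
  · refine ⟨0, .of_forall fun s => ?_, integrable_zero _ _ _, ?_⟩
    · rw [Set.inter_empty]
      exact hasIntegralOver_empty _ _
    · simpa using hasIntegralOver_empty _ _
  obtain ⟨C⟩ := nonempty_coverPieces b hU hne hbase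
  obtain ⟨Q⟩ := IncidencePieces.nonempty C
  obtain ⟨R, hR⟩ := C.eventually_disjoint K hKU hK
  have hbW (r) : C.base r ⊆ coeffDomain b (C.idx r) (C.center r) :=
    (C.base_subset r).trans (C.comp_subset r)
  have hφc (r) (v) : ContinuousOn (fun z => chartForm φ (C.center r) z v)
      (coeffDomain b (C.idx r) (C.center r)) :=
    (continuousOn_chartForm hφs _ v).mono fun y hy => hy.1
  -- The integrability hypothesis of the local formula follows from continuity on the compact set
  -- that contains the piece.
  have hloc (r) := (Q r).hasSum_integral hk (isOpen_coeffDomain _) (contDiffOn_chartCoeff _)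
    (hφc r) (C.measurableSet_base r) (hbW r) fun t =>
      (((continuousOn_wedgeCoeff_coeffDeriv hk (isOpen_coeffDomain _) (contDiffOn_chartCoeff _)
        (hφc r) t).mono (C.comp_subset r)).integrableOn_compact (C.isCompact_comp r)).mono_set
        (C.base_subset r)
  let P : Measure (∀ j, S j) := Measure.pi fun j => gaussianMeasure (b j)
  have hmp (r) : MeasurePreserving (Prod.map (splitCoeff b (C.idx r)) id)
      (P.prod (volume : Measure (Fin (m - k) → ℂ)))
      (((restMeasure n).prod (stdComplexGaussian k)).prod volume) :=
    (measurePreserving_splitCoeff b (C.idx r)).prod (.id _)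
  have hGint (q) : Integrable (Q.zeroDensity φ q) (P.prod volume) :=
    (hmp q.1).integrable_comp_of_integrable ((hloc q.1).1 q.2)
  have hG (q) : ∫ x, Q.zeroDensity φ q x ∂(P.prod volume) =
      ∫ p, ((Q q.1).chart q.2).pieceDens (chartForm φ (C.center q.1)) ((Q q.1).piece q.2) p
        ∂(((restMeasure n).prod (stdComplexGaussian k)).prod volume) := by
    rw [← (hmp q.1).map_eq, integral_map (hmp q.1).aemeasurable
      (by rw [(hmp q.1).map_eq]; exact ((hloc q.1).1 q.2).1)]
    rfl
  have hGn (q) : ∫ x, ‖Q.zeroDensity φ q x‖ ∂(P.prod volume) =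
      ∫ p, ‖((Q q.1).chart q.2).pieceDens (chartForm φ (C.center q.1)) ((Q q.1).piece q.2) p‖
        ∂(((restMeasure n).prod (stdComplexGaussian k)).prod volume) := by
    rw [← (hmp q.1).map_eq, integral_map (hmp q.1).aemeasurable
      (by rw [(hmp q.1).map_eq]; exact ((hloc q.1).1 q.2).1.norm)]
    rfl
  have hGs : Summable fun q => ∫ x, ‖Q.zeroDensity φ q x‖ ∂(P.prod volume) := by
    simp only [hGn]
    -- For each piece of `U` the inner sum is controlled by the local formula; the outer sum is
    -- finite, as pieces with `r ≥ R` miss the support of `φ`.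
    refine (summable_prod_of_nonneg fun q => integral_nonneg fun x => norm_nonneg _).2
      ⟨fun r => (hloc r).2.1, summable_of_ne_finset_zero (s := Finset.range R) fun r hr => ?_⟩
    have hrR : R ≤ r := by simpa using hr
    simp [Q.zeroDensity_eq_zero hφ0 (hR r hrR)]
  obtain ⟨hae, hX, hsum⟩ := hasSum_integral_slices hGint hGs
  refine ⟨fun s => ∑' q, ∫ w, Q.zeroDensity φ q (s, w), ?_, hX, ?_⟩
  · filter_upwards [hae] with s hs
    exact Q.hasIntegralOver_regularZeros hk s φ hs.1 hs.2.1 hs.2.2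
  -- Regrouping by pieces of `U` turns the series of expectations into the integrals of the expected
  -- form over the chart pieces.
  · have hsum' := hsum.prod_fiberwise (g := fun r => ∫ z in C.base r,
        wedgeCoeff hk (chartForm φ (C.center r) z) fun j => ddc (fun z => Real.log
          (1 + ∑ i, ‖chartCoeff b (C.idx r) (C.center r) j z i‖ ^ 2)) z) fun r => by
      simp only [hG]
      exact (hloc r).2.2.1
    let T (r : ℕ) : Patch m M m := chartPatch (C.center r) (C.base r) (fun y hy => (hbW r hy).1)
      (C.measurableSet_base r)
    have hT (r) (y) (hy : y ∈ C.base r) := density_chartPatch hk h (fun y hy => (hbW r hy).1)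
      (C.measurableSet_base r) φ (hbW r hy)
    refine ⟨ℕ, inferInstance, T, C.disjoint, C.iUnion_eq, fun r => ?_, ?_, ?_⟩
    · exact (hloc r).2.2.2.congr_fun (fun y hy => (hT r y hy).symm) (C.measurableSet_base r)
    · refine summable_of_ne_finset_zero (s := Finset.range R) fun r hr => ?_
      have hrR : R ≤ r := by simpa using hr
      refine setIntegral_eq_zero_of_forall_eq_zero fun y hy => ?_
      rw [norm_eq_zero]
      refine (hT r y hy).trans ?_
      rw [chartForm_eq_zero (hφ0 _ fun h => Set.disjoint_left.1 (hR r hrR) ⟨y, hy, rfl⟩ h),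
        wedgeCoeff_zero_left]
    · refine hsum'.congr_fun fun r => ?_
      exact setIntegral_congr_fun (C.measurableSet_base r) fun y hy => hT r y hy

end Main

/-! ### Base points and the case of a single section -/

section BasePoints

variable {m : ℕ} {M : Type*} [TopologicalSpace M] [ChartedSpace (Fin m → ℂ) M]
  {L : M → Type*} [∀ x, TopologicalSpace (L x)] [TopologicalSpace (TotalSpace ℂ L)]
  [∀ x, AddCommGroup (L x)] [∀ x, Module ℂ (L x)] [FiberBundle ℂ L] [VectorBundle ℂ ℂ L]

/-- At a point that is not a base point, some member of the basis does not vanish. -/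
lemma exists_basis_apply_ne_zero {S : Submodule ℂ (HolSection (m := m) L)} {d : ℕ}
    (b : Module.Basis (Fin d) ℂ S) {z : M} (h : ∃ s ∈ S, s z ≠ 0) :
    ∃ i, (b i : HolSection (m := m) L) z ≠ 0 := by
  obtain ⟨s, hs, hz⟩ := h
  by_contra! hb
  have hm := FiberBundle.mem_baseSet_trivializationAt' (F := ℂ) (E := L) z
  refine hz ((localRep_eq_zero_iff s hm).1 ?_)
  have h1 : s = ∑ l, b.repr ⟨s, hs⟩ l • (b l : HolSection (m := m) L) := by
    have h2 := congrArg S.subtype (b.sum_repr ⟨s, hs⟩)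
    rw [map_sum] at h2
    exact h2.symm
  rw [h1, localRep_sum_smul _ _ hm]
  exact Finset.sum_eq_zero fun l _ => by rw [(localRep_eq_zero_iff _ hm).2 (hb l), mul_zero]

variable [IsManifold 𝓘(ℂ, Fin m → ℂ) ω M] [ContMDiffVectorBundle ω ℂ L 𝓘(ℂ, Fin m → ℂ)]

/-- The expected zero current of a Gaussian random section. -/
theorem expectedCurrentEq_regularZeros_single [SecondCountableTopology M] (hm : 1 ≤ m)
    (h : HermitianMetric (m := m) L) {S : Submodule ℂ (HolSection (m := m) L)} {n : ℕ}
    (b : Module.Basis (Fin (n + 1)) ℂ S) {U : Set M} (hU : IsOpen U)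
    (hbase : ∀ z ∈ U, ∃ i, (b i : HolSection (m := m) L) z ≠ 0) :
    ExpectedCurrentEq (gaussianMeasure b)
      (fun s => regularZeros fun _ : Fin 1 => (s : HolSection (m := m) L)) U
      (q := 1) hm (expectedForm h b) := by
  intro φ hφ
  obtain ⟨X, h1, h2, h3⟩ := expectedCurrentEq_regularZeros (k := 1) (L := fun _ => L)
    (S := fun _ => S) (n := fun _ => n) (b := fun _ => b) hm (fun _ => h) hU (fun _ => hbase) φ hφ
  -- A section is identified with a tuple of length one, and the result for `k = 1` is transported
  -- along this identification.
  have hmp : MeasurePreserving (fun (s : S) (_ : Fin 1) => s) (gaussianMeasure b)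
      (Measure.pi fun _ => gaussianMeasure b) :=
    (measurePreserving_funUnique (gaussianMeasure b) (Fin 1)).symm
      (MeasurableEquiv.funUnique (Fin 1) S)
  refine ⟨fun s => X fun _ => s, hmp.quasiMeasurePreserving.ae h1,
    hmp.integrable_comp_of_integrable h2, ?_⟩
  have h4 : ∫ s, X (fun _ => s) ∂(gaussianMeasure b) =
      ∫ s, X s ∂(Measure.pi fun _ => gaussianMeasure b) := by
    rw [← hmp.map_eq, integral_map hmp.aemeasurable (by rw [hmp.map_eq]; exact h2.1)]
  simp only [wedgeAll_one] at h3
  rw [h4]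
  exact h3

end BasePoints

/-! ### Almost sure regularity on the whole open set -/

section Regularity

variable {m : ℕ} {M : Type*} [TopologicalSpace M] [ChartedSpace (Fin m → ℂ) M]
  {k : ℕ} {L : Fin k → M → Type*} [∀ j x, TopologicalSpace (L j x)]
  [∀ j, TopologicalSpace (TotalSpace ℂ (L j))]
  [∀ j x, AddCommGroup (L j x)] [∀ j x, Module ℂ (L j x)] [∀ j, FiberBundle ℂ (L j)]
  [∀ j, VectorBundle ℂ ℂ (L j)]
  [IsManifold 𝓘(ℂ, Fin m → ℂ) ω M] [∀ j, ContMDiffVectorBundle ω ℂ (L j) 𝓘(ℂ, Fin m → ℂ)]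

/-- Bertini's theorem for Gaussian random sections. -/
theorem ae_zeroSet_inter_subset_regularZeros [SecondCountableTopology M]
    {S : ∀ j, Submodule ℂ (HolSection (m := m) (L j))} {n : Fin k → ℕ}
    (b : ∀ j, Module.Basis (Fin (n j + 1)) ℂ (S j)) {U : Set M} (hU : IsOpen U)
    (hbase : ∀ j, ∀ z ∈ U, ∃ i, (b j i : HolSection (m := m) (L j)) z ≠ 0) :
    ∀ᵐ s ∂(Measure.pi fun j => gaussianMeasure (b j)),
      zeroSet (fun j => (s j : HolSection (m := m) (L j))) ∩ U ⊆
        regularZeros fun j => (s j : HolSection (m := m) (L j)) := by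
  rcases U.eq_empty_or_nonempty with rfl | hne
  · exact .of_forall fun s => by simp
  obtain ⟨C⟩ := nonempty_coverPieces b hU hne hbase
  filter_upwards [ae_all_iff.2 fun r =>
    ae_zeroSet_subset_regularZeros_chart (b := b) (C.center r) (C.idx r)] with s hs
  rintro z ⟨hz, hzU⟩
  obtain ⟨r, y, hy, rfl⟩ := Set.mem_iUnion.1 (C.iUnion_eq.superset hzU)
  exact hs r y (C.comp_subset r (C.base_subset r hy)) hz

end Regularity

end RandomZeros

end

/-! ### The main theorem -/

theorem mainTheorem12 {m k : ℕ} (hk : 1 ≤ k) (hkm : k ≤ m)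
    -- a compact complex manifold of dimension `m`
    {M : Type*} [TopologicalSpace M] [T2Space M] [CompactSpace M]
    [ChartedSpace (Fin m → ℂ) M] [IsManifold 𝓘(ℂ, Fin m → ℂ) ω M]
    -- holomorphic line bundles with Hermitian metrics
    {L : Fin k → M → Type*} [∀ j x, TopologicalSpace (L j x)]
    [∀ j, TopologicalSpace (TotalSpace ℂ (L j))]
    [∀ j x, AddCommGroup (L j x)] [∀ j x, Module ℂ (L j x)] [∀ j, FiberBundle ℂ (L j)]
    [∀ j, VectorBundle ℂ ℂ (L j)] [∀ j, ContMDiffVectorBundle ω ℂ (L j) 𝓘(ℂ, Fin m → ℂ)]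
    (h : ∀ j, HermitianMetric (m := m) (L j))
    -- subspaces with inner products, and orthonormal bases of them
    (S : ∀ j, Submodule ℂ (HolSection (m := m) (L j)))
    (ip : ∀ j, InnerProductSpace.Core ℂ (S j))
    {n : Fin k → ℕ} (b : ∀ j, Module.Basis (Fin (n j + 1)) ℂ (S j))
    (hb : ∀ j l l', (ip j).inner (b j l) (b j l') = if l = l' then 1 else 0)
    -- an open set without base points
    (U : Set M) (hU : IsOpen U) (hbase : ∀ j, ∀ z ∈ U, ∃ s ∈ S j, s z ≠ 0) :
    -- almost surely, the common zeros in `U` are regular points, without multiplicity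
    (∀ᵐ s ∂(Measure.pi fun j => gaussianMeasure (b j)),
      zeroSet (fun j => (s j : HolSection (m := m) (L j))) ∩ U ⊆
        regularZeros fun j => (s j : HolSection (m := m) (L j))) ∧
    -- the expected zero current of each single section is a smooth form on `U`
    (∀ j, SmoothFormOn (expectedForm (h j) (b j)) U ∧
      ExpectedCurrentEq (gaussianMeasure (b j))
        (fun s => regularZeros fun _ : Fin 1 => (s : HolSection (m := m) (L j))) U
        (q := 1) (hk.trans hkm) (expectedForm (h j) (b j))) ∧
    -- the expected simultaneous zero current is the wedge product of these forms
    ExpectedCurrentEq (Measure.pi fun j => gaussianMeasure (b j))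
      (fun s => regularZeros fun j => (s j : HolSection (m := m) (L j))) U hkm
      (fun x => wedgeAll k fun j => expectedForm (h j) (b j) x) ∧
    -- which are the pull-backs of the Fubini-Study forms by the Kodaira maps
    (∀ x ∈ U, (∀ j, expectedForm (h j) (b j) x =
        pullback (kodairaMap (b j)) (fubiniStudy (n j)) x) ∧
      (wedgeAll k fun j => expectedForm (h j) (b j) x) =
        wedgeAll k fun j => pullback (kodairaMap (b j)) (fubiniStudy (n j)) x) := by
  -- Compactness enters only here: it supplies the countable covers by chart pieces.
  have : SecondCountableTopology M := ChartedSpace.secondCountable_of_sigmaCompact (Fin m → ℂ) M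
  have hbase' (j) (z) (hz : z ∈ U) : ∃ i, (b j i : HolSection (m := m) (L j)) z ≠ 0 :=
    exists_basis_apply_ne_zero (b j) (hbase j z hz)
  have hFS (x) (hx : x ∈ U) (j) : expectedForm (h j) (b j) x =
      pullback (kodairaMap (b j)) (fubiniStudy (n j)) x :=
    expectedForm_eq_pullback_fubiniStudy (h j) (hbase' j x hx)
  exact ⟨ae_zeroSet_inter_subset_regularZeros b hU hbase',
    fun j => ⟨smoothFormOn_expectedForm (h j) (hbase' j),
      expectedCurrentEq_regularZeros_single _ (h j) (b j) hU (hbase' j)⟩,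
    expectedCurrentEq_regularZeros hkm h hU hbase',
    fun x hx => ⟨hFS x hx, congrArg _ (funext (hFS x hx))⟩⟩
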